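/- Let $M$ be an oriented smooth surface with a Riemannian metric $g$, let $\pi:P\to M$ be a smooth principal $\mathbb S^1$-bundle, and let $\omega$ be the connection $1$-form on $P$ of a principal connection $A$ (real valued, with $\mathrm{Lie}(\mathbb S^1)=\mathbb R$ via $t\mapsto e^{it}$, so $\omega(\xi^\#)=1$ for the fundamental vector field $\xi^\#_y=\frac{d}{dt}\big|_{t=0}\,y\,e^{it}$). Let $f:P\to(0,\infty)$ be smooth and $\mathbb S^1$-invariant, and let $g_A=\pi^*g+f^2\,\omega\otimes\omega$ be the connection metric on $P$. Write $F_\omega=d\omega$ for the curvature $2$-form, $K_g$ for the Gauss curvature of $g$, $\nabla$ for the Levi-Civita connection of $g_A$, $*$ for the Hodge star of the oriented surface $(M,g)$ acting on horizontal forms on $P$ through $\pi_*:\ker\omega\cong\pi^*TM$ (so $*\theta^1=\theta^2$, $*\theta^2=-\theta^1$, $*(\theta^1\wedge\theta^2)=1$ for a positive orthonormal horizontal coframe), $|F_\omega|_g=|{*F_\omega}|$ for the induced norm, and $\Delta f=-*d*df$ (the nonnegative Laplacian of $g$ applied to the function on $M$ to which $f$ descends). Let $y\in P$, let $(u_1,u_2)$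 be any $g$-orthonormal basis of $T_{\pi(y)}M$, let $e_1,e_2\in T_yP$ be the horizontal lifts of $u_1,u_2$, and let $e_3=f(y)^{-1}\xi^\#_y$. Then the matrix of the Ricci tensor of $g_A$ in the orthonormal frame $(e_1,e_2,e_3)$ is $$\big(\mathrm{Ric}(g_A)(e_i,e_j)\big)_{i,j}=\begin{pmatrix}\mathcal R&\mathcal S\\ \mathcal S^{t}&\varphi\end{pmatrix},$$ where $\mathcal R=(\mathcal R(e_i,e_j))_{i,j\le 2}$, $\mathcal S=(\mathcal S(e_i,e_3))_{i\le 2}$ and $\varphi$ are given by $$\mathcal R=\Big(\pi^*K_g-\tfrac12 f^2|F_\omega|_g^2\Big)\pi^*g-\tfrac1f\nabla df,$$ $$\mathcal S=-\tfrac12 f^2\,(*d*F_\omega)\otimes\omega-\tfrac32 f\,(*F_\omega)(*df)\otimes\omega,$$ $$\varphi=\tfrac12 f^2|F_\omega|_g^2+\frac{\Delta f}{f}.$$ -/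

import Mathlib

open scoped Manifold ContDiff

noncomputable section

/-! ## Bilinear forms and metrics in a coordinate space -/

/-- The pullback `B(D ·, D ·)` of a bilinear form `B` along a linear map `D`. -/
def bilinPullback {E F : Type*}
    [TopologicalSpace E] [AddCommGroup E] [Module ℝ E] [IsTopologicalAddGroup E]
    [ContinuousSMul ℝ E]
    [TopologicalSpace F] [AddCommGroup F] [Module ℝ F] [IsTopologicalAddGroup F]
    [ContinuousSMul ℝ F]
    (B : F →L[ℝ] F →L[ℝ] ℝ) (D : E →L[ℝ] F) : E →L[ℝ] E →L[ℝ] ℝ :=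
  (ContinuousLinearMap.precomp ℝ D).comp (B.comp D)

/-- The Christoffel map of a metric `G` on (an open subset of) a coordinate space:
`G(Γ(u,v),w) = ½ (∂_u G(v,w) + ∂_v G(u,w) - ∂_w G(u,v))`, i.e. `Γ(u,v) = ∇_u v` for the
Levi-Civita connection and constant vector fields `u`, `v`. -/
def flatChristoffel {E : Type*} [NormedAddCommGroup E] [NormedSpace ℝ E]
    (G : E → E →L[ℝ] E →L[ℝ] ℝ) (z u v : E) : E :=
  (G z).inverse ((1 / 2 : ℝ) •
    (fderiv ℝ G z u v + fderiv ℝ G z v u - ((fderiv ℝ G z).flip u).flip v))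

/-- The Riemann curvature tensor `R(u,v)w = ∇_u ∇_v w - ∇_v ∇_u w` (constant `u`, `v`, `w`) of a
metric `G` in coordinates. -/
def flatCurvature {E : Type*} [NormedAddCommGroup E] [NormedSpace ℝ E]
    (G : E → E →L[ℝ] E →L[ℝ] ℝ) (z u v w : E) : E :=
  fderiv ℝ (fun y => flatChristoffel G y v w) z u
    - fderiv ℝ (fun y => flatChristoffel G y u w) z v
    + flatChristoffel G z u (flatChristoffel G z v w)
    - flatChristoffel G z v (flatChristoffel G z u w)

/-! ## Tensor fields on a manifold, and curvature of a metric -/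

section Manifold

variable {n : ℕ} {N : Type*} [TopologicalSpace N] [ChartedSpace (EuclideanSpace ℝ (Fin n)) N]

/-- The preferred chart of the manifold at `y`, sending the vector `v ∈ T_y N` to its
coordinate vector. -/
def chartVec (y : N) (v : TangentSpace (𝓡 n) y) : EuclideanSpace ℝ (Fin n) :=
  mfderiv (𝓡 n) 𝓘(ℝ, EuclideanSpace ℝ (Fin n)) (extChartAt (𝓡 n) y) y v

/-- The inverse of the preferred chart at `y`. -/
def chartInv (y : N) : EuclideanSpace ℝ (Fin n) → N := (extChartAt (𝓡 n) y).symm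

/-- The differential at `z` of the inverse of the preferred chart at `y`. -/
def chartInvDeriv (y : N) (z : EuclideanSpace ℝ (Fin n)) :
    EuclideanSpace ℝ (Fin n) →L[ℝ] TangentSpace (𝓡 n) (chartInv y z) :=
  mfderiv 𝓘(ℝ, EuclideanSpace ℝ (Fin n)) (𝓡 n) (chartInv y) z

/-- A field of bilinear forms `h` on tangent spaces, written in the preferred chart at `y`. -/
def chartBilin (h : ∀ x : N, TangentSpace (𝓡 n) x →L[ℝ] TangentSpace (𝓡 n) x →L[ℝ] ℝ) (y : N) :
    EuclideanSpace ℝ (Fin n) →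
      EuclideanSpace ℝ (Fin n) →L[ℝ] EuclideanSpace ℝ (Fin n) →L[ℝ] ℝ :=
  fun z => bilinPullback (h (chartInv y z)) (chartInvDeriv y z)

/-- A `1`-form `α`, written in the preferred chart at `y`. -/
def chartForm (α : ∀ x : N, TangentSpace (𝓡 n) x →L[ℝ] ℝ) (y : N) :
    EuclideanSpace ℝ (Fin n) → EuclideanSpace ℝ (Fin n) →L[ℝ] ℝ :=
  fun z => (α (chartInv y z)).comp (chartInvDeriv y z)

/-- The differential `dh` of a function `h`, as a `1`-form. -/
def dFun (h : N → ℝ) (y : N) : TangentSpace (𝓡 n) y →L[ℝ] ℝ :=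
  mfderiv (𝓡 n) 𝓘(ℝ, ℝ) h y

/-- The exterior derivative `dα` of a `1`-form:
`dα(v,w) = ∂_v (α(w)) - ∂_w (α(v))` in coordinates. -/
def dForm (α : ∀ x : N, TangentSpace (𝓡 n) x →L[ℝ] ℝ) (y : N)
    (v w : TangentSpace (𝓡 n) y) : ℝ :=
  fderiv ℝ (chartForm α y) (extChartAt (𝓡 n) y y) (chartVec y v) (chartVec y w)
    - fderiv ℝ (chartForm α y) (extChartAt (𝓡 n) y y) (chartVec y w) (chartVec y v)

/-- The Ricci tensor of the metric `h` at `y`: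
`Ric(v,w)` is the trace of `u ↦ R(u,v)w`. -/
def ricci (h : ∀ x : N, TangentSpace (𝓡 n) x →L[ℝ] TangentSpace (𝓡 n) x →L[ℝ] ℝ) (y : N)
    (v w : TangentSpace (𝓡 n) y) : ℝ :=
  ∑ i : Fin n, flatCurvature (chartBilin h y) (extChartAt (𝓡 n) y y)
    (EuclideanSpace.single i 1) (chartVec y v) (chartVec y w) i

/-- The Hessian `∇dφ` of a function `φ`, for the Levi-Civita connection `∇` of the metric `h`:
`(∇dφ)(v,w) = ∂_v ∂_w φ - dφ(Γ(v,w))` in coordinates. -/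
def hessian (h : ∀ x : N, TangentSpace (𝓡 n) x →L[ℝ] TangentSpace (𝓡 n) x →L[ℝ] ℝ) (φ : N → ℝ)
    (y : N) (v w : TangentSpace (𝓡 n) y) : ℝ :=
  fderiv ℝ (fderiv ℝ (φ ∘ chartInv y)) (extChartAt (𝓡 n) y y) (chartVec y v) (chartVec y w)
    - fderiv ℝ (φ ∘ chartInv y) (extChartAt (𝓡 n) y y)
        (flatChristoffel (chartBilin h y) (extChartAt (𝓡 n) y y) (chartVec y v) (chartVec y w))

end Manifold

/-! ## Oriented Riemannian surfaces -/

section Surface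

variable {M : Type*} [TopologicalSpace M] [ChartedSpace (EuclideanSpace ℝ (Fin 2)) M]

/-- The Gauss curvature of a metric `g` on a surface:
`K = g(R(u,v)v,u) / (g(u,u)g(v,v) - g(u,v)²)` for a basis `u`, `v` (here the coordinate one). -/
def gaussCurvature (g : ∀ x : M, TangentSpace (𝓡 2) x →L[ℝ] TangentSpace (𝓡 2) x →L[ℝ] ℝ)
    (x : M) : ℝ :=
  let G := chartBilin g x
  let z := extChartAt (𝓡 2) x x
  let u : EuclideanSpace ℝ (Fin 2) := EuclideanSpace.single 0 1
  let v : EuclideanSpace ℝ (Fin 2) := EuclideanSpace.single 1 1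
  G z (flatCurvature G z u v v) u / (G z u u * G z v v - G z u v ^ 2)

/-- `vol` is the Riemannian area form of `g` for an orientation of the surface, i.e. a smooth
`2`-form of unit length. (Orientations of `M` correspond bijectively to such forms.) -/
structure IsAreaForm (g : ∀ x : M, TangentSpace (𝓡 2) x →L[ℝ] TangentSpace (𝓡 2) x →L[ℝ] ℝ)
    [IsManifold (𝓡 2) ∞ M]
    (vol : ∀ x : M, TangentSpace (𝓡 2) x →L[ℝ] TangentSpace (𝓡 2) x →L[ℝ] ℝ) : Prop where
  smooth : ContMDiff (𝓡 2)
    ((𝓡 2).prod 𝓘(ℝ, EuclideanSpace ℝ (Fin 2) →L[ℝ] EuclideanSpace ℝ (Fin 2) →L[ℝ] ℝ)) ∞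
    (fun x => Bundle.TotalSpace.mk'
      (EuclideanSpace ℝ (Fin 2) →L[ℝ] EuclideanSpace ℝ (Fin 2) →L[ℝ] ℝ)
      (E := fun x : M => TangentSpace (𝓡 2) x →L[ℝ] TangentSpace (𝓡 2) x →L[ℝ] ℝ) x (vol x))
  alternating : ∀ (x : M) (u : TangentSpace (𝓡 2) x), vol x u u = 0
  unit : ∀ (x : M) (u v : TangentSpace (𝓡 2) x),
    vol x u v ^ 2 = g x u u * g x v v - g x u v ^ 2

/-- The rightRotation `J` by a right angle: `g(J u, v) = vol(u, v)`, so that `J e₁ = e₂`, `J e₂ = -e₁`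
for a positive orthonormal basis. -/
def rightRotation (g vol : ∀ x : M, TangentSpace (𝓡 2) x →L[ℝ] TangentSpace (𝓡 2) x →L[ℝ] ℝ) (x : M) :
    TangentSpace (𝓡 2) x →L[ℝ] TangentSpace (𝓡 2) x :=
  (g x).inverse.comp (vol x)

/-- A basis of `T_x M`. -/
def tangentBasis (x : M) (i : Fin 2) : TangentSpace (𝓡 2) x :=
  (EuclideanSpace.single i 1 : EuclideanSpace ℝ (Fin 2))

/-- The Hodge star of an alternating form `β` of degree `2` on `T_x M`: the number `*β` with
`β = (*β) vol`, computed in any basis. -/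
def starTwo (vol : ∀ x : M, TangentSpace (𝓡 2) x →L[ℝ] TangentSpace (𝓡 2) x →L[ℝ] ℝ) (x : M)
    (β : TangentSpace (𝓡 2) x → TangentSpace (𝓡 2) x → ℝ) : ℝ :=
  β (tangentBasis x 0) (tangentBasis x 1) / vol x (tangentBasis x 0) (tangentBasis x 1)

/-- The squared `g`-norm of an alternating form `β` of degree `2` on `T_x M`:
`|β|² = β(u,v)² / |u ∧ v|²` for any basis `u`, `v`; it equals `β(e₁,e₂)²` for an orthonormal
basis. -/
def normSqTwo (g : ∀ x : M, TangentSpace (𝓡 2) x →L[ℝ] TangentSpace (𝓡 2) x →L[ℝ] ℝ) (x : M)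
    (β : TangentSpace (𝓡 2) x → TangentSpace (𝓡 2) x → ℝ) : ℝ :=
  β (tangentBasis x 0) (tangentBasis x 1) ^ 2 /
    (g x (tangentBasis x 0) (tangentBasis x 0) * g x (tangentBasis x 1) (tangentBasis x 1)
      - g x (tangentBasis x 0) (tangentBasis x 1) ^ 2)

end Surface

/-! ## Principal circle bundles over surfaces, with connection -/

section Bundle

variable {M : Type*} [TopologicalSpace M] [ChartedSpace (EuclideanSpace ℝ (Fin 2)) M]
variable {P : Type*} [TopologicalSpace P] [ChartedSpace (EuclideanSpace ℝ (Fin 3)) P]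

/-- `π : P → M` is a smooth principal circle bundle (the circle being commutative, its right
action on `P` is written as a left action). -/
structure IsPrincipalCircleBundle [MulAction Circle P] (π : P → M) : Prop where
  smooth_smul : ContMDiff ((𝓡 1).prod (𝓡 3)) (𝓡 3) ∞ (fun p : Circle × P => p.1 • p.2)
  smooth_proj : ContMDiff (𝓡 3) (𝓡 2) ∞ π
  proj_smul : ∀ (a : Circle) (y : P), π (a • y) = π y
  locally_trivial : ∀ x : M, ∃ t : Bundle.Trivialization Circle π, x ∈ t.baseSet ∧
    ContMDiffOn (𝓡 3) ((𝓡 2).prod (𝓡 1)) ∞ t t.source ∧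
    ContMDiffOn ((𝓡 2).prod (𝓡 1)) (𝓡 3) ∞ t.toOpenPartialHomeomorph.symm t.target ∧
    ∀ (a : Circle) (y : P), y ∈ t.source → t (a • y) = ((t y).1, a * (t y).2)

/-- The fundamental vector field `ξ^#` of the circle action:
`ξ^#_y = d/ds (y · exp(i s))` at `s = 0`. -/
def fundamentalField [MulAction Circle P] (y : P) : TangentSpace (𝓡 3) y :=
  (show TangentSpace (𝓡 3) y from
    (mfderiv 𝓘(ℝ, ℝ) (𝓡 3) (fun s : ℝ => Circle.exp s • y) 0 (1 : ℝ) :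
      EuclideanSpace ℝ (Fin 3)))

/-- `ωA` is the connection `1`-form of a principal connection. -/
structure IsConnectionForm [MulAction Circle P] [IsManifold (𝓡 3) ∞ P]
    (ωA : ∀ y : P, TangentSpace (𝓡 3) y →L[ℝ] ℝ) : Prop where
  smooth : ContMDiff (𝓡 3) ((𝓡 3).prod 𝓘(ℝ, EuclideanSpace ℝ (Fin 3) →L[ℝ] ℝ)) ∞
    (fun y => Bundle.TotalSpace.mk' (EuclideanSpace ℝ (Fin 3) →L[ℝ] ℝ)
      (E := fun y : P => TangentSpace (𝓡 3) y →L[ℝ] ℝ) y (ωA y))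
  fundamental : ∀ y : P, ωA y (fundamentalField y) = 1
  invariant : ∀ (a : Circle) (y : P) (v : TangentSpace (𝓡 3) y),
    ωA (a • y) (mfderiv (𝓡 3) (𝓡 3) (fun q : P => a • q) y v) = ωA y v

/-- The differential `π_*` of the bundle projection at `y`. -/
def projDeriv (π : P → M) (y : P) : TangentSpace (𝓡 3) y →L[ℝ] TangentSpace (𝓡 2) (π y) :=
  mfderiv (𝓡 3) (𝓡 2) π y

/-- The horizontal lift at `y` of `u ∈ T_{π y} M`: the vector `v` with `π_* v = u`, `ωA(v) = 0`. -/
def horizontalLift (π : P → M) (ωA : ∀ y : P, TangentSpace (𝓡 3) y →L[ℝ] ℝ) (y : P)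
    (u : TangentSpace (𝓡 2) (π y)) : TangentSpace (𝓡 3) y :=
  ((projDeriv π y).prod (ωA y)).inverse (u, 0)

/-- The connection metric `g_A = π^* g + f² ωA ⊗ ωA`. -/
def connectionMetric (π : P → M)
    (g : ∀ x : M, TangentSpace (𝓡 2) x →L[ℝ] TangentSpace (𝓡 2) x →L[ℝ] ℝ)
    (ωA : ∀ y : P, TangentSpace (𝓡 3) y →L[ℝ] ℝ) (f : P → ℝ) (y : P) :
    TangentSpace (𝓡 3) y →L[ℝ] TangentSpace (𝓡 3) y →L[ℝ] ℝ :=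
  bilinPullback (g (π y)) (projDeriv π y) + (f y ^ 2) • (ωA y).smulRight (ωA y)

/-- The Hodge star of the oriented surface `(M, g)`, acting on horizontal `1`-forms on `P` by means
of `π_* : ker ωA ≃ π^* TM`: `(*α)(v) = -α(lift of J (π_* v))`, so that `*θ¹ = θ²`, `*θ² = -θ¹`. -/
def hstarOne (π : P → M)
    (g vol : ∀ x : M, TangentSpace (𝓡 2) x →L[ℝ] TangentSpace (𝓡 2) x →L[ℝ] ℝ)
    (ωA : ∀ y : P, TangentSpace (𝓡 3) y →L[ℝ] ℝ) (α : ∀ y : P, TangentSpace (𝓡 3) y →L[ℝ] ℝ)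
    (y : P) : TangentSpace (𝓡 3) y →L[ℝ] ℝ :=
  -((α y).comp ((((projDeriv π y).prod (ωA y)).inverse).comp
    ((ContinuousLinearMap.inl ℝ (TangentSpace (𝓡 2) (π y)) ℝ).comp
      ((rightRotation g vol (π y)).comp (projDeriv π y)))))

/-- The Hodge star of the oriented surface `(M, g)` on horizontal `2`-forms on `P`: the function
`*β` on `P` with `β = (*β) π^* vol`, so that `*(θ¹ ∧ θ²) = 1`. -/
def hstarTwo (π : P → M)
    (vol : ∀ x : M, TangentSpace (𝓡 2) x →L[ℝ] TangentSpace (𝓡 2) x →L[ℝ] ℝ)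
    (ωA : ∀ y : P, TangentSpace (𝓡 3) y →L[ℝ] ℝ)
    (β : ∀ y : P, TangentSpace (𝓡 3) y → TangentSpace (𝓡 3) y → ℝ) (y : P) : ℝ :=
  starTwo vol (π y) (fun u v => β y (horizontalLift π ωA y u) (horizontalLift π ωA y v))

/-- The squared norm `|β|²_g` of a horizontal `2`-form on `P`. -/
def hnormSqTwo (π : P → M)
    (g : ∀ x : M, TangentSpace (𝓡 2) x →L[ℝ] TangentSpace (𝓡 2) x →L[ℝ] ℝ)
    (ωA : ∀ y : P, TangentSpace (𝓡 3) y →L[ℝ] ℝ)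
    (β : ∀ y : P, TangentSpace (𝓡 3) y → TangentSpace (𝓡 3) y → ℝ) (y : P) : ℝ :=
  normSqTwo g (π y) (fun u v => β y (horizontalLift π ωA y u) (horizontalLift π ωA y v))

/-- The curvature form `F_ω = dω` (the circle is commutative). -/
def curvatureForm (ωA : ∀ y : P, TangentSpace (𝓡 3) y →L[ℝ] ℝ) (y : P)
    (v w : TangentSpace (𝓡 3) y) : ℝ :=
  dForm ωA y v w

/-- The Laplacian `Δ f = - * d * d f` of an invariant function on `P`, with the Hodge star of the
surface: the nonnegative Laplacian of `(M, g)` applied to the function on `M` that `f` descends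
to. -/
def baseLaplacian (π : P → M)
    (g vol : ∀ x : M, TangentSpace (𝓡 2) x →L[ℝ] TangentSpace (𝓡 2) x →L[ℝ] ℝ)
    (ωA : ∀ y : P, TangentSpace (𝓡 3) y →L[ℝ] ℝ) (f : P → ℝ) (y : P) : ℝ :=
  -hstarTwo π vol ωA (dForm (hstarOne π g vol ωA (dFun f))) y

/-- The adapted frame `(e₁, e₂, e₃)` of `T_y P`: the horizontal lifts of `u₁`, `u₂ ∈ T_{π y} M`, and
`e₃ = ξ^# / f`. -/
def adaptedFrame [MulAction Circle P] (π : P → M) (ωA : ∀ y : P, TangentSpace (𝓡 3) y →L[ℝ] ℝ)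
    (f : P → ℝ) (y : P) (u : Fin 2 → TangentSpace (𝓡 2) (π y)) :
    Fin 2 ⊕ Fin 1 → TangentSpace (𝓡 3) y :=
  Sum.elim (fun i => horizontalLift π ωA y (u i)) (fun _ => (f y)⁻¹ • fundamentalField y)

/-- The bilinear form `𝓡 = (π^* K_g - ½ f² |F_ω|²_g) π^* g - (1/f) ∇df`, where `∇` is the
Levi-Civita connection of the connection metric. -/
def horizontalBlock (π : P → M)
    (g : ∀ x : M, TangentSpace (𝓡 2) x →L[ℝ] TangentSpace (𝓡 2) x →L[ℝ] ℝ)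
    (ωA : ∀ y : P, TangentSpace (𝓡 3) y →L[ℝ] ℝ) (f : P → ℝ) (y : P)
    (v w : TangentSpace (𝓡 3) y) : ℝ :=
  (gaussCurvature g (π y) - 1 / 2 * f y ^ 2 * hnormSqTwo π g ωA (curvatureForm ωA) y)
      * g (π y) (projDeriv π y v) (projDeriv π y w)
    - 1 / f y * hessian (connectionMetric π g ωA f) f y v w

/-- The bilinear form `𝓢 = - ½ f² (* d * F_ω) ⊗ ωA - (3/2) f (* F_ω) (* df) ⊗ ωA`. -/
def mixedBlock (π : P → M)
    (g vol : ∀ x : M, TangentSpace (𝓡 2) x →L[ℝ] TangentSpace (𝓡 2) x →L[ℝ] ℝ)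
    (ωA : ∀ y : P, TangentSpace (𝓡 3) y →L[ℝ] ℝ) (f : P → ℝ) (y : P)
    (v w : TangentSpace (𝓡 3) y) : ℝ :=
  -(1 / 2) * f y ^ 2 *
      hstarOne π g vol ωA (dFun (hstarTwo π vol ωA (curvatureForm ωA))) y v * ωA y w
    - 3 / 2 * f y * hstarTwo π vol ωA (curvatureForm ωA) y
      * hstarOne π g vol ωA (dFun f) y v * ωA y w

/-- The function `φ = ½ f² |F_ω|²_g + Δf / f`. -/
def verticalBlock (π : P → M)
    (g vol : ∀ x : M, TangentSpace (𝓡 2) x →L[ℝ] TangentSpace (𝓡 2) x →L[ℝ] ℝ)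
    (ωA : ∀ y : P, TangentSpace (𝓡 3) y →L[ℝ] ℝ) (f : P → ℝ) (y : P) : ℝ :=
  1 / 2 * f y ^ 2 * hnormSqTwo π g ωA (curvatureForm ωA) y + baseLaplacian π g vol ωA f y / f y

end Bundle

end

/-! The proof is Cartan's method of moving frames, carried out in the preferred chart at `y`. Write
`κ` for the connection form and pull back to `P` an orthonormal coframe `θ₀, θ₁` of the surface,
with connection form `α`. Together with `θ₂ = f κ` it is an orthonormal coframe of the connection
metric, and it satisfies dθ₀ = -α ∧ θ₁, dθ₁ = α ∧ θ₀, dκ = F θ₀ ∧ θ₁, df = f₀ θ₀ + f₁ θ₁, dα = K θ₀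
∧ θ₁. The third equation says that the curvature is horizontal, which is the invariance of `κ` in
infinitesimal form (`IsPrincipalCircleBundle.dForm_fundamentalField`); the fourth is the invariance
of `f`.

These equations determine the connection forms η₀₁ = α - ½ f² F κ, η₀₂ = -(f₀ κ + ½ f F θ₁), η₁₂ = ½
f F θ₀ - f₁ κ (`IsCircleFrame.isMovingFrame`). The curvature of the metric is dη + η ∧ η
(`IsMovingFrame.curvature`), and its trace in the frame is the Ricci tensor
(`IsMovingFrame.ricci_trace`). Since `F`, `f₀`, `f₁` have no vertical derivative, the trace reduces
to the stated blocks (`IsCircleFrame.ricci`).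

It remains to build such a frame with the prescribed values at `y` (`exists_isBaseFrame`,
`isCircleFrame_projChart`) and to express the Hodge stars, norms and Laplacian in it. The basis `u`
may be negatively oriented, so a sign `s` enters with every Hodge star; the stars come in pairs, and
`s * s = 1` removes it. -/

open scoped Topology

noncomputable section

/-! ## Exterior derivative of one-forms on a normed space -/

section Flat

variable {E F : Type*} [NormedAddCommGroup E] [NormedSpace ℝ E]
  [NormedAddCommGroup F] [NormedSpace ℝ F]

/-- The exterior derivative of a one-form on a normed space, as a bilinear expression. -/
def extD (α : E → E →L[ℝ] ℝ) (z u v : E) : ℝ := fderiv ℝ α z u v - fderiv ℝ α z v u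

theorem extD_antisymm (α : E → E →L[ℝ] ℝ) (z u v : E) : extD α z u v = -extD α z v u := by
  simp [extD]

theorem extD_self (α : E → E →L[ℝ] ℝ) (z u : E) : extD α z u u = 0 := by simp [extD]

theorem extD_congr {α β : E → E →L[ℝ] ℝ} {z : E} (h : α =ᶠ[𝓝 z] β) (u v : E) :
    extD α z u v = extD β z u v := by
  simp only [extD, h.fderiv_eq]

theorem extD_add {α β : E → E →L[ℝ] ℝ} {z : E} (hα : DifferentiableAt ℝ α z)
    (hβ : DifferentiableAt ℝ β z) (u v : E) :
    extD (fun y => α y + β y) z u v = extD α z u v + extD β z u v := by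
  simp only [extD, fderiv_fun_add hα hβ, add_apply]; ring

theorem extD_sub {α β : E → E →L[ℝ] ℝ} {z : E} (hα : DifferentiableAt ℝ α z)
    (hβ : DifferentiableAt ℝ β z) (u v : E) :
    extD (fun y => α y - β y) z u v = extD α z u v - extD β z u v := by
  simp only [extD, fderiv_fun_sub hα hβ, sub_apply]; ring

theorem extD_neg (α : E → E →L[ℝ] ℝ) (z u v : E) :
    extD (fun y => -α y) z u v = -extD α z u v := by
  simp only [extD, fderiv_fun_neg, neg_apply]; ring

theorem extD_smul {h : E → ℝ} {α : E → E →L[ℝ] ℝ} {z : E} (hh : DifferentiableAt ℝ h z)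
    (hα : DifferentiableAt ℝ α z) (u v : E) :
    extD (fun y => h y • α y) z u v =
      fderiv ℝ h z u * α z v - fderiv ℝ h z v * α z u + h z * extD α z u v := by
  simp only [extD, fderiv_fun_smul hh hα, add_apply,
    smul_apply, ContinuousLinearMap.smulRight_apply, smul_eq_mul]
  ring

theorem ContDiffAt.fderiv_infty {h : E → F} {z : E} (hh : ContDiffAt ℝ ∞ h z) :
    ContDiffAt ℝ ∞ (fderiv ℝ h) z :=
  hh.fderiv_right (by norm_cast)

theorem ContDiffAt.eventually_differentiableAt {h : E → F} {z : E} (hh : ContDiffAt ℝ ∞ h z) :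
    ∀ᶠ y in 𝓝 z, DifferentiableAt ℝ h y :=
  ((hh.of_le (m := 1) (by norm_cast)).eventually (by decide)).mono
    fun _ hy => hy.differentiableAt (by norm_num)

theorem ContDiffAt.differentiableAt_infty {h : E → F} {z : E} (hh : ContDiffAt ℝ ∞ h z) :
    DifferentiableAt ℝ h z :=
  hh.differentiableAt (by norm_num)

theorem ContDiffAt.fderiv_fderiv_symm {h : E → F} {z : E} (hh : ContDiffAt ℝ ∞ h z) (u v : E) :
    fderiv ℝ (fderiv ℝ h) z u v = fderiv ℝ (fderiv ℝ h) z v u :=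
  (hh.isSymmSndFDerivAt (by simp; norm_cast)).eq u v

theorem extD_fderiv {h : E → ℝ} {z : E} (hh : ContDiffAt ℝ ∞ h z) (u v : E) :
    extD (fderiv ℝ h) z u v = 0 := by
  simp [extD, hh.fderiv_fderiv_symm u v]

theorem fderiv_fderiv_apply_const {α : E → E →L[ℝ] F} {z : E} (hα : DifferentiableAt ℝ α z)
    (u v : E) : fderiv ℝ (fun y => α y v) z u = fderiv ℝ α z u v := by
  rw [fderiv_clm_apply hα (differentiableAt_const _)]
  simp

theorem differentiableAt_smulRight {α : E → E →L[ℝ] ℝ} {β : E → F} {z : E}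
    (hα : DifferentiableAt ℝ α z) (hβ : DifferentiableAt ℝ β z) :
    DifferentiableAt ℝ (fun y => (α y).smulRight (β y)) z :=
  DifferentiableAt.comp (g := fun q : (E →L[ℝ] ℝ) × F => q.1.smulRight q.2) z
    (isBoundedBilinearMap_smulRight.differentiableAt (α z, β z)) (hα.prodMk hβ)

/-- The pullback of a one-form along a map. -/
def pullForm (p : E → F) (α : F → F →L[ℝ] ℝ) (z : E) : E →L[ℝ] ℝ := (α (p z)).comp (fderiv ℝ p z)

theorem ContDiffAt.pullForm {p : E → F} {α : F → F →L[ℝ] ℝ} {z : E} (hp : ContDiffAt ℝ ∞ p z)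
    (hα : ContDiffAt ℝ ∞ α (p z)) : ContDiffAt ℝ ∞ (pullForm p α) z :=
  (hα.comp z hp).clm_comp hp.fderiv_infty

/-- The second derivative of `p` enters only through a term symmetric in `u`, `v`, and
antisymmetrizing kills it. -/
theorem extD_pullForm {p : E → F} {α : F → F →L[ℝ] ℝ} {z : E} (hp : ContDiffAt ℝ 2 p z)
    (hα : DifferentiableAt ℝ α (p z)) (u v : E) :
    extD (pullForm p α) z u v = extD α (p z) (fderiv ℝ p z u) (fderiv ℝ p z v) := by
  have hp1 : DifferentiableAt ℝ p z := hp.differentiableAt (by norm_num)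
  have hp2 : DifferentiableAt ℝ (fderiv ℝ p) z :=
    (hp.fderiv_right (m := 1) (by norm_num)).differentiableAt (by norm_num)
  have hs : fderiv ℝ (fderiv ℝ p) z u v = fderiv ℝ (fderiv ℝ p) z v u :=
    (hp.isSymmSndFDerivAt (by simp)).eq u v
  have hc : fderiv ℝ (fun y => α (p y)) z = (fderiv ℝ α (p z)).comp (fderiv ℝ p z) :=
    fderiv_fun_comp z hα hp1
  have : fderiv ℝ (pullForm p α) z = _ :=
    fderiv_clm_comp (c := fun y => α (p y)) (hα.comp z hp1) hp2
  simp only [extD, this, hc]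
  simp [hs]

/-! ## Moving frames -/

/-- An orthonormal moving frame `e` with coframe `θ` for the metric `G` near `z₀`, together with
its matrix `η` of connection one-forms. -/
structure IsMovingFrame {ι : Type*} [Fintype ι] [DecidableEq ι] (G : E → E →L[ℝ] E →L[ℝ] ℝ)
    (θ : ι → E → E →L[ℝ] ℝ) (e : ι → E → E) (η : ι → ι → E → E →L[ℝ] ℝ) (z₀ : E) : Prop where
  smooth_coframe : ∀ i, ContDiffAt ℝ ∞ (θ i) z₀
  smooth_frame : ∀ i, ContDiffAt ℝ ∞ (e i) z₀
  smooth_conn : ∀ i j, ContDiffAt ℝ ∞ (η i j) z₀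
  expand : ∀ᶠ z in 𝓝 z₀, ∀ v, ∑ i, θ i z v • e i z = v
  dual : ∀ᶠ z in 𝓝 z₀, ∀ i j, θ i z (e j z) = if i = j then 1 else 0
  metric : ∀ᶠ z in 𝓝 z₀, ∀ u v, G z u v = ∑ i, θ i z u * θ i z v
  skew : ∀ᶠ z in 𝓝 z₀, ∀ i j u, η i j z u = -η j i z u
  cartan : ∀ᶠ z in 𝓝 z₀, ∀ i u v,
    extD (θ i) z u v = -∑ j, (η i j z u * θ j z v - η i j z v * θ j z u)

theorem isInvertible_of_injective [FiniteDimensional ℝ E] [FiniteDimensional ℝ F]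
    (A : E →L[ℝ] F) (hd : Module.finrank ℝ E = Module.finrank ℝ F)
    (h : Function.Injective A) : A.IsInvertible := by
  have hs : Function.Surjective A :=
    (LinearMap.injective_iff_surjective_of_finrank_eq_finrank (f := (A : E →ₗ[ℝ] F)) hd).1 h
  exact ⟨(LinearEquiv.ofBijective (A : E →ₗ[ℝ] F) ⟨h, hs⟩).toContinuousLinearEquiv, by ext; rfl⟩

theorem finrank_clm_real [FiniteDimensional ℝ E] :
    Module.finrank ℝ (E →L[ℝ] ℝ) = Module.finrank ℝ E := by
  rw [← (LinearMap.toContinuousLinearMap (𝕜 := ℝ) (E := E) (F' := ℝ)).finrank_eq]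
  exact Subspace.dual_finrank_eq

/-- Guards against the default value of `ContinuousLinearMap.inverse`, which is zero on maps that
are not invertible; the Christoffel map is defined through that inverse. -/
theorem isInvertible_of_nondegenerate [FiniteDimensional ℝ E] (B : E →L[ℝ] E →L[ℝ] ℝ)
    (h : ∀ v, B v v = 0 → v = 0) : B.IsInvertible := by
  refine isInvertible_of_injective B finrank_clm_real.symm ?_
  rw [injective_iff_map_eq_zero]
  intro v hv
  exact h v (by simp [hv])

variable {ι : Type*} [Fintype ι]

/-- Infinitesimal form of the invariance of the dot product under rotations; it gives compatibility
of a skew connection matrix with the metric. -/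
theorem sum_skew_eq_zero (A : ι → ι → ℝ) (hA : ∀ i j, A i j = -A j i) (a b : ι → ℝ) :
    ∑ i, (∑ j, A i j * a j) * b i + ∑ i, a i * ∑ j, A i j * b j = 0 := by
  simp only [Finset.sum_mul, Finset.mul_sum]
  rw [Finset.sum_comm, ← Finset.sum_add_distrib]
  refine Finset.sum_eq_zero fun i _ => ?_
  rw [← Finset.sum_add_distrib]
  refine Finset.sum_eq_zero fun j _ => ?_
  rw [hA j i]; ring

variable [DecidableEq ι] {G : E → E →L[ℝ] E →L[ℝ] ℝ}
  {θ : ι → E → E →L[ℝ] ℝ} {e : ι → E → E} {η : ι → ι → E → E →L[ℝ] ℝ} {z₀ : E}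

/-- Uniqueness of the Levi-Civita connection: the right side is torsion-free by the structure
equation and metric by skewness of `η`, and the Koszul formula leaves only one such map. The
identity is needed near `z₀`, since curvature differentiates it. -/
theorem IsMovingFrame.christoffel [FiniteDimensional ℝ E] (h : IsMovingFrame G θ e η z₀) :
    ∀ᶠ z in 𝓝 z₀, ∀ u v, flatChristoffel G z u v =
      ∑ i, (fderiv ℝ (θ i) z u v + ∑ j, η i j z u * θ j z v) • e i z := by
  have hd : ∀ᶠ z in 𝓝 z₀, ∀ i, DifferentiableAt ℝ (θ i) z :=
    Filter.eventually_all.2 fun i => (h.smooth_coframe i).eventually_differentiableAt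
  filter_upwards [hd, h.expand, h.dual, h.metric, h.metric.eventually_nhds, h.skew, h.cartan]
    with z hd hexp hdual hmet hmetn hskew hcar u v
  have hGd : DifferentiableAt ℝ G z := by
    have hG : G =ᶠ[𝓝 z] fun y => ∑ i, (θ i y).smulRight (θ i y) := by
      filter_upwards [hmetn] with y hy
      ext a b
      simp [hy, sum_apply]
    rw [hG.differentiableAt_iff]
    exact DifferentiableAt.fun_sum fun i _ => differentiableAt_smulRight (hd i) (hd i)
  have hDG : ∀ a b c, fderiv ℝ G z a b c =
      ∑ i, (fderiv ℝ (θ i) z a b * θ i z c + θ i z b * fderiv ℝ (θ i) z a c) := by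
    intro a b c
    have hGb : DifferentiableAt ℝ (fun y => G y b) z := hGd.clm_apply (differentiableAt_const _)
    have hG : (fun y => G y b c) =ᶠ[𝓝 z] fun y => ∑ i, θ i y b * θ i y c :=
      hmetn.mono fun y hy => hy b c
    have hb : ∀ i x, DifferentiableAt ℝ (fun y => θ i y x) z := fun i x =>
      (hd i).clm_apply (differentiableAt_const _)
    rw [← fderiv_fderiv_apply_const hGd, ← fderiv_fderiv_apply_const hGb, hG.fderiv_eq,
      fderiv_fun_sum (fun i _ => (hb i b).fun_mul (hb i c))]
    simp only [sum_apply, fderiv_fun_mul (hb _ b) (hb _ c), add_apply, smul_apply, smul_eq_mul,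
      fderiv_fderiv_apply_const (hd _)]
    exact Finset.sum_congr rfl fun i _ => by ring
  -- The `i`-th frame component of the candidate for `∇_a b`, with `a`, `b` constant.
  set T : E → E → ι → ℝ := fun a b i => fderiv ℝ (θ i) z a b + ∑ j, η i j z a * θ j z b with hT
  have hsymm : ∀ a b i, T a b i = T b a i := by
    intro a b i
    have := hcar i a b
    rw [Finset.sum_sub_distrib, extD] at this
    simp only [hT]; linarith
  have hcomp : ∀ a b c, fderiv ℝ G z a b c = ∑ i, T a b i * θ i z c + ∑ i, θ i z b * T a c i := by
    intro a b c
    have := sum_skew_eq_zero (fun i j => η i j z a) (fun i j => hskew i j a) (fun i => θ i z b)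
      (fun i => θ i z c)
    rw [hDG]
    simp only [hT, add_mul, mul_add, Finset.sum_add_distrib]
    linarith
  have hinv : (G z).IsInvertible := by
    refine isInvertible_of_nondegenerate _ fun v hv => ?_
    rw [hmet, Finset.sum_eq_zero_iff_of_nonneg (fun i _ => mul_self_nonneg _)] at hv
    rw [← hexp v]
    refine Finset.sum_eq_zero fun i hi => ?_
    rw [mul_self_eq_zero.1 (hv i hi), zero_smul]
  have hθ : ∀ i, θ i z (∑ k, T u v k • e k z) = T u v i := by
    intro i
    simp [map_sum, hdual]
  -- Koszul formula: metricity expands each derivative of `G` into two terms, and symmetry of `T`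
  -- cancels all but `T u v`.
  have key : G z (∑ k, T u v k • e k z) = (1 / 2 : ℝ) •
      (fderiv ℝ G z u v + fderiv ℝ G z v u - ((fderiv ℝ G z).flip u).flip v) := by
    ext w
    rw [hmet]
    simp only [hθ, smul_apply, sub_apply,
      add_apply, ContinuousLinearMap.flip_apply, hcomp, smul_eq_mul]
    have e1 : ∑ i, T v u i * θ i z w = ∑ i, T u v i * θ i z w :=
      Finset.sum_congr rfl fun i _ => by rw [hsymm v u]
    have e2 : ∑ i, T w u i * θ i z v = ∑ i, θ i z v * T u w i :=
      Finset.sum_congr rfl fun i _ => by rw [hsymm w u]; ring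
    have e3 : ∑ i, θ i z u * T w v i = ∑ i, θ i z u * T v w i :=
      Finset.sum_congr rfl fun i _ => by rw [hsymm w v]
    rw [e1, e2, e3]; ring
  rw [flatChristoffel, ← key]
  exact hinv.inverse_apply_eq.2 rfl

/-- The curvature two-forms of a matrix of connection one-forms. -/
def frameCurvature (η : ι → ι → E → E →L[ℝ] ℝ) (z : E) (i j : ι) (u v : E) : ℝ :=
  extD (η i j) z u v + ∑ k, (η i k z u * η k j z v - η i k z v * η k j z u)

theorem IsMovingFrame.christoffel_coframe [FiniteDimensional ℝ E] (h : IsMovingFrame G θ e η z₀) :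
    ∀ᶠ z in 𝓝 z₀, ∀ i u v, θ i z (flatChristoffel G z u v) =
      fderiv ℝ (θ i) z u v + ∑ j, η i j z u * θ j z v := by
  filter_upwards [h.christoffel, h.dual] with z hz hdual i u v
  rw [hz]
  simp [map_sum, hdual]

/-- The second structure equation. Differentiating the coframe components of the Christoffel map and
antisymmetrizing in `u`, `v` leaves only dη + η ∧ η: second derivatives of `θ` are symmetric, and so
are the mixed products of `η` with the derivative of `θ`. -/
theorem IsMovingFrame.curvature [FiniteDimensional ℝ E] (h : IsMovingFrame G θ e η z₀)
    (u v w : E) : flatCurvature G z₀ u v w =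
      ∑ i, (∑ j, frameCurvature η z₀ i j u v * θ j z₀ w) • e i z₀ := by
  have hθd : ∀ i, DifferentiableAt ℝ (θ i) z₀ := fun i =>
    (h.smooth_coframe i).differentiableAt_infty
  have hθ2 : ∀ i, DifferentiableAt ℝ (fderiv ℝ (θ i)) z₀ := fun i =>
    (h.smooth_coframe i).fderiv_infty.differentiableAt_infty
  have hηd : ∀ i j, DifferentiableAt ℝ (η i j) z₀ := fun i j =>
    (h.smooth_conn i j).differentiableAt_infty
  have hed : ∀ i, DifferentiableAt ℝ (e i) z₀ := fun i =>
    (h.smooth_frame i).differentiableAt_infty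
  have hTd : ∀ i b c, HasFDerivAt
      (fun z => fderiv ℝ (θ i) z b c + ∑ j, η i j z b * θ j z c)
      (((fderiv ℝ (fderiv ℝ (θ i)) z₀).flip b).flip c
        + ∑ j, (η i j z₀ b • (fderiv ℝ (θ j) z₀).flip c
          + θ j z₀ c • (fderiv ℝ (η i j) z₀).flip b)) z₀ := by
    intro i b c
    refine HasFDerivAt.add ?_ (HasFDerivAt.fun_sum fun j _ => ?_)
    · have := ((hθ2 i).hasFDerivAt.clm_apply (hasFDerivAt_const b z₀)).clm_apply
        (hasFDerivAt_const c z₀)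
      refine this.congr_fderiv ?_
      ext x; simp
    · have h1 := (hηd i j).hasFDerivAt.clm_apply (hasFDerivAt_const b z₀)
      have h2 := (hθd j).hasFDerivAt.clm_apply (hasFDerivAt_const c z₀)
      refine (h1.mul h2).congr_fderiv ?_
      ext x; simp
  have hΓd : ∀ b c, DifferentiableAt ℝ (fun z => flatChristoffel G z b c) z₀ := by
    intro b c
    have : (fun z => flatChristoffel G z b c) =ᶠ[𝓝 z₀] fun z =>
        ∑ i, (fderiv ℝ (θ i) z b c + ∑ j, η i j z b * θ j z c) • e i z :=
      h.christoffel.mono fun z hz => hz b c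
    rw [this.differentiableAt_iff]
    exact DifferentiableAt.fun_sum fun i _ => (hTd i b c).differentiableAt.smul (hed i)
  -- The two summands are treated together because the derivative of `θ i` evaluated on `Γ(b,c)`
  -- occurs in both with opposite signs.
  have hDΓ : ∀ i a b c, θ i z₀ (fderiv ℝ (fun z => flatChristoffel G z b c) z₀ a
      + flatChristoffel G z₀ a (flatChristoffel G z₀ b c)) =
      fderiv ℝ (fderiv ℝ (θ i)) z₀ a b c
        + ∑ j, (η i j z₀ b * fderiv ℝ (θ j) z₀ a c + θ j z₀ c * fderiv ℝ (η i j) z₀ a b)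
        + ∑ j, η i j z₀ a * (fderiv ℝ (θ j) z₀ b c + ∑ k, η j k z₀ b * θ k z₀ c) := by
    intro i a b c
    have h1 : (fun z => θ i z (flatChristoffel G z b c)) =ᶠ[𝓝 z₀] fun z =>
        fderiv ℝ (θ i) z b c + ∑ j, η i j z b * θ j z c :=
      h.christoffel_coframe.mono fun z hz => hz i b c
    have h2 := h1.fderiv_eq (𝕜 := ℝ)
    rw [(hTd i b c).fderiv, fderiv_clm_apply (hθd i) (hΓd b c)] at h2
    have h3 := congrArg (fun L : E →L[ℝ] ℝ => L a) h2
    simp only [add_apply, ContinuousLinearMap.comp_apply,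
      ContinuousLinearMap.flip_apply, sum_apply,
      smul_apply, smul_eq_mul] at h3
    rw [map_add, h.christoffel_coframe.self_of_nhds i a]
    simp only [h.christoffel_coframe.self_of_nhds]
    linarith
  have hexp := h.expand.self_of_nhds
  rw [← hexp (flatCurvature G z₀ u v w)]
  refine Finset.sum_congr rfl fun i _ => ?_
  congr 1
  have hR : flatCurvature G z₀ u v w =
      (fderiv ℝ (fun z => flatChristoffel G z v w) z₀ u
        + flatChristoffel G z₀ u (flatChristoffel G z₀ v w))
      - (fderiv ℝ (fun z => flatChristoffel G z u w) z₀ v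
        + flatChristoffel G z₀ v (flatChristoffel G z₀ u w)) := by
    rw [flatCurvature]; abel
  have hs : fderiv ℝ (fderiv ℝ (θ i)) z₀ u v w = fderiv ℝ (fderiv ℝ (θ i)) z₀ v u w := by
    rw [(h.smooth_coframe i).fderiv_fderiv_symm]
  rw [hR, map_sub, hDΓ, hDΓ, hs]
  simp only [frameCurvature, extD, mul_add, add_mul, sub_mul, Finset.sum_add_distrib,
    Finset.sum_sub_distrib, Finset.mul_sum, Finset.sum_mul]
  have c1 : ∀ a b, ∑ j, ∑ k, η i k z₀ a * η k j z₀ b * θ j z₀ w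
      = ∑ j, ∑ k, η i j z₀ a * (η j k z₀ b * θ k z₀ w) := by
    intro a b
    rw [Finset.sum_comm]
    exact Finset.sum_congr rfl fun _ _ => Finset.sum_congr rfl fun _ _ => by ring
  have c2 : ∀ a b, ∑ j, fderiv ℝ (η i j) z₀ a b * θ j z₀ w
      = ∑ j, θ j z₀ w * fderiv ℝ (η i j) z₀ a b :=
    fun a b => Finset.sum_congr rfl fun _ _ => by ring
  rw [c1, c1, c2, c2]
  ring

/-- The Hessian in a moving frame. -/
theorem IsMovingFrame.hessian [FiniteDimensional ℝ E] (h : IsMovingFrame G θ e η z₀) {φ : E → ℝ}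
    {a : ι → E → ℝ} (ha : ∀ i, DifferentiableAt ℝ (a i) z₀)
    (hφ : ∀ᶠ z in 𝓝 z₀, fderiv ℝ φ z = ∑ i, a i z • θ i z) (v w : E) :
    fderiv ℝ (fderiv ℝ φ) z₀ v w - fderiv ℝ φ z₀ (flatChristoffel G z₀ v w) =
      ∑ i, (fderiv ℝ (a i) z₀ v * θ i z₀ w - a i z₀ * ∑ j, η i j z₀ v * θ j z₀ w) := by
  have hθd : ∀ i, DifferentiableAt ℝ (θ i) z₀ := fun i =>
    (h.smooth_coframe i).differentiableAt_infty
  have h1 : fderiv ℝ φ =ᶠ[𝓝 z₀] fun z => ∑ i, a i z • θ i z := hφ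
  rw [h1.fderiv_eq, hφ.self_of_nhds,
    fderiv_fun_sum (fun i _ => (ha i).fun_smul (hθd i))]
  simp only [fderiv_fun_smul (ha _) (hθd _), sum_apply,
    add_apply, smul_apply,
    ContinuousLinearMap.smulRight_apply, smul_eq_mul, h.christoffel_coframe.self_of_nhds,
    ← Finset.sum_sub_distrib]
  exact Finset.sum_congr rfl fun i _ => by ring

end Flat

/-- The trace defining the Ricci tensor, computed in a moving frame. -/
theorem IsMovingFrame.ricci_trace {n : ℕ} {ι : Type*} [Fintype ι] [DecidableEq ι]
    {G : EuclideanSpace ℝ (Fin n) → EuclideanSpace ℝ (Fin n) →L[ℝ] EuclideanSpace ℝ (Fin n) →L[ℝ] ℝ}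
    {θ : ι → EuclideanSpace ℝ (Fin n) → EuclideanSpace ℝ (Fin n) →L[ℝ] ℝ}
    {e : ι → EuclideanSpace ℝ (Fin n) → EuclideanSpace ℝ (Fin n)}
    {η : ι → ι → EuclideanSpace ℝ (Fin n) → EuclideanSpace ℝ (Fin n) →L[ℝ] ℝ}
    {z₀ : EuclideanSpace ℝ (Fin n)} (h : IsMovingFrame G θ e η z₀)
    (v w : EuclideanSpace ℝ (Fin n)) :
    ∑ i : Fin n, flatCurvature G z₀ (EuclideanSpace.single i 1) v w i =
      ∑ a, ∑ j, frameCurvature η z₀ a j (e a z₀) v * θ j z₀ w := by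
  -- As a linear functional of `u`, the component `A a` satisfies `∑ i, A a (single i) * (e a) i = A
  -- a (e a)`; this turns the coordinate trace into the frame trace.
  set A : ι → EuclideanSpace ℝ (Fin n) →ₗ[ℝ] ℝ := fun a =>
    { toFun := fun u => ∑ j, frameCurvature η z₀ a j u v * θ j z₀ w
      map_add' := fun x y => by
        rw [← Finset.sum_add_distrib]
        refine Finset.sum_congr rfl fun j _ => ?_
        rw [← add_mul]; congr 1
        simp only [frameCurvature, extD, map_add, add_apply, add_mul, mul_add,
          Finset.sum_add_distrib, Finset.sum_sub_distrib]
        ring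
      map_smul' := fun c x => by
        rw [RingHom.id_apply, smul_eq_mul, Finset.mul_sum]
        refine Finset.sum_congr rfl fun j _ => ?_
        rw [← mul_assoc]; congr 1
        simp only [frameCurvature, extD, map_smul, smul_apply, smul_eq_mul,
          mul_add, Finset.mul_sum]
        rw [mul_sub]
        congr 1
        exact Finset.sum_congr rfl fun k _ => by ring } with hA
  have hexp : ∀ x : EuclideanSpace ℝ (Fin n),
      x = ∑ i, x i • (EuclideanSpace.single i 1 : EuclideanSpace ℝ (Fin n)) := by
    intro x
    ext k
    simp [Finset.sum_apply, Pi.single_apply]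
  have h1 : ∀ i : Fin n, flatCurvature G z₀ (EuclideanSpace.single i 1) v w i =
      ∑ a, A a (EuclideanSpace.single i 1) * e a z₀ i := by
    intro i
    rw [h.curvature]
    simp [hA]
  have h2 : ∀ a, A a (e a z₀) = ∑ i, A a (EuclideanSpace.single i 1) * e a z₀ i := by
    intro a
    conv_lhs => rw [hexp (e a z₀), map_sum]
    exact Finset.sum_congr rfl fun i _ => by rw [map_smul, smul_eq_mul, mul_comm]
  simp only [h1]
  rw [Finset.sum_comm]
  exact Finset.sum_congr rfl fun a _ => (h2 a).symm

end

/-! ### Orthonormal frames and Gauss curvature of a surface -/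

noncomputable section

section Frames

variable {E : Type*} [NormedAddCommGroup E] [NormedSpace ℝ E]

theorem ContDiffAt.extD {α : E → E →L[ℝ] ℝ} {a b : E → E} {z : E} (hα : ContDiffAt ℝ ∞ α z)
    (ha : ContDiffAt ℝ ∞ a z) (hb : ContDiffAt ℝ ∞ b z) :
    ContDiffAt ℝ ∞ (fun y => extD α y (a y) (b y)) z :=
  ((hα.fderiv_infty.clm_apply ha).clm_apply hb).sub ((hα.fderiv_infty.clm_apply hb).clm_apply ha)

/-- Duality makes the map given by the coframe surjective, and equality of dimensions makes it
injective; it then suffices to compare coframe components. -/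
theorem expand_of_dual {ι : Type*} [Fintype ι] [DecidableEq ι] [FiniteDimensional ℝ E]
    (hd : Module.finrank ℝ E = Fintype.card ι) (θ : ι → E →L[ℝ] ℝ) (e : ι → E)
    (hdual : ∀ i j, θ i (e j) = if i = j then 1 else 0) (v : E) : ∑ i, θ i v • e i = v := by
  set A : E →ₗ[ℝ] (ι → ℝ) := LinearMap.pi fun i => (θ i : E →ₗ[ℝ] ℝ) with hA
  have hval : ∀ c : ι → ℝ, A (∑ i, c i • e i) = c := by
    intro c
    ext i
    simp [hA, map_sum, hdual]
  have hs : Function.Surjective A := fun c => ⟨_, hval c⟩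
  have hi : Function.Injective A :=
    (LinearMap.injective_iff_surjective_of_finrank_eq_finrank (by simp [hd])).2 hs
  refine hi ?_
  rw [hval fun i => θ i v]
  rfl

theorem two_form_eq {θ : Fin 2 → E →L[ℝ] ℝ} {e : Fin 2 → E} (hexp : ∀ v, ∑ i, θ i v • e i = v)
    (β : E → E →L[ℝ] ℝ) (h : ∀ u v, β u v = -β v u) (u v : E) :
    β u v = β (e 0) (e 1) * (θ 0 u * θ 1 v - θ 0 v * θ 1 u) := by
  have hr : ∀ w x, β w x = θ 0 x * β w (e 0) + θ 1 x * β w (e 1) := by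
    intro w x
    conv_lhs => rw [← hexp x]
    simp [Fin.sum_univ_two]
  have h0 : β (e 0) (e 0) = 0 := by linarith [h (e 0) (e 0)]
  have h1 : β (e 1) (e 1) = 0 := by linarith [h (e 1) (e 1)]
  rw [hr u v, h u (e 0), h u (e 1), hr (e 0) u, hr (e 1) u, h0, h1, h (e 1) (e 0)]
  ring

/-- The exterior derivative at a point, as a family of linear forms. -/
def extDLin (α : E → E →L[ℝ] ℝ) (z u : E) : E →L[ℝ] ℝ := fderiv ℝ α z u - (fderiv ℝ α z).flip u

theorem extD_two_form {θ : Fin 2 → E →L[ℝ] ℝ} {e : Fin 2 → E}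
    (hexp : ∀ v, ∑ i, θ i v • e i = v) (α : E → E →L[ℝ] ℝ) (z u v : E) :
    extD α z u v = extD α z (e 0) (e 1) * (θ 0 u * θ 1 v - θ 0 v * θ 1 u) :=
  two_form_eq hexp (extDLin α z) (extD_antisymm α z) u v

/-- The matrix of connection one-forms on a surface. -/
def rotConn (α : E → E →L[ℝ] ℝ) : Fin 2 → Fin 2 → E → E →L[ℝ] ℝ := ![![0, α], ![-α, 0]]

/-- Gram–Schmidt applied to the constant fields `u 0`, `u 1`. They are orthonormal at `z₀`, so the
norms stay positive nearby and the frame takes the prescribed value there. In dimension two the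
structure equations can then be solved for `α` explicitly. -/
theorem exists_surface_frame [FiniteDimensional ℝ E] (hdim : Module.finrank ℝ E = 2)
    {G : E → E →L[ℝ] E →L[ℝ] ℝ} {z₀ : E} (hG : ContDiffAt ℝ ∞ G z₀)
    (hsymm : ∀ᶠ z in 𝓝 z₀, ∀ u v, G z u v = G z v u) (u : Fin 2 → E)
    (hu : ∀ i j, G z₀ (u i) (u j) = if i = j then 1 else 0) :
    ∃ (θ : Fin 2 → E → E →L[ℝ] ℝ) (e : Fin 2 → E → E) (α : E → E →L[ℝ] ℝ),
      IsMovingFrame G θ e (rotConn α) z₀ ∧ ContDiffAt ℝ ∞ α z₀ ∧ ∀ i, e i z₀ = u i := by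
  set a : E → ℝ := fun z => G z (u 0) (u 0) with ha
  set e₀ : E → E := fun z => (√(a z))⁻¹ • u 0 with he₀
  set w : E → E := fun z => u 1 - G z (e₀ z) (u 1) • e₀ z with hw
  set b : E → ℝ := fun z => G z (w z) (w z) with hb
  set e₁ : E → E := fun z => (√(b z))⁻¹ • w z with he₁
  have ha₀ : a z₀ = 1 := by simp [ha, hu]
  have he₀₀ : e₀ z₀ = u 0 := by simp [he₀, ha₀]
  have hw₀ : w z₀ = u 1 := by simp [hw, he₀₀, hu]
  have hb₀ : b z₀ = 1 := by simp [hb, hw₀, hu]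
  have he₁₀ : e₁ z₀ = u 1 := by simp [he₁, hb₀, hw₀]
  have has : ContDiffAt ℝ ∞ a z₀ := (hG.clm_apply contDiffAt_const).clm_apply contDiffAt_const
  have he₀s : ContDiffAt ℝ ∞ e₀ z₀ :=
    ((has.sqrt (by simp [ha₀])).inv (by simp [ha₀])).smul contDiffAt_const
  have hws : ContDiffAt ℝ ∞ w z₀ :=
    contDiffAt_const.sub (((hG.clm_apply he₀s).clm_apply contDiffAt_const).smul he₀s)
  have hbs : ContDiffAt ℝ ∞ b z₀ := (hG.clm_apply hws).clm_apply hws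
  have he₁s : ContDiffAt ℝ ∞ e₁ z₀ :=
    ((hbs.sqrt (by simp [hb₀])).inv (by simp [hb₀])).smul hws
  set e : Fin 2 → E → E := ![e₀, e₁] with he
  set θ : Fin 2 → E → E →L[ℝ] ℝ := fun i z => G z (e i z) with hθ
  have hes : ∀ i, ContDiffAt ℝ ∞ (e i) z₀ := by
    intro i; fin_cases i
    · exact he₀s
    · exact he₁s
  have hθs : ∀ i, ContDiffAt ℝ ∞ (θ i) z₀ := fun i => hG.clm_apply (hes i)
  have hdual : ∀ᶠ z in 𝓝 z₀, ∀ i j, θ i z (e j z) = if i = j then 1 else 0 := by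
    have pa : ∀ᶠ z in 𝓝 z₀, 0 < a z :=
      has.continuousAt.eventually_const_lt (by rw [ha₀]; norm_num)
    have pb : ∀ᶠ z in 𝓝 z₀, 0 < b z :=
      hbs.continuousAt.eventually_const_lt (by rw [hb₀]; norm_num)
    filter_upwards [pa, pb, hsymm] with z pa pb hsym
    have h00 : G z (e₀ z) (e₀ z) = 1 := by
      simp only [he₀, map_smul, smul_apply, smul_eq_mul]
      change (√(a z))⁻¹ * ((√(a z))⁻¹ * a z) = 1
      have := Real.mul_self_sqrt pa.le
      have hne := (Real.sqrt_pos.2 pa).ne'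
      field_simp
      nlinarith
    have h0w : G z (e₀ z) (w z) = 0 := by
      simp [hw, h00]
    have h11 : G z (e₁ z) (e₁ z) = 1 := by
      simp only [he₁, map_smul, smul_apply, smul_eq_mul]
      change (√(b z))⁻¹ * ((√(b z))⁻¹ * b z) = 1
      have := Real.mul_self_sqrt pb.le
      have hne := (Real.sqrt_pos.2 pb).ne'
      field_simp
      nlinarith
    have h01 : G z (e₀ z) (e₁ z) = 0 := by
      simp [he₁, h0w]
    intro i j
    fin_cases i <;> fin_cases j <;> simp [hθ, he, h00, h01, h11]
    rw [hsym, h01]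
  have hexp : ∀ᶠ z in 𝓝 z₀, ∀ v, ∑ i, θ i z v • e i z = v := by
    filter_upwards [hdual] with z hz v
    exact expand_of_dual (by simp [hdim]) (fun i => θ i z) (fun i => e i z) hz v
  -- With dθᵢ = cᵢ θ₀ ∧ θ₁, the equations dθ₀ = -α ∧ θ₁ and dθ₁ = α ∧ θ₀ force α = -(c₀ θ₀ + c₁ θ₁).
  set α : E → E →L[ℝ] ℝ := fun z =>
    -(extD (θ 0) z (e 0 z) (e 1 z) • θ 0 z + extD (θ 1) z (e 0 z) (e 1 z) • θ 1 z) with hα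
  have hαs : ContDiffAt ℝ ∞ α z₀ :=
    ((((hθs 0).extD (hes 0) (hes 1)).smul (hθs 0)).add
      (((hθs 1).extD (hes 0) (hes 1)).smul (hθs 1))).neg
  refine ⟨θ, e, α, ⟨hθs, hes, ?_, hexp, hdual, ?_, ?_, ?_⟩, hαs, ?_⟩
  · intro i j
    fin_cases i <;> fin_cases j
    · exact contDiffAt_const
    · exact hαs
    · exact hαs.neg
    · exact contDiffAt_const
  · filter_upwards [hexp] with z hz u v
    conv_lhs => rw [← hz u]
    simp [hθ, Fin.sum_univ_two]
  · refine Filter.Eventually.of_forall fun z i j u => ?_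
    fin_cases i <;> fin_cases j <;> simp [rotConn]
  · filter_upwards [hexp] with z hz i u v
    rw [extD_two_form (θ := fun i => θ i z) (e := fun i => e i z) hz]
    fin_cases i <;> simp [rotConn, Fin.sum_univ_two, hα] <;> ring
  · intro i; fin_cases i
    · exact he₀₀
    · exact he₁₀

end Frames

/-- Plane rotations commute, so the η ∧ η term vanishes and the curvature form is dα. Numerator and
denominator both carry the squared area of `u`, `v`, which cancels. -/
theorem gauss_of_surface_frame
    {G : EuclideanSpace ℝ (Fin 2) → EuclideanSpace ℝ (Fin 2) →L[ℝ] EuclideanSpace ℝ (Fin 2) →L[ℝ] ℝ}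
    {θ : Fin 2 → EuclideanSpace ℝ (Fin 2) → EuclideanSpace ℝ (Fin 2) →L[ℝ] ℝ}
    {e : Fin 2 → EuclideanSpace ℝ (Fin 2) → EuclideanSpace ℝ (Fin 2)}
    {α : EuclideanSpace ℝ (Fin 2) → EuclideanSpace ℝ (Fin 2) →L[ℝ] ℝ}
    {z₀ : EuclideanSpace ℝ (Fin 2)} (h : IsMovingFrame G θ e (rotConn α) z₀)
    (u v : EuclideanSpace ℝ (Fin 2))
    (huv : θ 0 z₀ u * θ 1 z₀ v - θ 0 z₀ v * θ 1 z₀ u ≠ 0) :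
    G z₀ (flatCurvature G z₀ u v v) u / (G z₀ u u * G z₀ v v - G z₀ u v ^ 2) =
      extD α z₀ (e 0 z₀) (e 1 z₀) := by
  have hm := h.metric.self_of_nhds
  have hdual := h.dual.self_of_nhds
  have hcurv : ∀ i, θ i z₀ (flatCurvature G z₀ u v v) =
      ∑ j, frameCurvature (rotConn α) z₀ i j u v * θ j z₀ v := by
    intro i
    rw [h.curvature, map_sum]
    simp only [map_smul, hdual, smul_eq_mul, mul_ite, mul_one, mul_zero, Finset.sum_ite_eq,
      Finset.mem_univ, if_true]
  have hneg : extD (-α) z₀ u v = -extD α z₀ u v := extD_neg α z₀ u v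
  have hzero : extD (0 : EuclideanSpace ℝ (Fin 2) → EuclideanSpace ℝ (Fin 2) →L[ℝ] ℝ) z₀ u v = 0 := by
    simp [extD]
  have h2 := extD_two_form (θ := fun i => θ i z₀) (e := fun i => e i z₀) h.expand.self_of_nhds
    α z₀ u v
  have hden : G z₀ u u * G z₀ v v - G z₀ u v ^ 2 =
      (θ 0 z₀ u * θ 1 z₀ v - θ 0 z₀ v * θ 1 z₀ u) ^ 2 := by
    simp only [hm, Fin.sum_univ_two]; ring
  rw [hden, div_eq_iff (pow_ne_zero 2 huv), hm]
  simp only [hcurv, frameCurvature, Fin.sum_univ_two]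
  simp [rotConn, hneg, hzero, h2]
  ring

end

/-! ### The adapted coframe of a circle bundle and its connection forms -/

noncomputable section

section CircleFrame

variable {E : Type*} [NormedAddCommGroup E] [NormedSpace ℝ E]

/-- An adapted frame for a connection metric on a circle bundle over a surface: `θ₀, θ₁` is the
pullback of an orthonormal coframe of the surface with connection form `α` and Gauss curvature `K`,
`κ` is the connection form with curvature `F θ₀ ∧ θ₁`, and `df = f₀ θ₀ + f₁ θ₁`. -/
structure IsCircleFrame (θ : Fin 2 → E → E →L[ℝ] ℝ) (κ α : E → E →L[ℝ] ℝ) (e : Fin 3 → E → E)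
    (f F f₀ f₁ : E → ℝ) (K : ℝ) (z₀ : E) : Prop where
  smooth_coframe : ∀ i, ContDiffAt ℝ ∞ (θ i) z₀
  smooth_omega : ContDiffAt ℝ ∞ κ z₀
  smooth_alpha : ContDiffAt ℝ ∞ α z₀
  smooth_frame : ∀ i, ContDiffAt ℝ ∞ (e i) z₀
  smooth_f : ContDiffAt ℝ ∞ f z₀
  smooth_F : ContDiffAt ℝ ∞ F z₀
  smooth_f₀ : ContDiffAt ℝ ∞ f₀ z₀
  smooth_f₁ : ContDiffAt ℝ ∞ f₁ z₀
  pos : ∀ᶠ z in 𝓝 z₀, 0 < f z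
  horizontal_dual : ∀ᶠ z in 𝓝 z₀, ∀ i j : Fin 2, θ i z (e j.castSucc z) = if i = j then 1 else 0
  horizontal : ∀ᶠ z in 𝓝 z₀, ∀ j : Fin 2, κ z (e j.castSucc z) = 0
  vertical : ∀ᶠ z in 𝓝 z₀, ∀ i, θ i z (e 2 z) = 0
  vertical_omega : ∀ᶠ z in 𝓝 z₀, f z * κ z (e 2 z) = 1
  vertical_alpha : ∀ᶠ z in 𝓝 z₀, α z (e 2 z) = 0
  cartan₀ : ∀ᶠ z in 𝓝 z₀, ∀ u v, extD (θ 0) z u v = -(α z u * θ 1 z v - α z v * θ 1 z u)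
  cartan₁ : ∀ᶠ z in 𝓝 z₀, ∀ u v, extD (θ 1) z u v = α z u * θ 0 z v - α z v * θ 0 z u
  curvature : ∀ᶠ z in 𝓝 z₀, ∀ u v, extD κ z u v = F z * (θ 0 z u * θ 1 z v - θ 0 z v * θ 1 z u)
  gauss : ∀ u v, extD α z₀ u v = K * (θ 0 z₀ u * θ 1 z₀ v - θ 0 z₀ v * θ 1 z₀ u)
  deriv_f : ∀ᶠ z in 𝓝 z₀, fderiv ℝ f z = f₀ z • θ 0 z + f₁ z • θ 1 z

/-- The orthonormal coframe of the connection metric. -/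
def circleCoframe (θ : Fin 2 → E → E →L[ℝ] ℝ) (κ : E → E →L[ℝ] ℝ) (f : E → ℝ) :
    Fin 3 → E → E →L[ℝ] ℝ := ![θ 0, θ 1, fun z => f z • κ z]

/-- The connection one-forms of the connection metric. -/
def circleConn (θ : Fin 2 → E → E →L[ℝ] ℝ) (κ α : E → E →L[ℝ] ℝ) (f F f₀ f₁ : E → ℝ) :
    Fin 3 → Fin 3 → E → E →L[ℝ] ℝ :=
  let η₀₁ : E → E →L[ℝ] ℝ := fun z => α z - (1 / 2 * f z ^ 2 * F z) • κ z
  let η₀₂ : E → E →L[ℝ] ℝ := fun z => -(f₀ z • κ z + (1 / 2 * f z * F z) • θ 1 z)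
  let η₁₂ : E → E →L[ℝ] ℝ := fun z => (1 / 2 * f z * F z) • θ 0 z - f₁ z • κ z
  ![![0, η₀₁, η₀₂], ![fun z => -η₀₁ z, 0, η₁₂], ![fun z => -η₀₂ z, fun z => -η₁₂ z, 0]]

variable {θ : Fin 2 → E → E →L[ℝ] ℝ} {κ α : E → E →L[ℝ] ℝ} {e : Fin 3 → E → E}
  {f F f₀ f₁ : E → ℝ} {K : ℝ} {z₀ : E} {G : E → E →L[ℝ] E →L[ℝ] ℝ}

theorem IsCircleFrame.dual (h : IsCircleFrame θ κ α e f F f₀ f₁ K z₀) :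
    ∀ᶠ z in 𝓝 z₀, ∀ i j, circleCoframe θ κ f i z (e j z) = if i = j then 1 else 0 := by
  filter_upwards [h.horizontal_dual, h.horizontal, h.vertical, h.vertical_omega]
    with z h1 h2 h3 h4 i j
  have h100 := h1 0 0
  have h101 := h1 0 1
  have h110 := h1 1 0
  have h111 := h1 1 1
  have h20 := h2 0
  have h21 := h2 1
  simp at h100 h101 h110 h111 h20 h21
  fin_cases i <;> fin_cases j <;> simp [circleCoframe, *]

theorem IsCircleFrame.expand [FiniteDimensional ℝ E]
    (h : IsCircleFrame θ κ α e f F f₀ f₁ K z₀) (hdim : Module.finrank ℝ E = 3) :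
    ∀ᶠ z in 𝓝 z₀, ∀ v, θ 0 z v • e 0 z + θ 1 z v • e 1 z + (f z * κ z v) • e 2 z = v := by
  filter_upwards [h.dual] with z hz v
  have := expand_of_dual (by simp [hdim]) (fun i => circleCoframe θ κ f i z) (fun i => e i z) hz v
  rw [Fin.sum_univ_three] at this
  exact this

/-- By Leibniz, d(fκ) = df ∧ κ + f F θ₀ ∧ θ₁. The `f F` term is split evenly between `η₀₂` and
`η₁₂`; the term `-½ f² F κ` of `η₀₁` then cancels what this split contributes to dθ₀ and dθ₁. -/
theorem IsCircleFrame.isMovingFrame [FiniteDimensional ℝ E]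
    (h : IsCircleFrame θ κ α e f F f₀ f₁ K z₀) (hdim : Module.finrank ℝ E = 3)
    (hG : ∀ᶠ z in 𝓝 z₀, ∀ u v,
      G z u v = θ 0 z u * θ 0 z v + θ 1 z u * θ 1 z v + f z ^ 2 * (κ z u * κ z v)) :
    IsMovingFrame G (circleCoframe θ κ f) e (circleConn θ κ α f F f₀ f₁) z₀ := by
  have hθ := h.smooth_coframe
  have hκ := h.smooth_omega
  have hf := h.smooth_f
  have hF := h.smooth_F
  have h₀ := h.smooth_f₀
  have h₁ := h.smooth_f₁
  have hα := h.smooth_alpha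
  have hk : ContDiffAt ℝ ∞ (fun z => 1 / 2 * f z * F z) z₀ := (contDiffAt_const.mul hf).mul hF
  have hc : ContDiffAt ℝ ∞ (fun z => 1 / 2 * f z ^ 2 * F z) z₀ :=
    (contDiffAt_const.mul (hf.pow 2)).mul hF
  have s01 : ContDiffAt ℝ ∞ (fun z => α z - (1 / 2 * f z ^ 2 * F z) • κ z) z₀ :=
    hα.sub (hc.smul hκ)
  have s02 : ContDiffAt ℝ ∞ (fun z => -(f₀ z • κ z + (1 / 2 * f z * F z) • θ 1 z)) z₀ :=
    ((h₀.smul hκ).add (hk.smul (hθ 1))).neg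
  have s12 : ContDiffAt ℝ ∞ (fun z => (1 / 2 * f z * F z) • θ 0 z - f₁ z • κ z) z₀ :=
    (hk.smul (hθ 0)).sub (h₁.smul hκ)
  have hdual := h.dual
  refine ⟨?_, h.smooth_frame, ?_, ?_, hdual, ?_, ?_, ?_⟩
  · intro i
    fin_cases i
    · exact hθ 0
    · exact hθ 1
    · exact hf.smul hκ
  · intro i j
    fin_cases i <;> fin_cases j
    · exact contDiffAt_const
    · exact s01
    · exact s02
    · exact s01.neg
    · exact contDiffAt_const
    · exact s12
    · exact s02.neg
    · exact s12.neg
    · exact contDiffAt_const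
  · filter_upwards [hdual] with z hz v
    exact expand_of_dual (by simp [hdim]) (fun i => circleCoframe θ κ f i z) (fun i => e i z) hz v
  · filter_upwards [hG] with z hz u v
    rw [hz, Fin.sum_univ_three]
    simp [circleCoframe]
    ring
  · refine Filter.Eventually.of_forall fun z i j u => ?_
    fin_cases i <;> fin_cases j <;> simp [circleConn]
  · filter_upwards [h.cartan₀, h.cartan₁, h.curvature, h.deriv_f, hf.eventually_differentiableAt,
      hκ.eventually_differentiableAt] with z c0 c1 cκ df hfd hκd i u v
    rw [Fin.sum_univ_three]
    fin_cases i
    · simp [circleConn, circleCoframe, c0]; ring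
    · simp [circleConn, circleCoframe, c1]; ring
    · have : extD (fun z => f z • κ z) z u v = _ := extD_smul hfd hκd u v
      simp [circleConn, circleCoframe, this, cκ, df]; ring

/-- From ddκ = 0 and closedness of θ₀ ∧ θ₁ follows dF ∧ θ₀ ∧ θ₁ = 0; evaluating on the frame leaves
the vertical derivative of `F`. -/
theorem IsCircleFrame.deriv_F_vertical (h : IsCircleFrame θ κ α e f F f₀ f₁ K z₀) :
    fderiv ℝ F z₀ (e 2 z₀) = 0 := by
  have hθd : ∀ i x, DifferentiableAt ℝ (fun y => θ i y x) z₀ := fun i x =>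
    (h.smooth_coframe i).differentiableAt_infty.clm_apply (differentiableAt_const _)
  have hθf : ∀ i x y, fderiv ℝ (fun y => θ i y x) z₀ y = fderiv ℝ (θ i) z₀ y x := fun i x y =>
    fderiv_fderiv_apply_const (h.smooth_coframe i).differentiableAt_infty y x
  have hFd := h.smooth_F.differentiableAt_infty
  have hκ' := h.smooth_omega.fderiv_infty.differentiableAt_infty
  -- The equation dκ = F θ₀ ∧ θ₁, evaluated on constant `u`, `v` and differentiated along `w`.
  have key : ∀ u v w, fderiv ℝ (fderiv ℝ κ) z₀ w u v - fderiv ℝ (fderiv ℝ κ) z₀ w v u =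
      fderiv ℝ F z₀ w * (θ 0 z₀ u * θ 1 z₀ v - θ 0 z₀ v * θ 1 z₀ u) + F z₀ *
        (fderiv ℝ (θ 0) z₀ w u * θ 1 z₀ v + θ 0 z₀ u * fderiv ℝ (θ 1) z₀ w v
          - fderiv ℝ (θ 0) z₀ w v * θ 1 z₀ u - θ 0 z₀ v * fderiv ℝ (θ 1) z₀ w u) := by
    intro u v w
    have h1 : (fun z => fderiv ℝ κ z u v - fderiv ℝ κ z v u) =ᶠ[𝓝 z₀]
        fun z => F z * (θ 0 z u * θ 1 z v - θ 0 z v * θ 1 z u) :=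
      h.curvature.mono fun z hz => hz u v
    have h2 := congrArg (fun L : E →L[ℝ] ℝ => L w) (h1.fderiv_eq (𝕜 := ℝ))
    have d1 : ∀ x, DifferentiableAt ℝ (fun z => fderiv ℝ κ z x) z₀ := fun x =>
      hκ'.clm_apply (differentiableAt_const _)
    have d2 : ∀ x y, DifferentiableAt ℝ (fun z => fderiv ℝ κ z x y) z₀ := fun x y =>
      (d1 x).clm_apply (differentiableAt_const _)
    have d3 := (hθd 0 u).fun_mul (hθd 1 v)
    have d4 := (hθd 0 v).fun_mul (hθd 1 u)
    simp only [fderiv_fun_sub (d2 u v) (d2 v u), fderiv_fun_mul hFd (d3.fun_sub d4),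
      fderiv_fun_sub d3 d4, fderiv_fun_mul (hθd 0 u) (hθd 1 v),
      fderiv_fun_mul (hθd 0 v) (hθd 1 u), sub_apply, add_apply, smul_apply, smul_eq_mul, hθf,
      fderiv_fderiv_apply_const (d1 _), fderiv_fderiv_apply_const hκ'] at h2
    linarith
  have hs : ∀ u v w, fderiv ℝ (fderiv ℝ κ) z₀ u v w = fderiv ℝ (fderiv ℝ κ) z₀ v u w :=
    fun u v w => by rw [h.smooth_omega.fderiv_fderiv_symm]
  -- In the cyclic sum the second derivatives of `κ` cancel in pairs, which is ddκ = 0.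
  have k1 := key (e 0 z₀) (e 1 z₀) (e 2 z₀)
  have k2 := key (e 1 z₀) (e 2 z₀) (e 0 z₀)
  have k3 := key (e 2 z₀) (e 0 z₀) (e 1 z₀)
  rw [hs (e 2 z₀) (e 0 z₀), hs (e 2 z₀) (e 1 z₀)] at k1
  rw [hs (e 0 z₀) (e 1 z₀)] at k2
  have hd := h.horizontal_dual.self_of_nhds
  have d00 : θ 0 z₀ (e 0 z₀) = 1 := hd 0 0
  have d01 : θ 0 z₀ (e 1 z₀) = 0 := hd 0 1
  have d10 : θ 1 z₀ (e 0 z₀) = 0 := hd 1 0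
  have d11 : θ 1 z₀ (e 1 z₀) = 1 := hd 1 1
  have d02 := h.vertical.self_of_nhds 0
  have d12 := h.vertical.self_of_nhds 1
  have dα := h.vertical_alpha.self_of_nhds
  have c0 := h.cartan₀.self_of_nhds (e 2 z₀) (e 0 z₀)
  have c1 := h.cartan₁.self_of_nhds (e 2 z₀) (e 1 z₀)
  simp only [extD, d00, d01, d10, d11, d02, d12, dα] at k1 k2 k3 c0 c1
  -- The contributions of `c0` and `c1` are the two terms of d(θ₀ ∧ θ₁) on the frame.
  linear_combination -k1 - k2 - k3 - F z₀ * c0 - F z₀ * c1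

end CircleFrame

end

/-! ### Ricci tensor in the adapted frame -/

noncomputable section

section CircleFrame

variable {E : Type*} [NormedAddCommGroup E] [NormedSpace ℝ E]
  {θ : Fin 2 → E → E →L[ℝ] ℝ} {κ α : E → E →L[ℝ] ℝ} {e : Fin 3 → E → E}
  {f F f₀ f₁ : E → ℝ} {K : ℝ} {z₀ : E} {G : E → E →L[ℝ] E →L[ℝ] ℝ}

/-- Leibniz rule only; the exterior derivatives of `α`, `κ`, `θ` stay symbolic, so that the
structure equations can be substituted afterwards. -/
theorem IsCircleFrame.extD_conn (h : IsCircleFrame θ κ α e f F f₀ f₁ K z₀) (u v : E) :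
    extD (circleConn θ κ α f F f₀ f₁ 0 1) z₀ u v =
      extD α z₀ u v - ((f z₀ * F z₀ * fderiv ℝ f z₀ u + 1 / 2 * f z₀ ^ 2 * fderiv ℝ F z₀ u) * κ z₀ v
        - (f z₀ * F z₀ * fderiv ℝ f z₀ v + 1 / 2 * f z₀ ^ 2 * fderiv ℝ F z₀ v) * κ z₀ u
        + 1 / 2 * f z₀ ^ 2 * F z₀ * extD κ z₀ u v) ∧
    extD (circleConn θ κ α f F f₀ f₁ 0 2) z₀ u v =
      -(fderiv ℝ f₀ z₀ u * κ z₀ v - fderiv ℝ f₀ z₀ v * κ z₀ u + f₀ z₀ * extD κ z₀ u v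
        + (1 / 2 * (F z₀ * fderiv ℝ f z₀ u + f z₀ * fderiv ℝ F z₀ u) * θ 1 z₀ v
          - 1 / 2 * (F z₀ * fderiv ℝ f z₀ v + f z₀ * fderiv ℝ F z₀ v) * θ 1 z₀ u
          + 1 / 2 * f z₀ * F z₀ * extD (θ 1) z₀ u v)) ∧
    extD (circleConn θ κ α f F f₀ f₁ 1 2) z₀ u v =
      (1 / 2 * (F z₀ * fderiv ℝ f z₀ u + f z₀ * fderiv ℝ F z₀ u) * θ 0 z₀ v
          - 1 / 2 * (F z₀ * fderiv ℝ f z₀ v + f z₀ * fderiv ℝ F z₀ v) * θ 0 z₀ u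
          + 1 / 2 * f z₀ * F z₀ * extD (θ 0) z₀ u v)
        - (fderiv ℝ f₁ z₀ u * κ z₀ v - fderiv ℝ f₁ z₀ v * κ z₀ u + f₁ z₀ * extD κ z₀ u v) := by
  have hθ := fun i => (h.smooth_coframe i).differentiableAt_infty
  have hκ := h.smooth_omega.differentiableAt_infty
  have hα := h.smooth_alpha.differentiableAt_infty
  have hf := h.smooth_f.differentiableAt_infty
  have hF := h.smooth_F.differentiableAt_infty
  have h₀ := h.smooth_f₀.differentiableAt_infty
  have h₁ := h.smooth_f₁.differentiableAt_infty
  have hk : HasFDerivAt (fun z => 1 / 2 * f z * F z)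
      ((1 / 2 : ℝ) • (F z₀ • fderiv ℝ f z₀ + f z₀ • fderiv ℝ F z₀)) z₀ := by
    refine ((hf.hasFDerivAt.const_mul (1 / 2)).mul hF.hasFDerivAt).congr_fderiv ?_
    ext x; simp; ring
  have hc : HasFDerivAt (fun z => 1 / 2 * f z ^ 2 * F z)
      ((f z₀ * F z₀) • fderiv ℝ f z₀ + (1 / 2 * f z₀ ^ 2) • fderiv ℝ F z₀) z₀ := by
    refine (((hf.hasFDerivAt.pow 2).const_mul (1 / 2)).mul hF.hasFDerivAt).congr_fderiv ?_
    ext x; simp; ring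
  have hkd := hk.differentiableAt
  have hcd := hc.differentiableAt
  refine ⟨?_, ?_, ?_⟩
  · have : circleConn θ κ α f F f₀ f₁ 0 1 = fun z => α z - (1 / 2 * f z ^ 2 * F z) • κ z := rfl
    rw [this, extD_sub hα (hcd.fun_smul hκ), extD_smul hcd hκ, hc.fderiv]
    simp
  · have : circleConn θ κ α f F f₀ f₁ 0 2 =
      fun z => -(f₀ z • κ z + (1 / 2 * f z * F z) • θ 1 z) := rfl
    rw [this, extD_neg, extD_add (h₀.fun_smul hκ) (hkd.fun_smul (hθ 1)), extD_smul h₀ hκ,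
      extD_smul hkd (hθ 1), hk.fderiv]
    simp
    ring
  · have : circleConn θ κ α f F f₀ f₁ 1 2 =
      fun z => (1 / 2 * f z * F z) • θ 0 z - f₁ z • κ z := rfl
    rw [this, extD_sub (hkd.fun_smul (hθ 0)) (h₁.fun_smul hκ), extD_smul h₁ hκ,
      extD_smul hkd (hθ 0), hk.fderiv]
    simp
    ring

end CircleFrame

/-- The Ricci tensor of a metric in coordinates. -/
def flatRicci {n : ℕ}
    (G : EuclideanSpace ℝ (Fin n) → EuclideanSpace ℝ (Fin n) →L[ℝ] EuclideanSpace ℝ (Fin n) →L[ℝ] ℝ)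
    (z v w : EuclideanSpace ℝ (Fin n)) : ℝ :=
  ∑ i : Fin n, flatCurvature G z (EuclideanSpace.single i 1) v w i

/-- The Hessian of a function in coordinates. -/
def flatHessian {E : Type*} [NormedAddCommGroup E] [NormedSpace ℝ E]
    (G : E → E →L[ℝ] E →L[ℝ] ℝ) (f : E → ℝ) (z v w : E) : ℝ :=
  fderiv ℝ (fderiv ℝ f) z v w - fderiv ℝ f z (flatChristoffel G z v w)

/-- Substituting the structure equations into dη + η ∧ η reduces the trace to the values of `f`,
`F`, `f₀`, `f₁`, `α` and first derivatives of the coefficients; vertical derivatives vanish. The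
derivatives of `f₀` and `f₁` assemble into the Hessian in the horizontal block and into d*df in the
vertical entry. Both orders of the mixed entries are computed, so symmetry of the Ricci tensor is
not invoked. -/
theorem IsCircleFrame.ricci
    {θ : Fin 2 → EuclideanSpace ℝ (Fin 3) → EuclideanSpace ℝ (Fin 3) →L[ℝ] ℝ}
    {κ α : EuclideanSpace ℝ (Fin 3) → EuclideanSpace ℝ (Fin 3) →L[ℝ] ℝ}
    {e : Fin 3 → EuclideanSpace ℝ (Fin 3) → EuclideanSpace ℝ (Fin 3)}
    {f F f₀ f₁ : EuclideanSpace ℝ (Fin 3) → ℝ} {K : ℝ} {z₀ : EuclideanSpace ℝ (Fin 3)}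
    {G : EuclideanSpace ℝ (Fin 3) → EuclideanSpace ℝ (Fin 3) →L[ℝ] EuclideanSpace ℝ (Fin 3) →L[ℝ] ℝ}
    (h : IsCircleFrame θ κ α e f F f₀ f₁ K z₀)
    (hG : ∀ᶠ z in 𝓝 z₀, ∀ u v,
      G z u v = θ 0 z u * θ 0 z v + θ 1 z u * θ 1 z v + f z ^ 2 * (κ z u * κ z v)) :
    (∀ i j : Fin 2, flatRicci G z₀ (e i.castSucc z₀) (e j.castSucc z₀) =
      (K - 1 / 2 * f z₀ ^ 2 * F z₀ ^ 2) * (if i = j then 1 else 0)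
        - 1 / f z₀ * flatHessian G f z₀ (e i.castSucc z₀) (e j.castSucc z₀)) ∧
    (flatRicci G z₀ (e 0 z₀) (e 2 z₀) =
      1 / 2 * f z₀ * fderiv ℝ F z₀ (e 1 z₀) + 3 / 2 * F z₀ * f₁ z₀) ∧
    (flatRicci G z₀ (e 1 z₀) (e 2 z₀) =
      -(1 / 2 * f z₀ * fderiv ℝ F z₀ (e 0 z₀) + 3 / 2 * F z₀ * f₀ z₀)) ∧
    (flatRicci G z₀ (e 2 z₀) (e 0 z₀) =
      1 / 2 * f z₀ * fderiv ℝ F z₀ (e 1 z₀) + 3 / 2 * F z₀ * f₁ z₀) ∧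
    (flatRicci G z₀ (e 2 z₀) (e 1 z₀) =
      -(1 / 2 * f z₀ * fderiv ℝ F z₀ (e 0 z₀) + 3 / 2 * F z₀ * f₀ z₀)) ∧
    flatRicci G z₀ (e 2 z₀) (e 2 z₀) = 1 / 2 * f z₀ ^ 2 * F z₀ ^ 2
      - 1 / f z₀ * extD (fun z => f₀ z • θ 1 z - f₁ z • θ 0 z) z₀ (e 0 z₀) (e 1 z₀) := by
  have hm := h.isMovingFrame (by simp) hG
  have hθd := fun i => (h.smooth_coframe i).differentiableAt_infty
  have h₀d := h.smooth_f₀.differentiableAt_infty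
  have h₁d := h.smooth_f₁.differentiableAt_infty
  have hfd := h.smooth_f.differentiableAt_infty
  have hκd := h.smooth_omega.differentiableAt_infty
  have hpos := h.pos.self_of_nhds
  have hne : f z₀ ≠ 0 := hpos.ne'
  have hd := h.horizontal_dual.self_of_nhds
  have d00 : θ 0 z₀ (e 0 z₀) = 1 := hd 0 0
  have d01 : θ 0 z₀ (e 1 z₀) = 0 := hd 0 1
  have d10 : θ 1 z₀ (e 0 z₀) = 0 := hd 1 0
  have d11 : θ 1 z₀ (e 1 z₀) = 1 := hd 1 1
  have d02 := h.vertical.self_of_nhds 0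
  have d12 := h.vertical.self_of_nhds 1
  have k0 : κ z₀ (e 0 z₀) = 0 := h.horizontal.self_of_nhds 0
  have k1 : κ z₀ (e 1 z₀) = 0 := h.horizontal.self_of_nhds 1
  have k2 : κ z₀ (e 2 z₀) = 1 / f z₀ := by
    have := h.vertical_omega.self_of_nhds
    field_simp; linarith
  have dα := h.vertical_alpha.self_of_nhds
  have hdf := h.deriv_f.self_of_nhds
  have df : ∀ x, fderiv ℝ f z₀ x = f₀ z₀ * θ 0 z₀ x + f₁ z₀ * θ 1 z₀ x := by
    intro x; rw [hdf]; simp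
  have hF2 := h.deriv_F_vertical
  have c0 := h.cartan₀.self_of_nhds
  have c1 := h.cartan₁.self_of_nhds
  have cκ := h.curvature.self_of_nhds
  have cα := h.gauss
  -- This is ddf = 0 written in the coframe.
  have hclosed : ∀ u v, fderiv ℝ f₀ z₀ u * θ 0 z₀ v - fderiv ℝ f₀ z₀ v * θ 0 z₀ u
      + f₀ z₀ * extD (θ 0) z₀ u v + (fderiv ℝ f₁ z₀ u * θ 1 z₀ v - fderiv ℝ f₁ z₀ v * θ 1 z₀ u
      + f₁ z₀ * extD (θ 1) z₀ u v) = 0 := by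
    intro u v
    rw [← extD_smul h₀d (hθd 0), ← extD_smul h₁d (hθd 1),
      ← extD_add (h₀d.fun_smul (hθd 0)) (h₁d.fun_smul (hθd 1)), ← extD_fderiv h.smooth_f u v]
    exact extD_congr (h.deriv_f.mono fun z hz => hz.symm) u v
  have f02 := hclosed (e 2 z₀) (e 0 z₀)
  have f12 := hclosed (e 2 z₀) (e 1 z₀)
  have f01 := hclosed (e 0 z₀) (e 1 z₀)
  simp only [c0, c1, d00, d01, d10, d11, d02, d12, dα] at f02 f12 f01
  -- Pairing `e 2` with a horizontal vector in ddf = 0 leaves only this derivative, because the `θ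
  -- i` and `α` kill `e 2`.
  have g02 : fderiv ℝ f₀ z₀ (e 2 z₀) = 0 := by linarith
  have g12 : fderiv ℝ f₁ z₀ (e 2 z₀) = 0 := by linarith
  -- The third coefficient of df is zero, as `f` is constant along the fibres.
  have hess : ∀ v w, flatHessian G f z₀ v w = _ := hm.hessian (φ := f)
    (a := ![f₀, f₁, fun _ => 0])
    (fun i => by
      fin_cases i
      · exact h₀d
      · exact h₁d
      · exact differentiableAt_const _)
    (h.deriv_f.mono fun z hz => by rw [hz]; simp [Fin.sum_univ_three, circleCoframe])
  have hlap : extD (fun z => f₀ z • θ 1 z - f₁ z • θ 0 z) z₀ (e 0 z₀) (e 1 z₀) =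
      fderiv ℝ f₀ z₀ (e 0 z₀) + f₀ z₀ * α z₀ (e 1 z₀) * (-1)
        - (-fderiv ℝ f₁ z₀ (e 1 z₀) - f₁ z₀ * α z₀ (e 0 z₀)) := by
    rw [extD_sub (h₀d.fun_smul (hθd 1)) (h₁d.fun_smul (hθd 0)), extD_smul h₀d (hθd 1),
      extD_smul h₁d (hθd 0), c0, c1]
    simp only [d00, d01, d10, d11]
    ring
  have hric : ∀ v w, flatRicci G z₀ v w = _ := hm.ricci_trace
  have E01 := fun u v => (h.extD_conn u v).1
  have E02 := fun u v => (h.extD_conn u v).2.1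
  have E12 := fun u v => (h.extD_conn u v).2.2
  simp only [c0, c1, cκ, cα, df] at E01 E02 E12
  set η := circleConn θ κ α f F f₀ f₁ with hη
  have E10 : ∀ u v, extD (η 1 0) z₀ u v = -extD (η 0 1) z₀ u v := extD_neg _ z₀
  have E20 : ∀ u v, extD (η 2 0) z₀ u v = -extD (η 0 2) z₀ u v := extD_neg _ z₀
  have E21 : ∀ u v, extD (η 2 1) z₀ u v = -extD (η 1 2) z₀ u v := extD_neg _ z₀
  have Ez : ∀ u v, extD (0 : EuclideanSpace ℝ (Fin 3) → EuclideanSpace ℝ (Fin 3) →L[ℝ] ℝ) z₀ u v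
      = 0 := by simp [extD]
  have E00 : ∀ u v, extD (η 0 0) z₀ u v = 0 := Ez
  have E11 : ∀ u v, extD (η 1 1) z₀ u v = 0 := Ez
  have E22 : ∀ u v, extD (η 2 2) z₀ u v = 0 := Ez
  have n00 : ∀ u, η 0 0 z₀ u = 0 := fun u => rfl
  have n11 : ∀ u, η 1 1 z₀ u = 0 := fun u => rfl
  have n22 : ∀ u, η 2 2 z₀ u = 0 := fun u => rfl
  have n01 : ∀ u, η 0 1 z₀ u = α z₀ u - 1 / 2 * f z₀ ^ 2 * F z₀ * κ z₀ u := fun u => rfl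
  have n02 : ∀ u, η 0 2 z₀ u = -(f₀ z₀ * κ z₀ u + 1 / 2 * f z₀ * F z₀ * θ 1 z₀ u) := fun u => rfl
  have n12 : ∀ u, η 1 2 z₀ u = 1 / 2 * f z₀ * F z₀ * θ 0 z₀ u - f₁ z₀ * κ z₀ u := fun u => rfl
  have n10 : ∀ u, η 1 0 z₀ u = -η 0 1 z₀ u := fun u => rfl
  have n20 : ∀ u, η 2 0 z₀ u = -η 0 2 z₀ u := fun u => rfl
  have n21 : ∀ u, η 2 1 z₀ u = -η 1 2 z₀ u := fun u => rfl
  have t0 : ∀ u, circleCoframe θ κ f 0 z₀ u = θ 0 z₀ u := fun u => rfl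
  have t1 : ∀ u, circleCoframe θ κ f 1 z₀ u = θ 1 z₀ u := fun u => rfl
  have t2 : ∀ u, circleCoframe θ κ f 2 z₀ u = f z₀ * κ z₀ u := fun u => rfl
  simp only [Fin.sum_univ_three, frameCurvature, E00, E11, E22, E10, E20, E21, E01, E02, E12, n00,
    n11, n22, n10, n20, n21, n01, n02, n12, t0, t1, t2] at hric
  simp only [Fin.sum_univ_three, n00, n11, n22, n10, n20, n21, n01, n02, n12, t0, t1, t2,
    Matrix.cons_val] at hess
  refine ⟨?_, ?_, ?_, ?_, ?_, ?_⟩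
  · intro i j
    rw [hric, hess]
    fin_cases i <;> fin_cases j <;>
      simp [d00, d01, d10, d11, d02, d12, dα, k0, k1, k2, hF2, g02, g12]
    all_goals field_simp
    all_goals ring
  all_goals
    rw [hric]
    simp only [hlap, d00, d01, d10, d11, d02, d12, dα, k0, k1, k2, hF2, g02, g12]
    field_simp
    ring

end

/-! ### Passing between tangent vectors and chart coordinates -/

noncomputable section

section Charts

variable {n : ℕ} {N : Type*} [TopologicalSpace N] [ChartedSpace (EuclideanSpace ℝ (Fin n)) N]
  {m : ℕ} {N' : Type*} [TopologicalSpace N'] [ChartedSpace (EuclideanSpace ℝ (Fin m)) N']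

/-- The differential at `q` of the preferred chart at `y`. -/
def chartDeriv (y q : N) : TangentSpace (𝓡 n) q →L[ℝ] EuclideanSpace ℝ (Fin n) :=
  mfderiv (𝓡 n) 𝓘(ℝ, EuclideanSpace ℝ (Fin n)) (extChartAt (𝓡 n) y) q

theorem extChartAt_chartInv {y : N} {z : EuclideanSpace ℝ (Fin n)}
    (hz : z ∈ (extChartAt (𝓡 n) y).target) : extChartAt (𝓡 n) y (chartInv y z) = z :=
  (extChartAt (𝓡 n) y).right_inv hz

theorem chartInv_extChartAt {y q : N} (hq : q ∈ (extChartAt (𝓡 n) y).source) :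
    chartInv y (extChartAt (𝓡 n) y q) = q :=
  (extChartAt (𝓡 n) y).left_inv hq

theorem chartInv_mem_source {y : N} {z : EuclideanSpace ℝ (Fin n)}
    (hz : z ∈ (extChartAt (𝓡 n) y).target) : chartInv y z ∈ (extChartAt (𝓡 n) y).source :=
  (extChartAt (𝓡 n) y).map_target hz

theorem target_mem_nhds {y : N} {z : EuclideanSpace ℝ (Fin n)}
    (hz : z ∈ (extChartAt (𝓡 n) y).target) : (extChartAt (𝓡 n) y).target ∈ 𝓝 z :=
  (isOpen_extChartAt_target y).mem_nhds hz

theorem chartForm_congr (α : ∀ x : N, TangentSpace (𝓡 n) x →L[ℝ] ℝ) (y : N)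
    (z v : EuclideanSpace ℝ (Fin n)) :
    chartForm α y z v = α (chartInv y z) (chartInvDeriv y z v) := rfl

variable [IsManifold (𝓡 n) ∞ N] [IsManifold (𝓡 m) ∞ N']

theorem contMDiffAt_chartInv {y : N} {z : EuclideanSpace ℝ (Fin n)}
    (hz : z ∈ (extChartAt (𝓡 n) y).target) :
    ContMDiffAt 𝓘(ℝ, EuclideanSpace ℝ (Fin n)) (𝓡 n) ∞ (chartInv y) z :=
  (contMDiffOn_extChartAt_symm y).contMDiffAt (target_mem_nhds hz)

theorem mdifferentiableAt_chartInv {y : N} {z : EuclideanSpace ℝ (Fin n)}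
    (hz : z ∈ (extChartAt (𝓡 n) y).target) :
    MDifferentiableAt 𝓘(ℝ, EuclideanSpace ℝ (Fin n)) (𝓡 n) (chartInv y) z :=
  (contMDiffAt_chartInv hz).mdifferentiableAt (by simp)

theorem contMDiffAt_chart {y q : N} (hq : q ∈ (extChartAt (𝓡 n) y).source) :
    ContMDiffAt (𝓡 n) 𝓘(ℝ, EuclideanSpace ℝ (Fin n)) ∞ (extChartAt (𝓡 n) y) q :=
  contMDiffAt_extChartAt' (by rwa [← extChartAt_source (𝓡 n)])

theorem mdifferentiableAt_chart {y q : N} (hq : q ∈ (extChartAt (𝓡 n) y).source) :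
    MDifferentiableAt (𝓡 n) 𝓘(ℝ, EuclideanSpace ℝ (Fin n)) (extChartAt (𝓡 n) y) q :=
  (contMDiffAt_chart hq).mdifferentiableAt (by simp)

theorem chartDeriv_chartInvDeriv {y : N} {z : EuclideanSpace ℝ (Fin n)}
    (hz : z ∈ (extChartAt (𝓡 n) y).target) (v : EuclideanSpace ℝ (Fin n)) :
    chartDeriv y (chartInv y z) (chartInvDeriv y z v) = v := by
  have hc := mfderiv_comp z (mdifferentiableAt_chart (chartInv_mem_source hz))
    (mdifferentiableAt_chartInv hz)
  have he : (extChartAt (𝓡 n) y ∘ chartInv y) =ᶠ[𝓝 z] id :=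
    Filter.eventuallyEq_of_mem (target_mem_nhds hz) fun w hw => extChartAt_chartInv hw
  rw [he.mfderiv_eq, mfderiv_id] at hc
  exact (congrArg (fun L : EuclideanSpace ℝ (Fin n) →L[ℝ] EuclideanSpace ℝ (Fin n) => L v) hc).symm

/-- A one-sided inverse between spaces of equal finite dimension is two-sided. -/
theorem chartInvDeriv_chartDeriv {y : N} {z : EuclideanSpace ℝ (Fin n)}
    (hz : z ∈ (extChartAt (𝓡 n) y).target) (v : TangentSpace (𝓡 n) (chartInv y z)) :
    chartInvDeriv y z (chartDeriv y (chartInv y z) v) = v := by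
  let D : EuclideanSpace ℝ (Fin n) →L[ℝ] EuclideanSpace ℝ (Fin n) := chartDeriv y (chartInv y z)
  have hs : Function.Surjective (D : EuclideanSpace ℝ (Fin n) →ₗ[ℝ] EuclideanSpace ℝ (Fin n)) :=
    fun w => ⟨chartInvDeriv y z w, chartDeriv_chartInvDeriv hz w⟩
  have hi := LinearMap.injective_iff_surjective.2 hs
  exact hi (chartDeriv_chartInvDeriv hz _)

theorem chartDeriv_surjective {y q : N} (hq : q ∈ (extChartAt (𝓡 n) y).source)
    (v : EuclideanSpace ℝ (Fin n)) : ∃ w : TangentSpace (𝓡 n) q, chartDeriv y q w = v := by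
  -- The point is rewritten as `chartInv y z` so that `chartInvDeriv y z` lands in its tangent space
  -- definitionally; `chartInv y (extChartAt (𝓡 n) y q) = q` is only a propositional equality.
  obtain ⟨z, hz, rfl⟩ : ∃ z ∈ (extChartAt (𝓡 n) y).target, chartInv y z = q :=
    ⟨_, (extChartAt (𝓡 n) y).map_source hq, chartInv_extChartAt hq⟩
  exact ⟨_, chartDeriv_chartInvDeriv hz v⟩

theorem chartDeriv_eq_zero {y q : N} (hq : q ∈ (extChartAt (𝓡 n) y).source)
    {w : TangentSpace (𝓡 n) q} (h : chartDeriv y q w = 0) : w = 0 := by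
  obtain ⟨z, hz, rfl⟩ : ∃ z ∈ (extChartAt (𝓡 n) y).target, chartInv y z = q :=
    ⟨_, (extChartAt (𝓡 n) y).map_source hq, chartInv_extChartAt hq⟩
  rw [← chartInvDeriv_chartDeriv hz w, h, map_zero]

/-- With `chartDeriv_surjective`, this reduces identities between coordinate expressions to
identities on tangent spaces. -/
theorem chartForm_chartDeriv (α : ∀ x : N, TangentSpace (𝓡 n) x →L[ℝ] ℝ) {y q : N}
    (hq : q ∈ (extChartAt (𝓡 n) y).source) (v : TangentSpace (𝓡 n) q) :
    chartForm α y (extChartAt (𝓡 n) y q) (chartDeriv y q v) = α q v := by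
  obtain ⟨z, hz, rfl⟩ : ∃ z ∈ (extChartAt (𝓡 n) y).target, chartInv y z = q :=
    ⟨_, (extChartAt (𝓡 n) y).map_source hq, chartInv_extChartAt hq⟩
  rw [extChartAt_chartInv hz, chartForm_congr, chartInvDeriv_chartDeriv hz]

theorem chartBilin_chartDeriv
    (h : ∀ x : N, TangentSpace (𝓡 n) x →L[ℝ] TangentSpace (𝓡 n) x →L[ℝ] ℝ) {y q : N}
    (hq : q ∈ (extChartAt (𝓡 n) y).source) (v w : TangentSpace (𝓡 n) q) :
    chartBilin h y (extChartAt (𝓡 n) y q) (chartDeriv y q v) (chartDeriv y q w) = h q v w := by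
  obtain ⟨z, hz, rfl⟩ : ∃ z ∈ (extChartAt (𝓡 n) y).target, chartInv y z = q :=
    ⟨_, (extChartAt (𝓡 n) y).map_source hq, chartInv_extChartAt hq⟩
  rw [extChartAt_chartInv hz]
  change h (chartInv y z) (chartInvDeriv y z _) (chartInvDeriv y z _) = _
  rw [chartInvDeriv_chartDeriv hz, chartInvDeriv_chartDeriv hz]

theorem fderiv_comp_chartInv {F : Type*} [NormedAddCommGroup F] [NormedSpace ℝ F] {h : N → F}
    {y q : N} (hq : q ∈ (extChartAt (𝓡 n) y).source)
    (hh : MDifferentiableAt (𝓡 n) 𝓘(ℝ, F) h q) (v : TangentSpace (𝓡 n) q) :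
    fderiv ℝ (h ∘ chartInv y) (extChartAt (𝓡 n) y q) (chartDeriv y q v) =
      mfderiv (𝓡 n) 𝓘(ℝ, F) h q v := by
  obtain ⟨z, hz, rfl⟩ : ∃ z ∈ (extChartAt (𝓡 n) y).target, chartInv y z = q :=
    ⟨_, (extChartAt (𝓡 n) y).map_source hq, chartInv_extChartAt hq⟩
  rw [extChartAt_chartInv hz, ← mfderiv_eq_fderiv,
    mfderiv_comp z hh (mdifferentiableAt_chartInv hz)]
  change mfderiv (𝓡 n) 𝓘(ℝ, F) h (chartInv y z) (chartInvDeriv y z (chartDeriv y _ v)) = _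
  rw [chartInvDeriv_chartDeriv hz]

theorem fderiv_chart_comp {ψ : N → N'} {y q : N} {x : N'}
    (hq : q ∈ (extChartAt (𝓡 n) y).source) (hx : ψ q ∈ (extChartAt (𝓡 m) x).source)
    (hψ : MDifferentiableAt (𝓡 n) (𝓡 m) ψ q) (v : TangentSpace (𝓡 n) q) :
    fderiv ℝ (fun z => extChartAt (𝓡 m) x (ψ (chartInv y z))) (extChartAt (𝓡 n) y q)
      (chartDeriv y q v) = chartDeriv x (ψ q) (mfderiv (𝓡 n) (𝓡 m) ψ q v) := by
  have h1 := fderiv_comp_chartInv hq ((mdifferentiableAt_chart hx).comp q hψ) v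
  rw [mfderiv_comp q (mdifferentiableAt_chart hx) hψ] at h1
  exact h1

theorem contDiffAt_comp_chartInv {F : Type*} [NormedAddCommGroup F] [NormedSpace ℝ F] {h : N → F}
    {y : N} {z : EuclideanSpace ℝ (Fin n)} (hz : z ∈ (extChartAt (𝓡 n) y).target)
    (hh : ContMDiffAt (𝓡 n) 𝓘(ℝ, F) ∞ h (chartInv y z)) : ContDiffAt ℝ ∞ (h ∘ chartInv y) z :=
  (hh.comp z (contMDiffAt_chartInv hz)).contDiffAt

/-- The tangent map of the smooth inverse chart, composed with the constant section `v`. -/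
theorem contMDiffAt_chartInvDeriv {y : N} {z : EuclideanSpace ℝ (Fin n)}
    (hz : z ∈ (extChartAt (𝓡 n) y).target) (v : EuclideanSpace ℝ (Fin n)) :
    ContMDiffAt 𝓘(ℝ, EuclideanSpace ℝ (Fin n)) (𝓡 n).tangent ∞
      (fun w => (⟨chartInv y w, chartInvDeriv y w v⟩ : TangentBundle (𝓡 n) N)) z := by
  have h1 := (contMDiffOn_extChartAt_symm (I := 𝓡 n) (n := ∞) y).contMDiffOn_tangentMapWithin
    (m := ∞) (by norm_cast) (isOpen_extChartAt_target y).uniqueMDiffOn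
  have h2 : ContMDiff 𝓘(ℝ, EuclideanSpace ℝ (Fin n)) 𝓘(ℝ, EuclideanSpace ℝ (Fin n)).tangent ∞
      (fun w => (⟨w, v⟩ : TangentBundle 𝓘(ℝ, EuclideanSpace ℝ (Fin n))
        (EuclideanSpace ℝ (Fin n)))) :=
    contMDiff_vectorSpace_iff_contDiff.2 contDiff_const
  have h3 := h1.comp h2.contMDiffOn (s := (extChartAt (𝓡 n) y).target) fun w hw => hw
  refine (h3.contMDiffAt (target_mem_nhds hz)).congr_of_eventuallyEq ?_
  filter_upwards [target_mem_nhds hz] with w hw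
  simp only [Function.comp, tangentMapWithin]
  rw [mfderivWithin_of_isOpen (isOpen_extChartAt_target y) hw]
  rfl

/-- In finite dimension a family of linear maps is smooth once its value on each fixed vector is;
these values pair the smooth section `α` with the smooth coordinate fields. -/
theorem contDiffAt_chartForm {α : ∀ x : N, TangentSpace (𝓡 n) x →L[ℝ] ℝ}
    (hα : ContMDiff (𝓡 n) ((𝓡 n).prod 𝓘(ℝ, EuclideanSpace ℝ (Fin n) →L[ℝ] ℝ)) ∞
      (fun y => Bundle.TotalSpace.mk' (EuclideanSpace ℝ (Fin n) →L[ℝ] ℝ)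
        (E := fun y : N => TangentSpace (𝓡 n) y →L[ℝ] ℝ) y (α y)))
    {y : N} {z : EuclideanSpace ℝ (Fin n)} (hz : z ∈ (extChartAt (𝓡 n) y).target) :
    ContDiffAt ℝ ∞ (chartForm α y) z := by
  refine (contDiffOn_clm_apply.2 fun v w hw => ?_ : ContDiffOn ℝ ∞ (chartForm α y)
    (extChartAt (𝓡 n) y).target).contDiffAt (target_mem_nhds hz)
  have h1 : ContMDiffAt 𝓘(ℝ, EuclideanSpace ℝ (Fin n)) ((𝓡 n).prod 𝓘(ℝ, ℝ)) ∞
      (fun m => Bundle.TotalSpace.mk' ℝ (E := Bundle.Trivial N ℝ) (chartInv y m)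
        (α (chartInv y m) (chartInvDeriv y m v))) w := by
    apply ContMDiffAt.clm_bundle_apply (F₁ := EuclideanSpace ℝ (Fin n))
    · exact ContMDiffAt.comp w hα.contMDiffAt (contMDiffAt_chartInv hw)
    · exact contMDiffAt_chartInvDeriv hw v
  simp only [Bundle.contMDiffAt_totalSpace] at h1
  exact h1.2.contDiffAt.contDiffWithinAt

theorem contDiffAt_chartBilin
    {h : ∀ x : N, TangentSpace (𝓡 n) x →L[ℝ] TangentSpace (𝓡 n) x →L[ℝ] ℝ}
    (hh : ContMDiff (𝓡 n)
      ((𝓡 n).prod 𝓘(ℝ, EuclideanSpace ℝ (Fin n) →L[ℝ] EuclideanSpace ℝ (Fin n) →L[ℝ] ℝ)) ∞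
      (fun x => Bundle.TotalSpace.mk'
        (EuclideanSpace ℝ (Fin n) →L[ℝ] EuclideanSpace ℝ (Fin n) →L[ℝ] ℝ)
        (E := fun x : N => TangentSpace (𝓡 n) x →L[ℝ] TangentSpace (𝓡 n) x →L[ℝ] ℝ) x (h x)))
    {y : N} {z : EuclideanSpace ℝ (Fin n)} (hz : z ∈ (extChartAt (𝓡 n) y).target) :
    ContDiffAt ℝ ∞ (chartBilin h y) z := by
  have key : ∀ (u v w : EuclideanSpace ℝ (Fin n)), w ∈ (extChartAt (𝓡 n) y).target →
      ContDiffAt ℝ ∞ (fun p => chartBilin h y p u v) w := by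
    intro u v w hw
    have h1 : ContMDiffAt 𝓘(ℝ, EuclideanSpace ℝ (Fin n)) ((𝓡 n).prod 𝓘(ℝ, ℝ)) ∞
        (fun m => Bundle.TotalSpace.mk' ℝ (E := Bundle.Trivial N ℝ) (chartInv y m)
          (h (chartInv y m) (chartInvDeriv y m u) (chartInvDeriv y m v))) w := by
      apply ContMDiffAt.clm_bundle_apply₂ (F₁ := EuclideanSpace ℝ (Fin n))
        (F₂ := EuclideanSpace ℝ (Fin n))
      · exact ContMDiffAt.comp w hh.contMDiffAt (contMDiffAt_chartInv hw)
      · exact contMDiffAt_chartInvDeriv hw u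
      · exact contMDiffAt_chartInvDeriv hw v
    simp only [Bundle.contMDiffAt_totalSpace] at h1
    exact h1.2.contDiffAt
  refine (contDiffOn_clm_apply.2 fun u => contDiffOn_clm_apply.2 fun v w hw => ?_ :
    ContDiffOn ℝ ∞ (chartBilin h y) (extChartAt (𝓡 n) y).target).contDiffAt (target_mem_nhds hz)
  exact (key u v w hw).contDiffWithinAt

/-- Chart independence of the exterior derivative: `dForm` at `q` uses the chart preferred at `q`,
while the argument fixes the chart at `y` and lets `q` vary. The two expressions of the form differ
by pullback along the transition map, which commutes with d. -/
theorem dForm_eq_extD {α : ∀ x : N, TangentSpace (𝓡 n) x →L[ℝ] ℝ} {y q : N}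
    (hq : q ∈ (extChartAt (𝓡 n) y).source)
    (hα : DifferentiableAt ℝ (chartForm α y) (extChartAt (𝓡 n) y q))
    (v w : TangentSpace (𝓡 n) q) :
    dForm α q v w = extD (chartForm α y) (extChartAt (𝓡 n) y q) (chartDeriv y q v)
      (chartDeriv y q w) := by
  set τ : EuclideanSpace ℝ (Fin n) → EuclideanSpace ℝ (Fin n) :=
    extChartAt (𝓡 n) y ∘ chartInv q with hτ
  set z := extChartAt (𝓡 n) q q with hz
  have hzt : z ∈ (extChartAt (𝓡 n) q).target := mem_extChartAt_target q
  have hqq : q ∈ (extChartAt (𝓡 n) q).source := mem_extChartAt_source q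
  have hqz : chartInv q z = q := chartInv_extChartAt hqq
  have hnear : ∀ᶠ p in 𝓝 z, p ∈ (extChartAt (𝓡 n) q).target ∧
      chartInv q p ∈ (extChartAt (𝓡 n) y).source := by
    refine Filter.Eventually.and (target_mem_nhds hzt) ?_
    refine (contMDiffAt_chartInv hzt).continuousAt.eventually_mem ?_
    exact (isOpen_extChartAt_source y).mem_nhds (by rwa [hqz])
  have hpull : chartForm α q =ᶠ[𝓝 z] pullForm τ (chartForm α y) := by
    filter_upwards [hnear] with p hp
    ext a
    obtain ⟨b, hb⟩ := chartDeriv_surjective (chartInv_mem_source hp.1) a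
    have h1 := chartForm_chartDeriv α (chartInv_mem_source hp.1) b
    have h2 := chartForm_chartDeriv α hp.2 b
    have h3 := fderiv_comp_chartInv (chartInv_mem_source hp.1) (mdifferentiableAt_chart hp.2) b
    rw [extChartAt_chartInv hp.1] at h1 h3
    rw [hb] at h1 h3
    rw [h1, ← h2, pullForm, ContinuousLinearMap.comp_apply, h3]
    rfl
  have hτs : ContDiffAt ℝ ∞ τ z := contDiffAt_comp_chartInv hzt (by
    rw [hqz]; exact contMDiffAt_chart hq)
  have hτz : τ z = extChartAt (𝓡 n) y q := by simp [hτ, hqz]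
  have hd : ∀ a : TangentSpace (𝓡 n) q, fderiv ℝ τ z (chartDeriv q q a) = chartDeriv y q a :=
    fun a => fderiv_comp_chartInv hqq (mdifferentiableAt_chart hq) a
  change extD (chartForm α q) z (chartDeriv q q v) (chartDeriv q q w) = _
  rw [extD_congr hpull, extD_pullForm (hτs.of_le (by norm_cast)) (by rwa [hτz]), hd,
    hd, hτz]

end Charts

end

/-! ### Infinitesimal geometry of the circle action -/

noncomputable section

section Bundle

variable {M : Type*} [TopologicalSpace M] [ChartedSpace (EuclideanSpace ℝ (Fin 2)) M]
  {P : Type*} [TopologicalSpace P] [ChartedSpace (EuclideanSpace ℝ (Fin 3)) P]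
  [MulAction Circle P] {π : P → M}

theorem IsPrincipalCircleBundle.contMDiff_smul_const (hπ : IsPrincipalCircleBundle π) (a : Circle) :
    ContMDiff (𝓡 3) (𝓡 3) ∞ (fun q : P => a • q) :=
  hπ.smooth_smul.comp (contMDiff_const.prodMk contMDiff_id)

theorem IsPrincipalCircleBundle.contMDiff_orbit (hπ : IsPrincipalCircleBundle π) (q : P) :
    ContMDiff 𝓘(ℝ, ℝ) (𝓡 3) ∞ (fun s : ℝ => Circle.exp s • q) :=
  hπ.smooth_smul.comp (contMDiff_circleExp.prodMk contMDiff_const)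

theorem IsPrincipalCircleBundle.mfderiv_comp_orbit (hπ : IsPrincipalCircleBundle π)
    {F : Type*} [NormedAddCommGroup F] [NormedSpace ℝ F] {N : Type*} [TopologicalSpace N]
    [ChartedSpace F N] {h : P → N} {q : P} (hh : MDifferentiableAt (𝓡 3) 𝓘(ℝ, F) h q) :
    (mfderiv 𝓘(ℝ, ℝ) 𝓘(ℝ, F) (fun s : ℝ => h (Circle.exp s • q)) 0 : ℝ →L[ℝ] F) 1 =
      mfderiv (𝓡 3) 𝓘(ℝ, F) h q (fundamentalField q) := by
  set γ : ℝ → P := fun s => Circle.exp s • q with hγ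
  -- The base point is generalized because `Circle.exp 0 • q` equals `q` only propositionally, which
  -- matters for the type of the derivative.
  have key : ∀ q' : P, γ 0 = q' → MDifferentiableAt (𝓡 3) 𝓘(ℝ, F) h q' →
      (mfderiv 𝓘(ℝ, ℝ) 𝓘(ℝ, F) (h ∘ γ) 0 : ℝ →L[ℝ] F) 1 =
        (mfderiv (𝓡 3) 𝓘(ℝ, F) h q' : EuclideanSpace ℝ (Fin 3) →L[ℝ] F)
          ((mfderiv 𝓘(ℝ, ℝ) (𝓡 3) γ 0 : ℝ →L[ℝ] EuclideanSpace ℝ (Fin 3)) 1) := by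
    rintro q' rfl hq'
    rw [mfderiv_comp 0 hq' ((hπ.contMDiff_orbit q).mdifferentiable (by simp) 0)]
    rfl
  exact key q (by simp [hγ]) hh

/-- Invariant maps have vanishing derivative along the fundamental field. -/
theorem IsPrincipalCircleBundle.mfderiv_fundamentalField (hπ : IsPrincipalCircleBundle π)
    {F : Type*} [NormedAddCommGroup F] [NormedSpace ℝ F] {N : Type*} [TopologicalSpace N]
    [ChartedSpace F N] {h : P → N} {q : P} (hh : MDifferentiableAt (𝓡 3) 𝓘(ℝ, F) h q)
    (hinv : ∀ (a : Circle) (q : P), h (a • q) = h q) :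
    mfderiv (𝓡 3) 𝓘(ℝ, F) h q (fundamentalField q) = 0 := by
  have hc : ∀ γ : ℝ → N, γ = (fun _ => h q) →
      (mfderiv 𝓘(ℝ, ℝ) 𝓘(ℝ, F) γ 0 : ℝ →L[ℝ] F) 1 = 0 := by
    rintro _ rfl
    rw [mfderiv_const]
    rfl
  rw [← hπ.mfderiv_comp_orbit hh]
  exact hc _ (funext fun s => hinv _ _)

/-- A trivialization gives a local section through `q`, whose differential is a right inverse. -/
theorem IsPrincipalCircleBundle.projDeriv_surjective (hπ : IsPrincipalCircleBundle π) (q : P) :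
    Function.Surjective (projDeriv π q) := by
  obtain ⟨t, hx, -, hsymm, -⟩ := hπ.locally_trivial (π q)
  have hq : q ∈ t.source := by rwa [t.mem_source]
  set σ : M → P := fun x => t.toOpenPartialHomeomorph.symm (x, (t q).2) with hσ
  have hmem : (π q, (t q).2) ∈ t.target := t.mem_target.2 hx
  have hσq : σ (π q) = q := by
    have : (π q, (t q).2) = t q := Prod.ext (t.coe_fst hq).symm rfl
    simp only [hσ, this]
    exact t.toOpenPartialHomeomorph.left_inv hq
  have hσs : ContMDiffAt (𝓡 2) (𝓡 3) ∞ σ (π q) := by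
    have h1 := hsymm.contMDiffAt (t.open_target.mem_nhds hmem)
    exact h1.comp (π q) (contMDiffAt_id.prodMk contMDiffAt_const)
  have hid : (π ∘ σ) =ᶠ[𝓝 (π q)] id := by
    filter_upwards [t.open_baseSet.mem_nhds hx] with x hx'
    exact t.proj_symm_apply (t.mem_target.2 hx')
  have hπd : MDifferentiableAt (𝓡 3) (𝓡 2) π (σ (π q)) :=
    (hπ.smooth_proj _).mdifferentiableAt (by simp)
  have hc := mfderiv_comp (π q) hπd (hσs.mdifferentiableAt (by simp))
  rw [hid.mfderiv_eq, mfderiv_id] at hc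
  intro v
  have hv := congrArg (fun L : EuclideanSpace ℝ (Fin 2) →L[ℝ] EuclideanSpace ℝ (Fin 2) => L v) hc
  have hs : ∀ q' : P, σ (π q) = q' → ∃ w : EuclideanSpace ℝ (Fin 3),
      (mfderiv (𝓡 3) (𝓡 2) π q' : EuclideanSpace ℝ (Fin 3) →L[ℝ] EuclideanSpace ℝ (Fin 2)) w = v := by
    rintro q' rfl
    exact ⟨mfderiv (𝓡 2) (𝓡 3) σ (π q) v, hv.symm⟩
  exact hs q hσq

variable [IsManifold (𝓡 3) ∞ P]

/-- Any lift of a base vector can be corrected by a vertical multiple to have a prescribed value of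
`κ`, so the map is onto, and 3 = 2 + 1. Hence `horizontalLift` uses a genuine inverse. -/
theorem IsPrincipalCircleBundle.isInvertible_prod (hπ : IsPrincipalCircleBundle π)
    {κ : ∀ q : P, TangentSpace (𝓡 3) q →L[ℝ] ℝ} (hκ : IsConnectionForm κ) (q : P) :
    ((projDeriv π q).prod (κ q)).IsInvertible := by
  set A : EuclideanSpace ℝ (Fin 3) →L[ℝ] EuclideanSpace ℝ (Fin 2) × ℝ :=
    (projDeriv π q).prod (κ q) with hA
  have hs : Function.Surjective A := by
    rintro ⟨a, c⟩
    obtain ⟨v, hv⟩ := hπ.projDeriv_surjective q a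
    have h0 : projDeriv π q (fundamentalField q) = 0 :=
      hπ.mfderiv_fundamentalField ((hπ.smooth_proj q).mdifferentiableAt (by simp)) hπ.proj_smul
    refine ⟨v + (c - κ q v) • fundamentalField q, Prod.ext ?_ ?_⟩
    · change projDeriv π q (v + (c - κ q v) • fundamentalField q) = a
      rw [map_add, map_smul, h0, hv, smul_zero]
      exact add_zero a
    · change κ q (v + (c - κ q v) • fundamentalField q) = c
      rw [map_add, map_smul, hκ.fundamental, smul_eq_mul]
      ring
  have hi : Function.Injective A :=
    (LinearMap.injective_iff_surjective_of_finrank_eq_finrank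
      (f := (A : EuclideanSpace ℝ (Fin 3) →ₗ[ℝ] EuclideanSpace ℝ (Fin 2) × ℝ)) (by simp)).2 hs
  exact isInvertible_of_injective A (by simp) hi

/-- Cartan's formula: ι_ξ dκ = L_ξ κ - d(κ(ξ)), where the first term vanishes by invariance and the
second because κ(ξ) = 1. In coordinates the action becomes a map `Φ (s, z)`; the two facts are
differentiated separately and compared through the mixed partials of `Φ`. -/
theorem IsPrincipalCircleBundle.dForm_fundamentalField (hπ : IsPrincipalCircleBundle π)
    {κ : ∀ q : P, TangentSpace (𝓡 3) q →L[ℝ] ℝ} (hκ : IsConnectionForm κ) (y : P)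
    (w : TangentSpace (𝓡 3) y) : dForm κ y (fundamentalField y) w = 0 := by
  set z₀ := extChartAt (𝓡 3) y y with hz₀
  have hz₀t : z₀ ∈ (extChartAt (𝓡 3) y).target := mem_extChartAt_target y
  have hyz : chartInv y z₀ = y := chartInv_extChartAt (mem_extChartAt_source y)
  set β := chartForm κ y with hβ
  have hβs : ContDiffAt ℝ ∞ β z₀ := contDiffAt_chartForm hκ.smooth hz₀t
  set μ : ℝ × EuclideanSpace ℝ (Fin 3) → P := fun p => Circle.exp p.1 • chartInv y p.2 with hμ
  set Φ : ℝ × EuclideanSpace ℝ (Fin 3) → EuclideanSpace ℝ (Fin 3) :=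
    fun p => extChartAt (𝓡 3) y (μ p) with hΦ
  have hμ₀ : μ (0, z₀) = y := by simp [hμ, hyz]
  have hμs : ContMDiffAt 𝓘(ℝ, ℝ × EuclideanSpace ℝ (Fin 3)) (𝓡 3) ∞ μ (0, z₀) := by
    refine hπ.smooth_smul.contMDiffAt.comp (0, z₀) (ContMDiffAt.prodMk ?_ ?_)
    · exact contMDiff_circleExp.contMDiffAt.comp (0, z₀) contDiffAt_fst.contMDiffAt
    · exact (contMDiffAt_chartInv hz₀t).comp (0, z₀) contDiffAt_snd.contMDiffAt
  have hΦs : ContDiffAt ℝ ∞ Φ (0, z₀) :=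
    ((contMDiffAt_chart (by rw [hμ₀]; exact mem_extChartAt_source y)).comp (0, z₀) hμs).contDiffAt
  have hΦ₀ : Φ (0, z₀) = z₀ := by simp [hΦ, hμ₀]; rfl
  have hnear : ∀ᶠ p in 𝓝 ((0 : ℝ), z₀), p.2 ∈ (extChartAt (𝓡 3) y).target ∧
      μ p ∈ (extChartAt (𝓡 3) y).source ∧ DifferentiableAt ℝ Φ p := by
    refine Filter.Eventually.and ?_ (Filter.Eventually.and ?_ hΦs.eventually_differentiableAt)
    · exact continuousAt_snd.eventually_mem (target_mem_nhds hz₀t)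
    · exact hμs.continuousAt.eventually_mem
        ((isOpen_extChartAt_source y).mem_nhds (by rw [hμ₀]; exact mem_extChartAt_source y))
  have hslice : ∀ p, DifferentiableAt ℝ Φ p → ∀ v, fderiv ℝ Φ p (0, v) =
      fderiv ℝ (fun z => Φ (p.1, z)) p.2 v := by
    intro p hp v
    have h1 := (hp.hasFDerivAt (x := (p.1, p.2))).comp p.2 (hasFDerivAt_prodMk_right p.1 p.2)
    have h2 := h1.fderiv
    simp only [Function.comp_def] at h2
    rw [h2]; rfl
  have hslice' : ∀ p, DifferentiableAt ℝ Φ p → fderiv ℝ Φ p (1, 0) =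
      fderiv ℝ (fun s => Φ (s, p.2)) p.1 1 := by
    intro p hp
    have h0 : HasFDerivAt (fun s : ℝ => (s, p.2)) (ContinuousLinearMap.inl ℝ ℝ _) p.1 :=
      hasFDerivAt_prodMk_left p.1 p.2
    have h1 := (hp.hasFDerivAt (x := (p.1, p.2))).comp p.1 h0
    have h2 := h1.fderiv
    simp only [Function.comp_def] at h2
    rw [h2]; rfl
  have hinv : ∀ v, ∀ᶠ p in 𝓝 ((0 : ℝ), z₀), β (Φ p) (fderiv ℝ Φ p (0, v)) = β p.2 v := by
    intro v
    filter_upwards [hnear] with p hp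
    have hq := chartInv_mem_source hp.1
    obtain ⟨b, hb⟩ := chartDeriv_surjective hq v
    have h1 := fderiv_chart_comp (ψ := fun q : P => Circle.exp p.1 • q) (x := y) hq hp.2.1
      ((hπ.contMDiff_smul_const (Circle.exp p.1)).mdifferentiable (by simp) _) b
    rw [extChartAt_chartInv hp.1, hb] at h1
    have h2 := chartForm_chartDeriv κ hq b
    rw [extChartAt_chartInv hp.1, hb] at h2
    rw [hslice p hp.2.2]
    change β (Φ p) (fderiv ℝ (fun z => extChartAt (𝓡 3) y (Circle.exp p.1 • chartInv y z)) p.2 v) = _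
    rw [h1]
    change chartForm κ y (extChartAt (𝓡 3) y (Circle.exp p.1 • chartInv y p.2)) _ = _
    rw [chartForm_chartDeriv κ hp.2.1, hκ.invariant, h2]
  have hfund : ∀ z, z ∈ (extChartAt (𝓡 3) y).target → DifferentiableAt ℝ Φ (0, z) →
      fderiv ℝ Φ (0, z) (1, 0) = chartDeriv y (chartInv y z) (fundamentalField (chartInv y z)) := by
    intro z hz hd
    rw [hslice' _ hd, ← mfderiv_eq_fderiv]
    exact hπ.mfderiv_comp_orbit (mdifferentiableAt_chart (chartInv_mem_source hz))
  have hone : ∀ᶠ z in 𝓝 z₀, β z (fderiv ℝ Φ (0, z) (1, 0)) = 1 := by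
    have hc : ContinuousAt (fun z => ((0 : ℝ), z)) z₀ := by fun_prop
    filter_upwards [hc.eventually hnear] with z hz
    rw [hfund z hz.1 hz.2.2]
    have := chartForm_chartDeriv κ (chartInv_mem_source hz.1) (fundamentalField (chartInv y z))
    rw [extChartAt_chartInv hz.1, hκ.fundamental] at this
    exact this
  have hid : ∀ v, fderiv ℝ Φ (0, z₀) (0, v) = v := by
    intro v
    rw [hslice _ hΦs.differentiableAt_infty]
    have : (fun z => Φ (0, z)) =ᶠ[𝓝 z₀] id := by
      filter_upwards [target_mem_nhds hz₀t] with z hz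
      change extChartAt (𝓡 3) y (Circle.exp 0 • chartInv y z) = z
      rw [Circle.exp_zero, one_smul, extChartAt_chartInv hz]
    rw [this.fderiv_eq, fderiv_id]
    rfl
  set ξ := fderiv ℝ Φ (0, z₀) (1, 0) with hξ
  have hΦd := hΦs.differentiableAt_infty
  have hDΦd := hΦs.fderiv_infty.differentiableAt_infty
  have hβd := hβs.differentiableAt_infty
  -- The `s`-derivative at 0 of the invariance `hinv`, whose right side does not depend on `s`; this
  -- is L_ξ κ = 0.
  have e1 : ∀ v, fderiv ℝ β z₀ ξ v + β z₀ (fderiv ℝ (fderiv ℝ Φ) (0, z₀) (1, 0) (0, v)) = 0 := by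
    intro v
    have hβΦ₀ : HasFDerivAt β (fderiv ℝ β z₀) (Φ (0, z₀)) := by
      rw [hΦ₀]; exact hβd.hasFDerivAt
    have hβΦ : HasFDerivAt (fun p => β (Φ p)) ((fderiv ℝ β z₀).comp (fderiv ℝ Φ (0, z₀))) (0, z₀) :=
      hβΦ₀.comp (0, z₀) hΦd.hasFDerivAt
    have hl := hβΦ.clm_apply (hDΦd.hasFDerivAt.clm_apply (hasFDerivAt_const ((0 : ℝ), v) _))
    have hr : HasFDerivAt (fun p : ℝ × EuclideanSpace ℝ (Fin 3) => β p.2 v)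
        (((fderiv ℝ β z₀).flip v).comp (ContinuousLinearMap.snd ℝ ℝ _)) (0, z₀) := by
      have h3 : HasFDerivAt (fun z => β z v) ((fderiv ℝ β z₀).flip v) z₀ := by
        have := hβd.hasFDerivAt.clm_apply (hasFDerivAt_const v z₀)
        refine this.congr_fderiv ?_
        ext x; simp
      exact HasFDerivAt.comp (g := fun z => β z v) (f := Prod.snd) ((0 : ℝ), z₀) h3
        (hasFDerivAt_snd (𝕜 := ℝ))
    have hu := hl.unique (hr.congr_of_eventuallyEq (hinv v))
    have := congrArg (fun L : ℝ × EuclideanSpace ℝ (Fin 3) →L[ℝ] ℝ => L (1, 0)) hu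
    simp [hΦ₀, hid] at this
    linarith
  -- The derivative of κ(ξ) = 1 along `v`.
  have e2 : ∀ v, fderiv ℝ β z₀ v ξ + β z₀ (fderiv ℝ (fderiv ℝ Φ) (0, z₀) (0, v) (1, 0)) = 0 := by
    intro v
    have hΨ : HasFDerivAt (fun z => fderiv ℝ Φ (0, z))
        ((fderiv ℝ (fderiv ℝ Φ) (0, z₀)).comp (ContinuousLinearMap.inr ℝ ℝ _)) z₀ :=
      HasFDerivAt.comp z₀ hDΦd.hasFDerivAt (hasFDerivAt_prodMk_right (0 : ℝ) z₀)
    have hl := hβd.hasFDerivAt.clm_apply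
      (hΨ.clm_apply (hasFDerivAt_const ((1 : ℝ), (0 : EuclideanSpace ℝ (Fin 3))) z₀))
    have hu := hl.unique ((hasFDerivAt_const (1 : ℝ) z₀).congr_of_eventuallyEq hone)
    have := congrArg (fun L : EuclideanSpace ℝ (Fin 3) →L[ℝ] ℝ => L v) hu
    simp at this
    linarith
  have hξy : chartVec y (fundamentalField y) = ξ := by
    have := hfund z₀ hz₀t hΦd
    rw [hξ, this]
    have hcongr : ∀ q q' : P, q = q' → (chartDeriv y q (fundamentalField q)) =
        chartDeriv y q' (fundamentalField q') := by rintro q _ rfl; rfl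
    exact hcongr _ _ hyz.symm
  change fderiv ℝ β z₀ (chartVec y (fundamentalField y)) (chartVec y w)
    - fderiv ℝ β z₀ (chartVec y w) (chartVec y (fundamentalField y)) = 0
  have h1 := e1 (chartVec y w)
  have h2 := e2 (chartVec y w)
  rw [hΦs.fderiv_fderiv_symm] at h1
  rw [hξy]
  linarith

end Bundle

end

/-! ### Oriented orthonormal frames of the base -/

noncomputable section

section Base

variable {M : Type*} [TopologicalSpace M] [ChartedSpace (EuclideanSpace ℝ (Fin 2)) M]

/-- `Θ, E` is an orthonormal frame of the oriented surface in the preferred chart at `x₀`, with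
connection form `α`; the sign `s` records its orientation. -/
structure IsBaseFrame
    (g vol : ∀ x : M, TangentSpace (𝓡 2) x →L[ℝ] TangentSpace (𝓡 2) x →L[ℝ] ℝ) (x₀ : M)
    (Θ : Fin 2 → EuclideanSpace ℝ (Fin 2) → EuclideanSpace ℝ (Fin 2) →L[ℝ] ℝ)
    (E : Fin 2 → EuclideanSpace ℝ (Fin 2) → EuclideanSpace ℝ (Fin 2))
    (α : EuclideanSpace ℝ (Fin 2) → EuclideanSpace ℝ (Fin 2) →L[ℝ] ℝ) (s : ℝ) : Prop where
  frame : IsMovingFrame (chartBilin g x₀) Θ E (rotConn α) (extChartAt (𝓡 2) x₀ x₀)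
  smooth_conn : ContDiffAt ℝ ∞ α (extChartAt (𝓡 2) x₀ x₀)
  sign : s * s = 1
  area : ∀ᶠ b in 𝓝 (extChartAt (𝓡 2) x₀ x₀), ∀ u v,
    chartBilin vol x₀ b u v = s * (Θ 0 b u * Θ 1 b v - Θ 0 b v * Θ 1 b u)

/-- The coframe of an `IsBaseFrame`, as linear forms on the tangent spaces of the surface. -/
def baseCoframe (x₀ : M)
    (Θ : Fin 2 → EuclideanSpace ℝ (Fin 2) → EuclideanSpace ℝ (Fin 2) →L[ℝ] ℝ) (i : Fin 2) (x : M) :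
    TangentSpace (𝓡 2) x →L[ℝ] ℝ :=
  (Θ i (extChartAt (𝓡 2) x₀ x)).comp (chartDeriv x₀ x)

/-- `t` is an orthonormal coframe at `x`, with orientation sign `s`. -/
structure IsOrthoCoframe
    (g vol : ∀ x : M, TangentSpace (𝓡 2) x →L[ℝ] TangentSpace (𝓡 2) x →L[ℝ] ℝ) (x : M)
    (t : Fin 2 → TangentSpace (𝓡 2) x →L[ℝ] ℝ) (s : ℝ) : Prop where
  sign : s * s = 1
  metric : ∀ a b, g x a b = t 0 a * t 0 b + t 1 a * t 1 b
  area : ∀ a b, vol x a b = s * (t 0 a * t 1 b - t 0 b * t 1 a)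
  dual : ∃ w : Fin 2 → TangentSpace (𝓡 2) x, ∀ i j, t i (w j) = if i = j then 1 else 0

variable {g vol : ∀ x : M, TangentSpace (𝓡 2) x →L[ℝ] TangentSpace (𝓡 2) x →L[ℝ] ℝ}

theorem tangent_expand_of_dual {x : M} {t : Fin 2 → TangentSpace (𝓡 2) x →L[ℝ] ℝ}
    {w : Fin 2 → TangentSpace (𝓡 2) x}
    (hw : ∀ i j, t i (w j) = if i = j then 1 else 0) (a : TangentSpace (𝓡 2) x) :
    t 0 a • w 0 + t 1 a • w 1 = a := by
  have := expand_of_dual (E := EuclideanSpace ℝ (Fin 2)) (by simp) t w hw a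
  rwa [Fin.sum_univ_two] at this

/-- Multiplicativity of determinants: the dual vectors have area 1, which is the area of the
coordinate basis times the determinant of their coordinates. -/
theorem tangentBasis_area_ne_zero {x : M} {t : Fin 2 → TangentSpace (𝓡 2) x →L[ℝ] ℝ}
    {w : Fin 2 → TangentSpace (𝓡 2) x}
    (hw : ∀ i j, t i (w j) = if i = j then 1 else 0) :
    t 0 (tangentBasis x 0) * t 1 (tangentBasis x 1)
      - t 0 (tangentBasis x 1) * t 1 (tangentBasis x 0) ≠ 0 := by
  intro h0
  have hexp : ∀ v : TangentSpace (𝓡 2) x, ∃ c d : ℝ, ∀ k : Fin 2,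
      t k v = c * t k (tangentBasis x 0) + d * t k (tangentBasis x 1) := by
    intro (v : EuclideanSpace ℝ (Fin 2))
    have hv : v = v 0 • (EuclideanSpace.single 0 1 : EuclideanSpace ℝ (Fin 2))
        + v 1 • (EuclideanSpace.single 1 1 : EuclideanSpace ℝ (Fin 2)) := by
      ext i
      fin_cases i <;> simp
    refine ⟨v 0, v 1, fun k => ?_⟩
    let T : EuclideanSpace ℝ (Fin 2) →L[ℝ] ℝ := t k
    change T v = v 0 * T (EuclideanSpace.single 0 1) + v 1 * T (EuclideanSpace.single 1 1)
    conv_lhs => rw [hv]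
    simp only [map_add, map_smul, smul_eq_mul]
  obtain ⟨p, q, h1⟩ := hexp (w 0)
  obtain ⟨r, k, h2⟩ := hexp (w 1)
  have a00 := (h1 0).symm.trans (hw 0 0)
  have a01 := (h2 0).symm.trans (hw 0 1)
  have a10 := (h1 1).symm.trans (hw 1 0)
  have a11 := (h2 1).symm.trans (hw 1 1)
  simp only [if_true, Fin.isValue, zero_ne_one, one_ne_zero, if_false] at a00 a01 a10 a11
  set A := t 0 (tangentBasis x 0)
  set B := t 0 (tangentBasis x 1)
  set C := t 1 (tangentBasis x 0)
  set D := t 1 (tangentBasis x 1)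
  have : (1 : ℝ) = 0 := by
    have h1 : (p * A + q * B) * (r * C + k * D) - (r * A + k * B) * (p * C + q * D)
      = (p * k - q * r) * (A * D - B * C) := by ring
    rw [a00, a01, a10, a11, h0] at h1
    linarith
  exact one_ne_zero this

/-- The quotient is `c / s`, and `s` is its own inverse. -/
theorem IsOrthoCoframe.starTwo_eq {x : M} {t : Fin 2 → TangentSpace (𝓡 2) x →L[ℝ] ℝ} {s : ℝ}
    (h : IsOrthoCoframe g vol x t s) {β : TangentSpace (𝓡 2) x → TangentSpace (𝓡 2) x → ℝ} {c : ℝ}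
    (hβ : ∀ a b, β a b = c * (t 0 a * t 1 b - t 0 b * t 1 a)) : starTwo vol x β = s * c := by
  obtain ⟨w, hw⟩ := h.dual
  have hne := tangentBasis_area_ne_zero hw
  have hs : s ≠ 0 := fun h0 => by have := h.sign; simp [h0] at this
  rw [starTwo, hβ, h.area, div_eq_iff (mul_ne_zero hs hne)]
  linear_combination (-c * (t 0 (tangentBasis x 0) * t 1 (tangentBasis x 1)
      - t 0 (tangentBasis x 1) * t 1 (tangentBasis x 0))) * h.sign

theorem IsOrthoCoframe.normSqTwo_eq {x : M} {t : Fin 2 → TangentSpace (𝓡 2) x →L[ℝ] ℝ} {s : ℝ}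
    (h : IsOrthoCoframe g vol x t s) {β : TangentSpace (𝓡 2) x → TangentSpace (𝓡 2) x → ℝ} {c : ℝ}
    (hβ : ∀ a b, β a b = c * (t 0 a * t 1 b - t 0 b * t 1 a)) : normSqTwo g x β = c ^ 2 := by
  obtain ⟨w, hw⟩ := h.dual
  have hne := tangentBasis_area_ne_zero hw
  have hden : g x (tangentBasis x 0) (tangentBasis x 0) * g x (tangentBasis x 1) (tangentBasis x 1)
      - g x (tangentBasis x 0) (tangentBasis x 1) ^ 2 =
      (t 0 (tangentBasis x 0) * t 1 (tangentBasis x 1)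
      - t 0 (tangentBasis x 1) * t 1 (tangentBasis x 0)) ^ 2 := by
    simp only [h.metric]; ring
  rw [normSqTwo, hden, hβ, div_eq_iff (pow_ne_zero 2 hne)]
  ring

theorem IsOrthoCoframe.eq_zero {x : M} {t : Fin 2 → TangentSpace (𝓡 2) x →L[ℝ] ℝ} {s : ℝ}
    (h : IsOrthoCoframe g vol x t s) {a : TangentSpace (𝓡 2) x} (h0 : t 0 a = 0) (h1 : t 1 a = 0) :
    a = 0 := by
  obtain ⟨w, hw⟩ := h.dual
  rw [← tangent_expand_of_dual hw a, h0, h1, zero_smul, zero_smul, add_zero]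

/-- Nondegeneracy of `g x` makes the rotation the unique solution of g(Ja, ·) = vol(a, ·); the dual
vectors exhibit it. -/
theorem IsOrthoCoframe.rightRotation_eq {x : M} {t : Fin 2 → TangentSpace (𝓡 2) x →L[ℝ] ℝ} {s : ℝ}
    (h : IsOrthoCoframe g vol x t s) (a : TangentSpace (𝓡 2) x) :
    t 0 (rightRotation g vol x a) = -(s * t 1 a) ∧ t 1 (rightRotation g vol x a) = s * t 0 a := by
  obtain ⟨w, hw⟩ := h.dual
  have hw' := hw
  simp only [Fin.forall_fin_two, if_true, Fin.isValue, zero_ne_one, one_ne_zero, if_false] at hw'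
  obtain ⟨⟨a00, a01⟩, a10, a11⟩ := hw'
  have hinv : (g x).IsInvertible := by
    refine isInvertible_of_nondegenerate (E := EuclideanSpace ℝ (Fin 2)) (g x) fun v hv => ?_
    have hv' : t 0 v * t 0 v + t 1 v * t 1 v = 0 := (h.metric v v).symm.trans hv
    refine h.eq_zero ?_ ?_ <;> nlinarith [mul_self_nonneg (t 0 v), mul_self_nonneg (t 1 v)]
  have hJ : rightRotation g vol x a = -(s * t 1 a) • w 0 + (s * t 0 a) • w 1 := by
    refine hinv.inverse_apply_eq.2 (ContinuousLinearMap.ext fun b => Eq.symm ?_)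
    change g x (-(s * t 1 a) • w 0 + (s * t 0 a) • w 1) b = vol x a b
    rw [h.area, h.metric]
    simp only [map_add, map_smul, smul_eq_mul, a00, a01, a10, a11]
    ring
  rw [hJ]
  simp only [map_add, map_smul, smul_eq_mul, a00, a01, a10, a11]
  constructor <;> ring

variable {Θ : Fin 2 → EuclideanSpace ℝ (Fin 2) → EuclideanSpace ℝ (Fin 2) →L[ℝ] ℝ}
  {E : Fin 2 → EuclideanSpace ℝ (Fin 2) → EuclideanSpace ℝ (Fin 2)}
  {α : EuclideanSpace ℝ (Fin 2) → EuclideanSpace ℝ (Fin 2) →L[ℝ] ℝ} {s : ℝ} {x₀ : M}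

theorem IsBaseFrame.gauss (h : IsBaseFrame g vol x₀ Θ E α s) (u v : EuclideanSpace ℝ (Fin 2)) :
    extD α (extChartAt (𝓡 2) x₀ x₀) u v = gaussCurvature g x₀ *
      (Θ 0 (extChartAt (𝓡 2) x₀ x₀) u * Θ 1 (extChartAt (𝓡 2) x₀ x₀) v
        - Θ 0 (extChartAt (𝓡 2) x₀ x₀) v * Θ 1 (extChartAt (𝓡 2) x₀ x₀) u) := by
  have hne := tangentBasis_area_ne_zero (x := x₀) (t := fun i => Θ i (extChartAt (𝓡 2) x₀ x₀))
    (w := fun i => E i (extChartAt (𝓡 2) x₀ x₀)) h.frame.dual.self_of_nhds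
  have hg : gaussCurvature g x₀ = _ := gauss_of_surface_frame h.frame _ _ hne
  rw [hg]
  exact extD_two_form (θ := fun i => Θ i (extChartAt (𝓡 2) x₀ x₀))
    (e := fun i => E i (extChartAt (𝓡 2) x₀ x₀)) h.frame.expand.self_of_nhds α _ u v

variable [IsManifold (𝓡 2) ∞ M]

theorem IsBaseFrame.eventually_isOrthoCoframe (h : IsBaseFrame g vol x₀ Θ E α s) :
    ∀ᶠ x in 𝓝 x₀, IsOrthoCoframe g vol x (fun i => baseCoframe x₀ Θ i x) s := by
  have hc : ContinuousAt (extChartAt (𝓡 2) x₀) x₀ := continuousAt_extChartAt x₀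
  filter_upwards [hc.eventually h.frame.metric, hc.eventually h.frame.dual, hc.eventually h.area,
    extChartAt_source_mem_nhds (I := 𝓡 2) x₀] with x hm hd ha hx
  refine ⟨h.sign, fun a b => ?_, fun a b => ?_, ?_⟩
  · rw [← chartBilin_chartDeriv g hx, hm, Fin.sum_univ_two]
    rfl
  · rw [← chartBilin_chartDeriv vol hx, ha]
    rfl
  · choose w hw using fun i => chartDeriv_surjective hx (E i (extChartAt (𝓡 2) x₀ x))
    refine ⟨w, fun i j => ?_⟩
    change Θ i _ (chartDeriv x₀ x (w j)) = _
    rw [hw, hd]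

/-- The area `c` of the frame satisfies c² = 1 by `IsAreaForm.unit`. Being continuous it is locally
constant, and its value at the base point is the sign. -/
theorem exists_isBaseFrame
    (g : Bundle.ContMDiffRiemannianMetric (𝓡 2) ∞ (EuclideanSpace ℝ (Fin 2))
      (fun x : M => TangentSpace (𝓡 2) x)) (hvol : IsAreaForm g.inner vol) (x₀ : M)
    (u : Fin 2 → TangentSpace (𝓡 2) x₀)
    (hu : ∀ i j, g.inner x₀ (u i) (u j) = if i = j then 1 else 0) :
    ∃ Θ E α s, IsBaseFrame g.inner vol x₀ Θ E α s ∧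
      ∀ i, E i (extChartAt (𝓡 2) x₀ x₀) = chartDeriv x₀ x₀ (u i) := by
  set b₀ := extChartAt (𝓡 2) x₀ x₀ with hb₀
  have hbt : b₀ ∈ (extChartAt (𝓡 2) x₀).target := mem_extChartAt_target x₀
  have hG : ContDiffAt ℝ ∞ (chartBilin g.inner x₀) b₀ := contDiffAt_chartBilin g.contMDiff hbt
  have hV : ContDiffAt ℝ ∞ (chartBilin vol x₀) b₀ := contDiffAt_chartBilin hvol.smooth hbt
  obtain ⟨Θ, E, α, hfr, hα, hE⟩ := exists_surface_frame (by simp) hG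
    (Filter.Eventually.of_forall fun z v w => g.symm _ _ _)
    (fun i => chartDeriv x₀ x₀ (u i)) (fun i j => by
      rw [chartBilin_chartDeriv _ (mem_extChartAt_source x₀), hu])
  set c : EuclideanSpace ℝ (Fin 2) → ℝ := fun b => chartBilin vol x₀ b (E 0 b) (E 1 b) with hc
  have hcs : ContDiffAt ℝ ∞ c b₀ :=
    (hV.clm_apply (hfr.smooth_frame 0)).clm_apply (hfr.smooth_frame 1)
  have hcsq : ∀ᶠ b in 𝓝 b₀, c b * c b = 1 := by
    filter_upwards [hfr.metric, hfr.dual] with b hm hd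
    have h1 : c b ^ 2 = chartBilin g.inner x₀ b (E 0 b) (E 0 b) *
        chartBilin g.inner x₀ b (E 1 b) (E 1 b) - chartBilin g.inner x₀ b (E 0 b) (E 1 b) ^ 2 :=
      hvol.unit _ _ _
    simp [hm, hd] at h1
    rcases h1 with h1 | h1 <;> rw [h1] <;> norm_num
  have hs : c b₀ * c b₀ = 1 := hcsq.self_of_nhds
  have hconst : ∀ᶠ b in 𝓝 b₀, c b = c b₀ := by
    have hpos : ∀ᶠ b in 𝓝 b₀, 0 < c b * c b₀ :=
      (hcs.continuousAt.mul continuousAt_const).eventually_const_lt (by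
        change 0 < c b₀ * c b₀
        rw [hs]; norm_num)
    filter_upwards [hpos, hcsq] with b hb hb2
    have : (c b - c b₀) * (c b + c b₀) = 0 := by linear_combination hb2 - hs
    rcases mul_eq_zero.1 this with h | h
    · linarith
    · nlinarith
  refine ⟨Θ, E, α, c b₀, ⟨hfr, hα, hs, ?_⟩, hE⟩
  filter_upwards [hconst, hfr.expand] with b hb hexp u v
  have halt : ∀ v, chartBilin vol x₀ b v v = 0 := fun v => hvol.alternating _ _
  have hanti : ∀ u v, chartBilin vol x₀ b u v = -chartBilin vol x₀ b v u := by
    intro u v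
    have := halt (u + v)
    simp only [map_add, add_apply, halt] at this
    linarith
  rw [← hb]
  exact two_form_eq (θ := fun i => Θ i b) (e := fun i => E i b) hexp _ hanti u v

end Base

end

/-! ### Lifting a surface frame along a submersion with a connection form -/

noncomputable section

section Lift

variable {E B : Type*} [NormedAddCommGroup E] [NormedSpace ℝ E] [NormedAddCommGroup B]
  [NormedSpace ℝ B]

/-- The frame of horizontal lifts of `X` together with the normalized vertical field. -/
def liftFrame (p : E → B) (κ : E → E →L[ℝ] ℝ) (f : E → ℝ) (X : Fin 2 → B → B) : Fin 3 → E → E :=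
  ![fun z => ((fderiv ℝ p z).prod (κ z)).inverse (X 0 (p z), 0),
    fun z => ((fderiv ℝ p z).prod (κ z)).inverse (X 1 (p z), 0),
    fun z => ((fderiv ℝ p z).prod (κ z)).inverse (0, (f z)⁻¹)]

variable {p : E → B} {κ : E → E →L[ℝ] ℝ} {f : E → ℝ} {X : Fin 2 → B → B} {z : E}

theorem liftFrame_castSucc (i : Fin 2) (z : E) : liftFrame p κ f X i.castSucc z =
    ((fderiv ℝ p z).prod (κ z)).inverse (X i (p z), 0) := by
  fin_cases i <;> rfl

theorem fderiv_liftFrame (hi : ((fderiv ℝ p z).prod (κ z)).IsInvertible) (i : Fin 2) :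
    fderiv ℝ p z (liftFrame p κ f X i.castSucc z) = X i (p z) := by
  rw [liftFrame_castSucc]
  exact congrArg Prod.fst (hi.self_apply_inverse (X i (p z), (0 : ℝ)))

theorem form_liftFrame (hi : ((fderiv ℝ p z).prod (κ z)).IsInvertible) (i : Fin 2) :
    κ z (liftFrame p κ f X i.castSucc z) = 0 := by
  rw [liftFrame_castSucc]
  exact congrArg Prod.snd (hi.self_apply_inverse (X i (p z), (0 : ℝ)))

theorem fderiv_liftFrame_two (hi : ((fderiv ℝ p z).prod (κ z)).IsInvertible) :
    fderiv ℝ p z (liftFrame p κ f X 2 z) = 0 :=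
  congrArg Prod.fst (hi.self_apply_inverse ((0 : B), (f z)⁻¹))

theorem form_liftFrame_two (hi : ((fderiv ℝ p z).prod (κ z)).IsInvertible) :
    κ z (liftFrame p κ f X 2 z) = (f z)⁻¹ :=
  congrArg Prod.snd (hi.self_apply_inverse ((0 : B), (f z)⁻¹))

theorem eq_of_fderiv_eq_of_form_eq (hi : ((fderiv ℝ p z).prod (κ z)).IsInvertible) {v w : E}
    (h1 : fderiv ℝ p z v = fderiv ℝ p z w) (h2 : κ z v = κ z w) : v = w :=
  hi.injective (Prod.ext h1 h2)

theorem liftFrame_two_eq (hi : ((fderiv ℝ p z).prod (κ z)).IsInvertible) {ξ : E}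
    (h1 : fderiv ℝ p z ξ = 0) (h2 : κ z ξ = 1) : liftFrame p κ f X 2 z = (f z)⁻¹ • ξ :=
  eq_of_fderiv_eq_of_form_eq hi (by rw [fderiv_liftFrame_two hi, map_smul, h1, smul_zero])
    (by rw [form_liftFrame_two hi, map_smul, h2, smul_eq_mul, mul_one])

/-- Equations that live on the base survive because d commutes with pullback. The two others, for dκ
and df, hold because both dκ and df kill the vertical vector `ξ` provided by `hξ`, the sole input
from the circle action, and so have only horizontal components. -/
theorem isCircleFrame_liftFrame [CompleteSpace E] {z₀ : E} {G : B → B →L[ℝ] B →L[ℝ] ℝ}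
    {Θ : Fin 2 → B → B →L[ℝ] ℝ} {α : B → B →L[ℝ] ℝ} {K : ℝ}
    (hB : IsMovingFrame G Θ X (rotConn α) (p z₀)) (hα : ContDiffAt ℝ ∞ α (p z₀))
    (hK : ∀ u v, extD α (p z₀) u v =
      K * (Θ 0 (p z₀) u * Θ 1 (p z₀) v - Θ 0 (p z₀) v * Θ 1 (p z₀) u))
    (hp : ContDiffAt ℝ ∞ p z₀) (hκ : ContDiffAt ℝ ∞ κ z₀) (hf : ContDiffAt ℝ ∞ f z₀)
    (hpos : ∀ z, 0 < f z)
    (hinv : ∀ᶠ z in 𝓝 z₀, ((fderiv ℝ p z).prod (κ z)).IsInvertible)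
    (hξ : ∀ᶠ z in 𝓝 z₀, ∃ ξ, fderiv ℝ p z ξ = 0 ∧ κ z ξ = 1 ∧ (∀ w, extD κ z ξ w = 0) ∧
      fderiv ℝ f z ξ = 0) :
    IsCircleFrame (fun i => pullForm p (Θ i)) κ (pullForm p α) (liftFrame p κ f X) f
      (fun z => extD κ z (liftFrame p κ f X 0 z) (liftFrame p κ f X 1 z))
      (fun z => fderiv ℝ f z (liftFrame p κ f X 0 z))
      (fun z => fderiv ℝ f z (liftFrame p κ f X 1 z)) K z₀ := by
  have hθs : ∀ i, ContDiffAt ℝ ∞ (pullForm p (Θ i)) z₀ := fun i => hp.pullForm (hB.smooth_coframe i)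
  -- Inversion of continuous linear maps is smooth at an invertible one.
  have hAs : ContDiffAt ℝ ∞ (fun z => ((fderiv ℝ p z).prod (κ z)).inverse) z₀ := by
    have h1 : ContDiffAt ℝ ∞ (fun z => (fderiv ℝ p z).prod (κ z)) z₀ :=
      (ContinuousLinearMap.prodₗᵢ (𝕜 := ℝ) (E := E) (F := B) (G := ℝ) ℝ).contDiff.contDiffAt.comp z₀
        (hp.fderiv_infty.prodMk hκ)
    exact (hinv.self_of_nhds.contDiffAt_map_inverse).comp z₀ h1
  have hfinv : ContDiffAt ℝ ∞ (fun z => (f z)⁻¹) z₀ := hf.inv (hpos z₀).ne'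
  have hes : ∀ i, ContDiffAt ℝ ∞ (liftFrame p κ f X i) z₀ := by
    intro i
    fin_cases i
    · exact hAs.clm_apply (((hB.smooth_frame 0).comp z₀ hp).prodMk contDiffAt_const)
    · exact hAs.clm_apply (((hB.smooth_frame 1).comp z₀ hp).prodMk contDiffAt_const)
    · exact hAs.clm_apply (contDiffAt_const.prodMk hfinv)
  have hpc : ContinuousAt p z₀ := hp.continuousAt
  have hp2 : ∀ᶠ z in 𝓝 z₀, ContDiffAt ℝ 2 p z :=
    (hp.of_le (m := 2) (by norm_cast)).eventually (by decide)
  have hdual : ∀ᶠ z in 𝓝 z₀, ∀ i j : Fin 2,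
      pullForm p (Θ i) z (liftFrame p κ f X j.castSucc z) = if i = j then 1 else 0 := by
    filter_upwards [hpc.eventually hB.dual, hinv] with z hd hi i j
    rw [pullForm, ContinuousLinearMap.comp_apply, fderiv_liftFrame hi, hd]
  have hexp : ∀ᶠ z in 𝓝 z₀, ∀ v, v = pullForm p (Θ 0) z v • liftFrame p κ f X 0 z
      + pullForm p (Θ 1) z v • liftFrame p κ f X 1 z
      + (f z * κ z v) • liftFrame p κ f X 2 z := by
    filter_upwards [hpc.eventually hB.expand, hinv] with z he hi v
    have d0 : fderiv ℝ p z (liftFrame p κ f X 0 z) = _ := fderiv_liftFrame hi 0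
    have d1 : fderiv ℝ p z (liftFrame p κ f X 1 z) = _ := fderiv_liftFrame hi 1
    have k0 : κ z (liftFrame p κ f X 0 z) = _ := form_liftFrame hi 0
    have k1 : κ z (liftFrame p κ f X 1 z) = _ := form_liftFrame hi 1
    refine eq_of_fderiv_eq_of_form_eq hi ?_ ?_
    · simp only [map_add, map_smul, d0, d1, fderiv_liftFrame_two hi, smul_zero, add_zero]
      have := he (fderiv ℝ p z v)
      rw [Fin.sum_univ_two] at this
      exact this.symm
    · simp only [map_add, map_smul, k0, k1, form_liftFrame_two hi, smul_eq_mul, mul_zero, zero_add]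
      field_simp [(hpos z).ne']
  refine ⟨hθs, hκ, hp.pullForm hα, hes, hf, hκ.extD (hes 0) (hes 1),
    hf.fderiv_infty.clm_apply (hes 0), hf.fderiv_infty.clm_apply (hes 1),
    Filter.Eventually.of_forall hpos, hdual, ?_, ?_, ?_, ?_, ?_, ?_, ?_, ?_, ?_⟩
  · filter_upwards [hinv] with z hi j
    exact form_liftFrame hi j
  · filter_upwards [hinv] with z hi i
    rw [pullForm, ContinuousLinearMap.comp_apply, fderiv_liftFrame_two hi, map_zero]
  · filter_upwards [hinv] with z hi
    rw [form_liftFrame_two hi, mul_inv_cancel₀ (hpos z).ne']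
  · filter_upwards [hinv] with z hi
    rw [pullForm, ContinuousLinearMap.comp_apply, fderiv_liftFrame_two hi, map_zero]
  · filter_upwards [hp2, hpc.eventually hB.cartan,
      hpc.eventually (hB.smooth_coframe 0).eventually_differentiableAt] with z hz hc hd u v
    rw [extD_pullForm hz hd, hc, Fin.sum_univ_two]
    simp [rotConn, pullForm]
  · filter_upwards [hp2, hpc.eventually hB.cartan,
      hpc.eventually (hB.smooth_coframe 1).eventually_differentiableAt] with z hz hc hd u v
    rw [extD_pullForm hz hd, hc, Fin.sum_univ_two]
    simp [rotConn, pullForm]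
    ring
  · filter_upwards [hexp, hξ, hinv] with z he ⟨ξ, hξ1, hξ2, hξ3, _⟩ hi u v
    have h2 : ∀ w, extD κ z (liftFrame p κ f X 2 z) w = 0 := by
      intro w
      rw [liftFrame_two_eq hi hξ1 hξ2]
      have := hξ3 w
      simp only [extD, map_smul, smul_apply, smul_eq_mul] at this ⊢
      linear_combination (f z)⁻¹ * this
    have h2' : ∀ w, extD κ z w (liftFrame p κ f X 2 z) = 0 := fun w => by
      rw [extD_antisymm, h2, neg_zero]
    have hm : ∀ (a b : ℝ) c d, extD κ z (a • c) (b • d) = a * b * extD κ z c d := by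
      intro a b c d; simp only [extD, map_smul, smul_apply, smul_eq_mul]; ring
    have hz : ∀ w, extD κ z w w = 0 := extD_self κ z
    -- After bilinear expansion only the coefficient on the two horizontal fields survives.
    conv_lhs => rw [he u, he v]
    have hl1 : ∀ a b c, extD κ z (a + b) c = extD κ z a c + extD κ z b c := by
      intro a b c; simp only [extD, map_add, add_apply]; ring
    have hl2 : ∀ a b c, extD κ z c (a + b) = extD κ z c a + extD κ z c b := by
      intro a b c; simp only [extD, map_add, add_apply]; ring
    simp only [hl1, hl2, hm, hz, h2, h2', extD_antisymm κ z (liftFrame p κ f X 1 z)]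
    ring
  · intro u v
    rw [extD_pullForm hp2.self_of_nhds hα.differentiableAt_infty, hK]
    rfl
  · filter_upwards [hexp, hξ, hinv] with z he ⟨ξ, hξ1, hξ2, _, hξ4⟩ hi
    have h2 : fderiv ℝ f z (liftFrame p κ f X 2 z) = 0 := by
      rw [liftFrame_two_eq hi hξ1 hξ2, map_smul, hξ4, smul_zero]
    ext v
    conv_lhs => rw [he v]
    simp only [map_add, map_smul, h2, smul_eq_mul, add_apply, smul_apply]
    ring

end Lift

end

/-! ### The adapted frame of the bundle in the charts at `y` and `π y` -/

noncomputable section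

section Chart

variable {n : ℕ} {N : Type*} [TopologicalSpace N] [ChartedSpace (EuclideanSpace ℝ (Fin n)) N]

theorem eventually_of_eventually_chart {y : N} {Q : EuclideanSpace ℝ (Fin n) → Prop}
    (h : ∀ᶠ q in 𝓝 y, q ∈ (extChartAt (𝓡 n) y).source → Q (extChartAt (𝓡 n) y q)) :
    ∀ᶠ z in 𝓝 (extChartAt (𝓡 n) y y), Q z := by
  have h1 : Filter.Tendsto (chartInv y) (𝓝 (extChartAt (𝓡 n) y y)) (𝓝 y) := by
    have := continuousAt_extChartAt_symm (I := 𝓡 n) y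
    rw [ContinuousAt, extChartAt_to_inv] at this
    exact this
  filter_upwards [h1.eventually h, extChartAt_target_mem_nhds (I := 𝓡 n) y] with z hz ht
  have := hz (chartInv_mem_source ht)
  rwa [extChartAt_chartInv ht] at this

theorem eventually_chart {y : N} {Q : EuclideanSpace ℝ (Fin n) → Prop}
    (h : ∀ᶠ z in 𝓝 (extChartAt (𝓡 n) y y), Q z) :
    ∀ᶠ q in 𝓝 y, Q (extChartAt (𝓡 n) y q) :=
  (continuousAt_extChartAt (I := 𝓡 n) y).eventually h

end Chart

section Bundle

variable {M : Type*} [TopologicalSpace M] [ChartedSpace (EuclideanSpace ℝ (Fin 2)) M]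
  {P : Type*} [TopologicalSpace P] [ChartedSpace (EuclideanSpace ℝ (Fin 3)) P]
  {π : P → M} {κ : ∀ q : P, TangentSpace (𝓡 3) q →L[ℝ] ℝ}
  {g vol : ∀ x : M, TangentSpace (𝓡 2) x →L[ℝ] TangentSpace (𝓡 2) x →L[ℝ] ℝ}

theorem prod_horizontalLift {q : P} (hi : ((projDeriv π q).prod (κ q)).IsInvertible)
    (a : TangentSpace (𝓡 2) (π q)) :
    (projDeriv π q).prod (κ q) (horizontalLift π κ q a) = (a, 0) :=
  hi.self_apply_inverse (a, 0)

theorem projDeriv_horizontalLift {q : P} (hi : ((projDeriv π q).prod (κ q)).IsInvertible)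
    (a : TangentSpace (𝓡 2) (π q)) : projDeriv π q (horizontalLift π κ q a) = a :=
  congrArg Prod.fst (prod_horizontalLift hi a)

theorem form_horizontalLift {q : P} (hi : ((projDeriv π q).prod (κ q)).IsInvertible)
    (a : TangentSpace (𝓡 2) (π q)) : κ q (horizontalLift π κ q a) = 0 :=
  congrArg Prod.snd (prod_horizontalLift hi a)

theorem IsOrthoCoframe.hstarOne_eq {q : P} (hi : ((projDeriv π q).prod (κ q)).IsInvertible)
    {t : Fin 2 → TangentSpace (𝓡 2) (π q) →L[ℝ] ℝ} {s : ℝ} (h : IsOrthoCoframe g vol (π q) t s)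
    {β : ∀ q : P, TangentSpace (𝓡 3) q →L[ℝ] ℝ} {a₀ a₁ : ℝ}
    (hβ : ∀ w, β q w = a₀ * t 0 (projDeriv π q w) + a₁ * t 1 (projDeriv π q w))
    (w : TangentSpace (𝓡 3) q) :
    hstarOne π g vol κ β q w =
      s * (a₀ * t 1 (projDeriv π q w) - a₁ * t 0 (projDeriv π q w)) := by
  have h1 : hstarOne π g vol κ β q w =
      -(β q (horizontalLift π κ q (rightRotation g vol (π q) (projDeriv π q w)))) := rfl
  obtain ⟨r0, r1⟩ := h.rightRotation_eq (projDeriv π q w)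
  rw [h1, hβ, projDeriv_horizontalLift hi, r0, r1]
  ring

/-- The bundle projection in the preferred charts at `y` and `π y`. -/
def projChart (π : P → M) (y : P) (z : EuclideanSpace ℝ (Fin 3)) : EuclideanSpace ℝ (Fin 2) :=
  extChartAt (𝓡 2) (π y) (π (chartInv y z))

theorem projChart_extChartAt {y q : P} (hq : q ∈ (extChartAt (𝓡 3) y).source) :
    projChart π y (extChartAt (𝓡 3) y q) = extChartAt (𝓡 2) (π y) (π q) := by
  rw [projChart, chartInv_extChartAt hq]

variable [IsManifold (𝓡 2) ∞ M]
  {Θ : Fin 2 → EuclideanSpace ℝ (Fin 2) → EuclideanSpace ℝ (Fin 2) →L[ℝ] ℝ}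
  {E : Fin 2 → EuclideanSpace ℝ (Fin 2) → EuclideanSpace ℝ (Fin 2)}
  {α : EuclideanSpace ℝ (Fin 2) → EuclideanSpace ℝ (Fin 2) →L[ℝ] ℝ} {s : ℝ} {y : P} {f : P → ℝ}

theorem eventually_proj (hπ : ContMDiff (𝓡 3) (𝓡 2) ∞ π) (h : IsBaseFrame g vol (π y) Θ E α s) :
    ∀ᶠ q in 𝓝 y, q ∈ (extChartAt (𝓡 3) y).source ∧ π q ∈ (extChartAt (𝓡 2) (π y)).source ∧
      IsOrthoCoframe g vol (π q) (fun i => baseCoframe (π y) Θ i (π q)) s :=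
  Filter.Eventually.and (extChartAt_source_mem_nhds (I := 𝓡 3) y)
    (hπ.continuous.continuousAt.eventually
      (Filter.Eventually.and (extChartAt_source_mem_nhds (I := 𝓡 2) (π y))
        h.eventually_isOrthoCoframe))

variable [IsManifold (𝓡 3) ∞ P]

theorem fderiv_projChart {y q : P} (hπ : MDifferentiableAt (𝓡 3) (𝓡 2) π q)
    (hq : q ∈ (extChartAt (𝓡 3) y).source) (hx : π q ∈ (extChartAt (𝓡 2) (π y)).source)
    (v : TangentSpace (𝓡 3) q) :
    fderiv ℝ (projChart π y) (extChartAt (𝓡 3) y q) (chartDeriv y q v) =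
      chartDeriv (π y) (π q) (projDeriv π q v) :=
  fderiv_chart_comp hq hx hπ v

theorem pullForm_projChart {y q : P} (hπ : MDifferentiableAt (𝓡 3) (𝓡 2) π q)
    (hq : q ∈ (extChartAt (𝓡 3) y).source) (hx : π q ∈ (extChartAt (𝓡 2) (π y)).source)
    (i : Fin 2) (v : TangentSpace (𝓡 3) q) :
    pullForm (projChart π y) (Θ i) (extChartAt (𝓡 3) y q) (chartDeriv y q v) =
      baseCoframe (π y) Θ i (π q) (projDeriv π q v) := by
  rw [pullForm, ContinuousLinearMap.comp_apply, fderiv_projChart hπ hq hx,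
    projChart_extChartAt hq]
  rfl

theorem chartBilin_connectionMetric (hπ : ContMDiff (𝓡 3) (𝓡 2) ∞ π)
    (h : IsBaseFrame g vol (π y) Θ E α s) :
    ∀ᶠ z in 𝓝 (extChartAt (𝓡 3) y y), ∀ u v, chartBilin (connectionMetric π g κ f) y z u v =
      pullForm (projChart π y) (Θ 0) z u * pullForm (projChart π y) (Θ 0) z v
      + pullForm (projChart π y) (Θ 1) z u * pullForm (projChart π y) (Θ 1) z v
      + (f ∘ chartInv y) z ^ 2 * (chartForm κ y z u * chartForm κ y z v) := by
  refine eventually_of_eventually_chart ?_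
  filter_upwards [eventually_proj hπ h] with q ⟨hq, hx, ho⟩ _ u v
  obtain ⟨u, rfl⟩ := chartDeriv_surjective hq u
  obtain ⟨v, rfl⟩ := chartDeriv_surjective hq v
  have hd : MDifferentiableAt (𝓡 3) (𝓡 2) π q := (hπ q).mdifferentiableAt (by simp)
  simp only [pullForm_projChart hd hq hx, chartForm_chartDeriv κ hq, chartBilin_chartDeriv _ hq,
    Function.comp_apply, chartInv_extChartAt hq]
  have h1 : connectionMetric π g κ f q u v = g (π q) (projDeriv π q u) (projDeriv π q v)
      + f q ^ 2 * (κ q u * κ q v) := rfl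
  rw [h1, ho.metric]

variable [MulAction Circle P]

theorem isInvertible_projChart (hπ : IsPrincipalCircleBundle π) (hκ : IsConnectionForm κ) {q : P}
    (hq : q ∈ (extChartAt (𝓡 3) y).source) (hx : π q ∈ (extChartAt (𝓡 2) (π y)).source) :
    ((fderiv ℝ (projChart π y) (extChartAt (𝓡 3) y q)).prod
      (chartForm κ y (extChartAt (𝓡 3) y q))).IsInvertible := by
  refine isInvertible_of_injective _ (by simp) ((injective_iff_map_eq_zero _).2 fun v hv => ?_)
  obtain ⟨w, rfl⟩ := chartDeriv_surjective hq v
  have h1 : fderiv ℝ (projChart π y) (extChartAt (𝓡 3) y q) (chartDeriv y q w) = 0 :=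
    congrArg Prod.fst hv
  have h2 : chartForm κ y (extChartAt (𝓡 3) y q) (chartDeriv y q w) = 0 := congrArg Prod.snd hv
  rw [fderiv_projChart ((hπ.smooth_proj q).mdifferentiableAt (by simp)) hq hx] at h1
  rw [chartForm_chartDeriv κ hq] at h2
  have h3 := chartDeriv_eq_zero hx h1
  have h4 : w = 0 := (hπ.isInvertible_prod hκ q).injective (by
    rw [map_zero]; exact Prod.ext h3 h2)
  rw [h4, map_zero]

/-- The adapted frame of a circle bundle in a chart, lifted from a frame of the base. -/
theorem isCircleFrame_projChart (hπ : IsPrincipalCircleBundle π) (hκ : IsConnectionForm κ)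
    (h : IsBaseFrame g vol (π y) Θ E α s) (hf : ContMDiff (𝓡 3) 𝓘(ℝ, ℝ) ∞ f)
    (hpos : ∀ q, 0 < f q) (hinv : ∀ (a : Circle) (q : P), f (a • q) = f q) :
    IsCircleFrame (fun i => pullForm (projChart π y) (Θ i)) (chartForm κ y)
      (pullForm (projChart π y) α)
      (liftFrame (projChart π y) (chartForm κ y) (f ∘ chartInv y) E) (f ∘ chartInv y)
      (fun z => extD (chartForm κ y) z
        (liftFrame (projChart π y) (chartForm κ y) (f ∘ chartInv y) E 0 z)
        (liftFrame (projChart π y) (chartForm κ y) (f ∘ chartInv y) E 1 z))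
      (fun z => fderiv ℝ (f ∘ chartInv y) z
        (liftFrame (projChart π y) (chartForm κ y) (f ∘ chartInv y) E 0 z))
      (fun z => fderiv ℝ (f ∘ chartInv y) z
        (liftFrame (projChart π y) (chartForm κ y) (f ∘ chartInv y) E 1 z))
      (gaussCurvature g (π y)) (extChartAt (𝓡 3) y y) := by
  have ht : extChartAt (𝓡 3) y y ∈ (extChartAt (𝓡 3) y).target := mem_extChartAt_target y
  have hp0 : projChart π y (extChartAt (𝓡 3) y y) = extChartAt (𝓡 2) (π y) (π y) :=
    projChart_extChartAt (mem_extChartAt_source y)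
  have hyy : chartInv y (extChartAt (𝓡 3) y y) = y := chartInv_extChartAt (mem_extChartAt_source y)
  have hπd : ∀ q, MDifferentiableAt (𝓡 3) (𝓡 2) π q := fun q =>
    (hπ.smooth_proj q).mdifferentiableAt (by simp)
  refine isCircleFrame_liftFrame (G := chartBilin g (π y)) ?_ ?_ ?_ ?_
    (contDiffAt_chartForm hκ.smooth ht) (contDiffAt_comp_chartInv ht (hf _)) (fun z => hpos _) ?_ ?_
  · rw [hp0]; exact h.frame
  · rw [hp0]; exact h.smooth_conn
  · rw [hp0]; exact h.gauss
  · refine contDiffAt_comp_chartInv (h := fun q => extChartAt (𝓡 2) (π y) (π q)) ht ?_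
    refine (contMDiffAt_chart ?_).comp _ (hπ.smooth_proj _)
    rw [hyy]; exact mem_extChartAt_source (π y)
  · refine eventually_of_eventually_chart ?_
    filter_upwards [eventually_proj hπ.smooth_proj h] with q ⟨hq, hx, _⟩ _
    exact isInvertible_projChart hπ hκ hq hx
  · refine eventually_of_eventually_chart ?_
    filter_upwards [eventually_proj hπ.smooth_proj h] with q ⟨hq, hx, _⟩ _
    -- The vertical vector is the fundamental field. The four conditions are: `π` is invariant, `κ`
    -- is normalized, the curvature is horizontal, and `f` is invariant.
    refine ⟨chartDeriv y q (fundamentalField q), ?_, ?_, fun w => ?_, ?_⟩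
    · rw [fderiv_projChart (hπd q) hq hx]
      refine (congrArg (chartDeriv (π y) (π q)) ?_).trans (map_zero _)
      exact hπ.mfderiv_fundamentalField (hπd q) hπ.proj_smul
    · rw [chartForm_chartDeriv κ hq, hκ.fundamental]
    · obtain ⟨w, rfl⟩ := chartDeriv_surjective hq w
      rw [← dForm_eq_extD hq (contDiffAt_chartForm hκ.smooth
        ((extChartAt (𝓡 3) y).map_source hq)).differentiableAt_infty]
      exact hπ.dForm_fundamentalField hκ q w
    · rw [fderiv_comp_chartInv hq ((hf q).mdifferentiableAt (by simp))]
      exact hπ.mfderiv_fundamentalField ((hf q).mdifferentiableAt (by simp)) hinv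

end Bundle

end

/-! ### Hodge stars, norm and Laplacian in the adapted frame -/

noncomputable section

section Bundle

variable {M : Type*} [TopologicalSpace M] [ChartedSpace (EuclideanSpace ℝ (Fin 2)) M]
  [IsManifold (𝓡 2) ∞ M]
  {P : Type*} [TopologicalSpace P] [ChartedSpace (EuclideanSpace ℝ (Fin 3)) P]
  [IsManifold (𝓡 3) ∞ P] [MulAction Circle P]
  {π : P → M} {κ : ∀ q : P, TangentSpace (𝓡 3) q →L[ℝ] ℝ}
  {g vol : ∀ x : M, TangentSpace (𝓡 2) x →L[ℝ] TangentSpace (𝓡 2) x →L[ℝ] ℝ}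
  {Θ : Fin 2 → EuclideanSpace ℝ (Fin 2) → EuclideanSpace ℝ (Fin 2) →L[ℝ] ℝ}
  {E : Fin 2 → EuclideanSpace ℝ (Fin 2) → EuclideanSpace ℝ (Fin 2)}
  {α : EuclideanSpace ℝ (Fin 2) → EuclideanSpace ℝ (Fin 2) →L[ℝ] ℝ} {s : ℝ} {y : P} {f : P → ℝ}
  {γ : EuclideanSpace ℝ (Fin 3) → EuclideanSpace ℝ (Fin 3) →L[ℝ] ℝ}
  {e : Fin 3 → EuclideanSpace ℝ (Fin 3) → EuclideanSpace ℝ (Fin 3)}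
  {f' F f₀ f₁ : EuclideanSpace ℝ (Fin 3) → ℝ} {K : ℝ}

/-- Both sides project to the same base vector and are killed by the connection form, and these two
data determine a vector. -/
theorem chartDeriv_horizontalLift (hπ : IsPrincipalCircleBundle π) (hκ : IsConnectionForm κ)
    {φ : EuclideanSpace ℝ (Fin 3) → ℝ} {i : Fin 2} {a : TangentSpace (𝓡 2) (π y)}
    (hE : E i (extChartAt (𝓡 2) (π y) (π y)) = chartDeriv (π y) (π y) a) :
    chartDeriv y y (horizontalLift π κ y a) =
      liftFrame (projChart π y) (chartForm κ y) φ E i.castSucc (extChartAt (𝓡 3) y y) := by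
  have hy := mem_extChartAt_source (I := 𝓡 3) y
  have hx := mem_extChartAt_source (I := 𝓡 2) (π y)
  have hi := isInvertible_projChart hπ hκ hy hx
  have hq := hπ.isInvertible_prod hκ y
  refine eq_of_fderiv_eq_of_form_eq hi ?_ ?_
  · rw [fderiv_projChart ((hπ.smooth_proj y).mdifferentiableAt (by simp)) hy hx,
      fderiv_liftFrame hi, projDeriv_horizontalLift hq, projChart_extChartAt hy, hE]
  · rw [chartForm_chartDeriv κ hy, form_horizontalLift hq, form_liftFrame hi]

theorem chartDeriv_fundamentalField (hπ : IsPrincipalCircleBundle π) (hκ : IsConnectionForm κ) :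
    chartDeriv y y ((f y)⁻¹ • fundamentalField y) =
      liftFrame (projChart π y) (chartForm κ y) (f ∘ chartInv y) E 2 (extChartAt (𝓡 3) y y) := by
  have hy := mem_extChartAt_source (I := 𝓡 3) y
  have hx := mem_extChartAt_source (I := 𝓡 2) (π y)
  have hd : MDifferentiableAt (𝓡 3) (𝓡 2) π y := (hπ.smooth_proj y).mdifferentiableAt (by simp)
  rw [liftFrame_two_eq (ξ := chartDeriv y y (fundamentalField y))
    (isInvertible_projChart hπ hκ hy hx), Function.comp_apply, chartInv_extChartAt hy, map_smul]
  · rw [fderiv_projChart hd hy hx]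
    refine (congrArg (chartDeriv (π y) (π y)) ?_).trans (map_zero _)
    exact hπ.mfderiv_fundamentalField hd hπ.proj_smul
  · rw [chartForm_chartDeriv κ hy, hκ.fundamental]

section Frame

variable (hπ : IsPrincipalCircleBundle π) (hκ : IsConnectionForm κ)
  (h : IsBaseFrame g vol (π y) Θ E α s)
  (C : IsCircleFrame (fun i => pullForm (projChart π y) (Θ i)) (chartForm κ y) γ e
    f' F f₀ f₁ K (extChartAt (𝓡 3) y y))

include hπ hκ h C

theorem eventually_curvatureForm_eq : ∀ᶠ q in 𝓝 y, ∀ a b : TangentSpace (𝓡 3) q,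
    curvatureForm κ q a b = F (extChartAt (𝓡 3) y q) *
      (baseCoframe (π y) Θ 0 (π q) (projDeriv π q a) * baseCoframe (π y) Θ 1 (π q) (projDeriv π q b)
      - baseCoframe (π y) Θ 0 (π q) (projDeriv π q b) *
        baseCoframe (π y) Θ 1 (π q) (projDeriv π q a)) := by
  filter_upwards [eventually_proj hπ.smooth_proj h, eventually_chart C.curvature]
    with q ⟨hq, hx, ho⟩ hc a b
  have hd : MDifferentiableAt (𝓡 3) (𝓡 2) π q := (hπ.smooth_proj q).mdifferentiableAt (by simp)
  rw [curvatureForm, dForm_eq_extD hq (contDiffAt_chartForm hκ.smooth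
        ((extChartAt (𝓡 3) y).map_source hq)).differentiableAt_infty, hc]
  simp only [pullForm_projChart hd hq hx]

/-- Stated on a neighbourhood because the mixed block differentiates this function. -/
theorem eventually_hstarTwo_curvatureForm :
    ∀ᶠ q in 𝓝 y, hstarTwo π vol κ (curvatureForm κ) q = s * F (extChartAt (𝓡 3) y q) := by
  filter_upwards [eventually_proj hπ.smooth_proj h, eventually_curvatureForm_eq hπ hκ h C]
    with q ⟨_, _, ho⟩ hc
  refine ho.starTwo_eq fun a b => ?_
  have hi := hπ.isInvertible_prod hκ q
  rw [hc, projDeriv_horizontalLift hi, projDeriv_horizontalLift hi]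

theorem hnormSqTwo_curvatureForm :
    hnormSqTwo π g κ (curvatureForm κ) y = F (extChartAt (𝓡 3) y y) ^ 2 := by
  obtain ⟨_, _, ho⟩ := (eventually_proj hπ.smooth_proj h).self_of_nhds
  refine ho.normSqTwo_eq fun a b => ?_
  have hi := hπ.isInvertible_prod hκ y
  rw [(eventually_curvatureForm_eq hπ hκ h C).self_of_nhds, projDeriv_horizontalLift hi,
    projDeriv_horizontalLift hi]

/-- One sign comes from the star of the curvature and one from the star of its differential, so `s`
drops out. The differential has no vertical component by `IsCircleFrame.deriv_F_vertical`. -/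
theorem hstarOne_dFun_curvature (w : TangentSpace (𝓡 3) y) :
    hstarOne π g vol κ (dFun (hstarTwo π vol κ (curvatureForm κ))) y w =
      fderiv ℝ F (extChartAt (𝓡 3) y y) (e 0 (extChartAt (𝓡 3) y y)) *
        baseCoframe (π y) Θ 1 (π y) (projDeriv π y w)
      - fderiv ℝ F (extChartAt (𝓡 3) y y) (e 1 (extChartAt (𝓡 3) y y)) *
        baseCoframe (π y) Θ 0 (π y) (projDeriv π y w) := by
  have hy := mem_extChartAt_source (I := 𝓡 3) y
  have hx := mem_extChartAt_source (I := 𝓡 2) (π y)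
  have hd : MDifferentiableAt (𝓡 3) (𝓡 2) π y := (hπ.smooth_proj y).mdifferentiableAt (by simp)
  obtain ⟨_, _, ho⟩ := (eventually_proj hπ.smooth_proj h).self_of_nhds
  have hF : MDifferentiableAt (𝓡 3) 𝓘(ℝ, ℝ) (fun q => s * F (extChartAt (𝓡 3) y q)) y :=
    ((C.smooth_F.differentiableAt_infty.const_mul s).mdifferentiableAt).comp y
      (mdifferentiableAt_chart hy)
  have hw : ∀ w : TangentSpace (𝓡 3) y, dFun (hstarTwo π vol κ (curvatureForm κ)) y w =
      s * fderiv ℝ F (extChartAt (𝓡 3) y y) (e 0 (extChartAt (𝓡 3) y y)) *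
        baseCoframe (π y) Θ 0 (π y) (projDeriv π y w)
      + s * fderiv ℝ F (extChartAt (𝓡 3) y y) (e 1 (extChartAt (𝓡 3) y y)) *
        baseCoframe (π y) Θ 1 (π y) (projDeriv π y w) := by
    intro w
    have he : hstarTwo π vol κ (curvatureForm κ) =ᶠ[𝓝 y] fun q => s * F (extChartAt (𝓡 3) y q) :=
      eventually_hstarTwo_curvatureForm hπ hκ h C
    have h1 : dFun (hstarTwo π vol κ (curvatureForm κ)) y w =
        s * fderiv ℝ F (extChartAt (𝓡 3) y y) (chartDeriv y y w) := by
      have h2 : mfderiv (𝓡 3) 𝓘(ℝ, ℝ) (hstarTwo π vol κ (curvatureForm κ)) y w =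
          mfderiv (𝓡 3) 𝓘(ℝ, ℝ) (fun q => s * F (extChartAt (𝓡 3) y q)) y w := by
        rw [he.mfderiv_eq]; rfl
      refine h2.trans ?_
      rw [← fderiv_comp_chartInv hy hF]
      have h3 : (fun q => s * F (extChartAt (𝓡 3) y q)) ∘ chartInv y
          =ᶠ[𝓝 (extChartAt (𝓡 3) y y)] fun z => s * F z := by
        filter_upwards [extChartAt_target_mem_nhds (I := 𝓡 3) y] with z hz
        rw [Function.comp_apply, extChartAt_chartInv hz]
      rw [h3.fderiv_eq, fderiv_const_mul C.smooth_F.differentiableAt_infty]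
      rfl
    rw [h1, ← (C.expand (by simp)).self_of_nhds (chartDeriv y y w)]
    simp only [map_add, map_smul, C.deriv_F_vertical, pullForm_projChart hd hy hx, smul_eq_mul]
    ring
  rw [ho.hstarOne_eq (hπ.isInvertible_prod hκ y) hw]
  linear_combination (fderiv ℝ F (extChartAt (𝓡 3) y y) (e 0 (extChartAt (𝓡 3) y y)) *
        baseCoframe (π y) Θ 1 (π y) (projDeriv π y w)
      - fderiv ℝ F (extChartAt (𝓡 3) y y) (e 1 (extChartAt (𝓡 3) y y)) *
        baseCoframe (π y) Θ 0 (π y) (projDeriv π y w)) * h.sign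

theorem eventually_hstarOne_dFun (hf : ContMDiff (𝓡 3) 𝓘(ℝ, ℝ) ∞ f) (hf' : f' = f ∘ chartInv y) :
    ∀ᶠ q in 𝓝 y, ∀ w : TangentSpace (𝓡 3) q, hstarOne π g vol κ (dFun f) q w =
      s * (f₀ (extChartAt (𝓡 3) y q) * baseCoframe (π y) Θ 1 (π q) (projDeriv π q w)
        - f₁ (extChartAt (𝓡 3) y q) * baseCoframe (π y) Θ 0 (π q) (projDeriv π q w)) := by
  filter_upwards [eventually_proj hπ.smooth_proj h, eventually_chart C.deriv_f]
    with q ⟨hq, hx, ho⟩ hc w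
  have hd : MDifferentiableAt (𝓡 3) (𝓡 2) π q := (hπ.smooth_proj q).mdifferentiableAt (by simp)
  refine ho.hstarOne_eq (hπ.isInvertible_prod hκ q) (fun w => ?_) w
  have h1 : dFun f q w = _ := (fderiv_comp_chartInv hq ((hf q).mdifferentiableAt (by simp)) w).symm
  rw [h1, ← hf', hc, add_apply, smul_apply, smul_apply, pullForm_projChart hd hq hx,
    pullForm_projChart hd hq hx]
  rfl

theorem hstarTwo_curvatureForm_mul_hstarOne_dFun (hf : ContMDiff (𝓡 3) 𝓘(ℝ, ℝ) ∞ f)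
    (hf' : f' = f ∘ chartInv y) (w : TangentSpace (𝓡 3) y) :
    hstarTwo π vol κ (curvatureForm κ) y * hstarOne π g vol κ (dFun f) y w =
      F (extChartAt (𝓡 3) y y) *
        (f₀ (extChartAt (𝓡 3) y y) * baseCoframe (π y) Θ 1 (π y) (projDeriv π y w)
          - f₁ (extChartAt (𝓡 3) y y) * baseCoframe (π y) Θ 0 (π y) (projDeriv π y w)) := by
  rw [(eventually_hstarTwo_curvatureForm hπ hκ h C).self_of_nhds,
    (eventually_hstarOne_dFun hπ hκ h C hf hf').self_of_nhds]
  linear_combination F (extChartAt (𝓡 3) y y) *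
        (f₀ (extChartAt (𝓡 3) y y) * baseCoframe (π y) Θ 1 (π y) (projDeriv π y w)
          - f₁ (extChartAt (𝓡 3) y y) * baseCoframe (π y) Θ 0 (π y) (projDeriv π y w)) * h.sign

/-- The inner star gives `s` times the form in the brackets near `y`, the outer star gives the
second `s`, and horizontal lifts involve only the first two frame vectors. -/
theorem baseLaplacian_eq (hf : ContMDiff (𝓡 3) 𝓘(ℝ, ℝ) ∞ f) (hf' : f' = f ∘ chartInv y) :
    baseLaplacian π g vol κ f y = -extD (fun z => f₀ z • pullForm (projChart π y) (Θ 1) z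
      - f₁ z • pullForm (projChart π y) (Θ 0) z) (extChartAt (𝓡 3) y y)
      (e 0 (extChartAt (𝓡 3) y y)) (e 1 (extChartAt (𝓡 3) y y)) := by
  have hy := mem_extChartAt_source (I := 𝓡 3) y
  have hx := mem_extChartAt_source (I := 𝓡 2) (π y)
  have hd : MDifferentiableAt (𝓡 3) (𝓡 2) π y := (hπ.smooth_proj y).mdifferentiableAt (by simp)
  have hi := hπ.isInvertible_prod hκ y
  obtain ⟨_, _, ho⟩ := (eventually_proj hπ.smooth_proj h).self_of_nhds
  set z₀ := extChartAt (𝓡 3) y y with hz₀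
  set X : EuclideanSpace ℝ (Fin 3) → EuclideanSpace ℝ (Fin 3) →L[ℝ] ℝ := fun z =>
    f₀ z • pullForm (projChart π y) (Θ 1) z - f₁ z • pullForm (projChart π y) (Θ 0) z with hX
  have hXd : DifferentiableAt ℝ X z₀ :=
    (C.smooth_f₀.differentiableAt_infty.smul (C.smooth_coframe 1).differentiableAt_infty).sub
      (C.smooth_f₁.differentiableAt_infty.smul (C.smooth_coframe 0).differentiableAt_infty)
  have hform : chartForm (hstarOne π g vol κ (dFun f)) y =ᶠ[𝓝 z₀] fun z => s • X z := by
    refine eventually_of_eventually_chart ?_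
    filter_upwards [eventually_proj hπ.smooth_proj h,
      eventually_hstarOne_dFun hπ hκ h C hf hf'] with q ⟨hq, hx, _⟩ hs _
    have hd : MDifferentiableAt (𝓡 3) (𝓡 2) π q := (hπ.smooth_proj q).mdifferentiableAt (by simp)
    refine ContinuousLinearMap.ext fun v => ?_
    obtain ⟨v, rfl⟩ := chartDeriv_surjective hq v
    rw [chartForm_chartDeriv _ hq, hs]
    simp only [hX, smul_apply, sub_apply, pullForm_projChart hd hq hx, smul_eq_mul]
  have hlift : ∀ a, chartDeriv y y (horizontalLift π κ y a) =
      baseCoframe (π y) Θ 0 (π y) a • e 0 z₀ + baseCoframe (π y) Θ 1 (π y) a • e 1 z₀ := by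
    intro a
    have := (C.expand (by simp)).self_of_nhds (chartDeriv y y (horizontalLift π κ y a))
    rw [pullForm_projChart hd hy hx, pullForm_projChart hd hy hx, chartForm_chartDeriv κ hy,
      form_horizontalLift hi, projDeriv_horizontalLift hi, mul_zero, zero_smul, add_zero] at this
    exact this.symm
  have hm : ∀ a b : TangentSpace (𝓡 2) (π y), dForm (hstarOne π g vol κ (dFun f)) y
      (horizontalLift π κ y a) (horizontalLift π κ y b) = s * extD X z₀ (e 0 z₀) (e 1 z₀) *
      (baseCoframe (π y) Θ 0 (π y) a * baseCoframe (π y) Θ 1 (π y) b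
        - baseCoframe (π y) Θ 0 (π y) b * baseCoframe (π y) Θ 1 (π y) a) := by
    intro a b
    have h1 : dForm (hstarOne π g vol κ (dFun f)) y
        (horizontalLift π κ y a) (horizontalLift π κ y b) =
        extD (chartForm (hstarOne π g vol κ (dFun f)) y) z₀
          (chartDeriv y y (horizontalLift π κ y a)) (chartDeriv y y (horizontalLift π κ y b)) := rfl
    rw [h1, hlift, hlift, extD, extD, hform.fderiv_eq, show (fun z => s • X z) = s • X from rfl, fderiv_const_smul hXd]
    simp only [map_add, map_smul, add_apply, smul_apply, smul_eq_mul]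
    ring
  rw [baseLaplacian, hstarTwo, ho.starTwo_eq hm]
  linear_combination -(extD X z₀ (e 0 z₀) (e 1 z₀)) * h.sign

end Frame

end Bundle

end

/-! ### Comparison of the frame computation with the invariant formulas -/

theorem proposition3
    {M : Type*} [TopologicalSpace M] [ChartedSpace (EuclideanSpace ℝ (Fin 2)) M]
    [IsManifold (𝓡 2) ∞ M]
    {P : Type*} [TopologicalSpace P] [ChartedSpace (EuclideanSpace ℝ (Fin 3)) P]
    [IsManifold (𝓡 3) ∞ P] [MulAction Circle P]
    (π : P → M) (hπ : IsPrincipalCircleBundle π)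
    (g : Bundle.ContMDiffRiemannianMetric (𝓡 2) ∞ (EuclideanSpace ℝ (Fin 2))
      (fun x : M => TangentSpace (𝓡 2) x))
    (vol : ∀ x : M, TangentSpace (𝓡 2) x →L[ℝ] TangentSpace (𝓡 2) x →L[ℝ] ℝ)
    (hvol : IsAreaForm g.inner vol)
    (ωA : ∀ y : P, TangentSpace (𝓡 3) y →L[ℝ] ℝ) (hω : IsConnectionForm ωA)
    (f : P → ℝ) (hf : ContMDiff (𝓡 3) 𝓘(ℝ, ℝ) ∞ f) (hf_pos : ∀ y, 0 < f y)
    (hf_inv : ∀ (a : Circle) (y : P), f (a • y) = f y)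
    (y : P) (u : Fin 2 → TangentSpace (𝓡 2) (π y))
    (hu : ∀ i j, g.inner (π y) (u i) (u j) = if i = j then 1 else 0) :
    let e := adaptedFrame π ωA f y u
    let 𝓢 : Matrix (Fin 2) (Fin 1) ℝ :=
      Matrix.of fun i k => mixedBlock π g.inner vol ωA f y (e (Sum.inl i)) (e (Sum.inr k))
    (Matrix.of fun i j => ricci (connectionMetric π g.inner ωA f) y (e i) (e j)) =
      Matrix.fromBlocks
        (Matrix.of fun i j => horizontalBlock π g.inner ωA f y (e (Sum.inl i)) (e (Sum.inl j)))
        𝓢 𝓢.transpose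
        (Matrix.of fun _ _ => verticalBlock π g.inner vol ωA f y) := by
  intro e 𝓢
  -- The base frame extends the given `u`, so at `y` its lift is exactly the coordinate expression
  -- of the adapted frame.
  obtain ⟨Θ, E, α, s, h, hE⟩ := exists_isBaseFrame g hvol (π y) u hu
  have C := isCircleFrame_projChart hπ hω h hf hf_pos hf_inv
  have hy := mem_extChartAt_source (I := 𝓡 3) y
  have hi := hπ.isInvertible_prod hω y
  have hfy : (f ∘ chartInv y) (extChartAt (𝓡 3) y y) = f y := by
    rw [Function.comp_apply, chartInv_extChartAt hy]
  have hfne : f y ≠ 0 := (hf_pos y).ne'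
  obtain ⟨r, r02, r12, r20, r21, r22⟩ := C.ricci (chartBilin_connectionMetric hπ.smooth_proj h)
  have hN := hnormSqTwo_curvatureForm hπ hω h C
  have hS := hstarTwo_curvatureForm_mul_hstarOne_dFun hπ hω h C hf rfl
  have hdF := hstarOne_dFun_curvature hπ hω h C
  have hL := baseLaplacian_eq hπ hω h C hf rfl
  have e0 : ∀ i, chartVec y (e (Sum.inl i)) = liftFrame (projChart π y) (chartForm ωA y)
      (f ∘ chartInv y) E i.castSucc (extChartAt (𝓡 3) y y) := fun i =>
    chartDeriv_horizontalLift hπ hω (hE i)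
  have e2 : ∀ k, chartVec y (e (Sum.inr k)) = liftFrame (projChart π y) (chartForm ωA y)
      (f ∘ chartInv y) E 2 (extChartAt (𝓡 3) y y) := fun _ => chartDeriv_fundamentalField hπ hω
  have hp : ∀ i, projDeriv π y (e (Sum.inl i)) = u i := fun i => projDeriv_horizontalLift hi (u i)
  have ht : ∀ i j, baseCoframe (π y) Θ i (π y) (u j) = if i = j then 1 else 0 := by
    intro i j
    have := h.frame.dual.self_of_nhds i j
    rw [hE] at this
    exact this
  have hω2 : ∀ k, ωA y (e (Sum.inr k)) = (f y)⁻¹ := fun k => by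
    change ωA y ((f y)⁻¹ • fundamentalField y) = _
    rw [map_smul, hω.fundamental, smul_eq_mul, mul_one]
  have hric : ∀ v w, ricci (connectionMetric π g.inner ωA f) y v w =
      flatRicci (chartBilin (connectionMetric π g.inner ωA f) y) (extChartAt (𝓡 3) y y)
        (chartVec y v) (chartVec y w) := fun _ _ => rfl
  have hhess : ∀ v w, hessian (connectionMetric π g.inner ωA f) f y v w =
      flatHessian (chartBilin (connectionMetric π g.inner ωA f) y) (f ∘ chartInv y)
        (extChartAt (𝓡 3) y y) (chartVec y v) (chartVec y w) := fun _ _ => rfl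
  simp only [hfy] at r r02 r12 r20 r21 r22
  have hmix : ∀ i k, mixedBlock π g.inner vol ωA f y (e (Sum.inl i)) (e (Sum.inr k)) =
      flatRicci (chartBilin (connectionMetric π g.inner ωA f) y) (extChartAt (𝓡 3) y y)
        (chartVec y (e (Sum.inl i))) (chartVec y (e (Sum.inr k))) := by
    intro i k
    -- Reassociating brings the two stars in the second term together; only their product is
    -- independent of the orientation of `u`.
    rw [mixedBlock, mul_assoc (3 / 2 * f y), hS, hdF, hp, hω2, ht, ht, e0, e2]
    fin_cases i
    · refine Eq.trans ?_ r02.symm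
      simp only [Fin.zero_eta, Fin.isValue, one_ne_zero, if_true, if_false]
      field_simp
      ring
    · refine Eq.trans ?_ r12.symm
      simp only [Fin.mk_one, Fin.isValue, zero_ne_one, if_true, if_false]
      field_simp
      ring
  have hmix' : ∀ i k, mixedBlock π g.inner vol ωA f y (e (Sum.inl i)) (e (Sum.inr k)) =
      flatRicci (chartBilin (connectionMetric π g.inner ωA f) y) (extChartAt (𝓡 3) y y)
        (chartVec y (e (Sum.inr k))) (chartVec y (e (Sum.inl i))) := by
    intro i k
    rw [hmix, e0, e2]
    fin_cases i
    · exact r02.trans r20.symm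
    · exact r12.trans r21.symm
  ext (i | i) (j | j)
  · change ricci _ y _ _ = horizontalBlock π g.inner ωA f y _ _
    rw [horizontalBlock, hric, hhess, hN, hp, hp, hu, e0, e0, r]
  · exact (hmix i j).symm
  · exact (hmix' j i).symm
  · change ricci _ y _ _ = verticalBlock π g.inner vol ωA f y
    rw [hric, e2, e2, r22, verticalBlock, hN, hL]
    ring
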